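/- Let $N$ be a non-empty smooth 6-manifold with an $SU(3)$-structure $(g_6,\omega,\Omega)$: a Riemannian metric $g_6$, an orthogonal almost complex structure $J$, the Hermitian form $\omega=g_6(J\cdot,\cdot)$ and a nowhere-vanishing complex form $\Omega$ of type $(3,0)$, with $\Omega\wedge\omega=\bar\Omega\wedge\omega=0$, $\omega^3=6\,\mathrm{vol}_6$, $\Omega\wedge\bar\Omega=-8i\,\mathrm{vol}_6$, where $\mathrm{vol}_6$ is the volume form of $g_6$. Assume that for a constant $\lambda\in\mathbb R$ $$d\omega=-3\lambda\,\mathrm{Re}\,\Omega,\qquad d\Omega=2\lambda i\,\omega^2,\qquad d(\omega^2)=0$$ (Calabi–Yau for $\lambda=0$, nearly Kähler for $\lambda\neq0$). Let $L$ be a smooth 1-manifold with a nowhere-vanishing smooth 1-form $dr$ (the differential of a local coordinate $r$), and write $f'=\partial f/\partial r$, i.e. $df=f'\,dr$. Let $S\subseteq\mathbb R$ be a time interval with more than one point (for instance $[0,T)$), and let $G,h,\theta$ be real functions of $(t,r)\in S\times L$, smooth on $S\times L$, with $G>0$ and $h$ nowhere zero. Put $F=he^{i\theta/3}$, and for each $t$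 consider on $M=N\times L$ the warped $G_2$-structure $$\varphi=\mathrm{Re}(F^3\Omega)+Gh^2\,dr\wedge\omega,\qquad \psi=\tfrac12h^4\omega^2+\mathrm{Im}(F^3\Omega)\wedge G\,dr,$$ $$g_7=G^2dr^2+h^2g_6,\qquad \mathrm{vol}_7=Gh^6\,\mathrm{vol}_6\wedge dr .$$ Let $*$ and $\Delta=dd^*+d^*d$ be the Hodge star and Hodge Laplacian of $(g_7,\mathrm{vol}_7)$, and let $T_{am}=\frac1{24}(\nabla_a\varphi_{bcd})\psi_m{}^{bcd}$ be the full torsion tensor, with $\nabla$ the Levi-Civita connection of $g_7$ and trace $\mathrm{Tr}\,T=g_7^{am}T_{am}$. Set $$\alpha=\frac{\theta'}{G},\qquad \beta=\lambda h^{-1}\sin\theta,\qquad \gamma=\frac{h'}{h}+\lambda h^{-1}G\cos\theta .$$ Suppose that the structure is co-closed, $d\psi=0$, for all $t\in S$, and let $k,C\in\mathbb R$. Then $\mathrm{Tr}\,T=\alpha-6\beta$ and $\gamma=0$, and the modified Laplacian coflow $$\frac{\partial\psi}{\partial t}=\Delta\psi+k\,d\big((C-\mathrm{Tr}\,T)\varphi\big)\quad\text{for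 all } t\in S$$ is equivalent to the system, on $S\times L$, $$\frac{\dot G}{G}=(1-k)\alpha^2+3\beta^2+6k\alpha\beta+kC\alpha,$$ $$\dot\theta=(k-1)G^{-1}(\alpha-6\beta)',$$ $$\frac{\dot h}{h}=3(1-2k)\beta^2+(k-1)\alpha\beta-kC\beta .$$ Moreover, if the coflow holds, then on $S\times L$ $$\dot\alpha=(k-1)G^{-2}\Big(-\frac{G'}{G}(\mathrm{Tr}\,T)'+(\mathrm{Tr}\,T)''\Big)+(k-1)\alpha^3-6k\beta\alpha^2-3\beta^2\alpha-kC\alpha^2,$$ and, wherever $\alpha+\beta\neq0$, $$\dot\beta=(k-1)G^{-2}(\mathrm{Tr}\,T)'\,\frac{\beta'}{\alpha+\beta}+(1-k)\beta^2\alpha+3(2k-1)\beta^3+kC\beta^2,$$ where $\mathrm{Tr}\,T=\alpha-6\beta$. Dots and, at end points of $S$, smoothness and time derivatives are understood within $S$. -/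

import Mathlib

open scoped Manifold

noncomputable section

/-! ## Multilinear algebra on one tangent space -/

section PointwiseAlgebra

variable {V : Type*} [AddCommGroup V] [Module ℝ V] [TopologicalSpace V]

/-- The product `v ↦ a (v₀, …, v_{k-1}) * b (v_k, …, v_{k+l-1})` of two alternating maps, as a
continuous multilinear map. -/
def tensorMul {A : Type*} [NormedCommRing A] [NormedAlgebra ℝ A] {k l : ℕ}
    (a : V [⋀^Fin k]→L[ℝ] A) (b : V [⋀^Fin l]→L[ℝ] A) :
    ContinuousMultilinearMap ℝ (fun _ : Fin (k + l) => V) A where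
  toFun v := a (fun i => v (Fin.castAdd l i)) * b (fun j => v (Fin.natAdd k j))
  map_update_add' {inst} m i x y := by
    obtain rfl : inst = instDecidableEqFin _ := Subsingleton.elim _ _
    refine Fin.addCases (fun i => ?_) (fun i => ?_) i
    · have h1 : ∀ z : V, (fun j => Function.update m (Fin.castAdd l i) z (Fin.castAdd l j)) =
          Function.update (fun j => m (Fin.castAdd l j)) i z := fun z =>
        Function.update_comp_eq_of_injective m (Fin.castAdd_injective k l) i z
      have h2 : ∀ z : V, (fun j => Function.update m (Fin.castAdd l i) z (Fin.natAdd k j)) =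
          (fun j => m (Fin.natAdd k j)) := fun z => by
        funext j
        exact Function.update_of_ne (by simp [Fin.ext_iff]; omega) _ _
      simp only [h1, h2, a.map_update_add, add_mul]
    · have h1 : ∀ z : V, (fun j => Function.update m (Fin.natAdd k i) z (Fin.natAdd k j)) =
          Function.update (fun j => m (Fin.natAdd k j)) i z := fun z =>
        Function.update_comp_eq_of_injective m (Fin.natAdd_injective l k) i z
      have h2 : ∀ z : V, (fun j => Function.update m (Fin.natAdd k i) z (Fin.castAdd l j)) =
          (fun j => m (Fin.castAdd l j)) := fun z => by
        funext j
        exact Function.update_of_ne (by simp [Fin.ext_iff]; omega) _ _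
      simp only [h1, h2, b.map_update_add, mul_add]
  map_update_smul' {inst} m i c x := by
    obtain rfl : inst = instDecidableEqFin _ := Subsingleton.elim _ _
    refine Fin.addCases (fun i => ?_) (fun i => ?_) i
    · have h1 : ∀ z : V, (fun j => Function.update m (Fin.castAdd l i) z (Fin.castAdd l j)) =
          Function.update (fun j => m (Fin.castAdd l j)) i z := fun z =>
        Function.update_comp_eq_of_injective m (Fin.castAdd_injective k l) i z
      have h2 : ∀ z : V, (fun j => Function.update m (Fin.castAdd l i) z (Fin.natAdd k j)) =
          (fun j => m (Fin.natAdd k j)) := fun z => by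
        funext j
        exact Function.update_of_ne (by simp [Fin.ext_iff]; omega) _ _
      simp only [h1, h2, a.map_update_smul, smul_mul_assoc]
    · have h1 : ∀ z : V, (fun j => Function.update m (Fin.natAdd k i) z (Fin.natAdd k j)) =
          Function.update (fun j => m (Fin.natAdd k j)) i z := fun z =>
        Function.update_comp_eq_of_injective m (Fin.natAdd_injective l k) i z
      have h2 : ∀ z : V, (fun j => Function.update m (Fin.natAdd k i) z (Fin.castAdd l j)) =
          (fun j => m (Fin.castAdd l j)) := fun z => by
        funext j
        exact Function.update_of_ne (by simp [Fin.ext_iff]; omega) _ _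
      simp only [h1, h2, b.map_update_smul, mul_smul_comm]
  cont := by
    refine Continuous.mul ?_ ?_
    · exact a.coe_continuous.comp (by fun_prop)
    · exact b.coe_continuous.comp (by fun_prop)

/-- The wedge product of alternating forms,
`(a ∧ b)(v) = (1 / (k! l!)) ∑_σ sign σ a(v_{σ 0}, …) b(v_{σ k}, …)`. -/
def wedge {A : Type*} [NormedCommRing A] [NormedAlgebra ℝ A] {k l : ℕ}
    (a : V [⋀^Fin k]→L[ℝ] A) (b : V [⋀^Fin l]→L[ℝ] A) : V [⋀^Fin (k + l)]→L[ℝ] A :=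
  ((k.factorial * l.factorial : ℝ)⁻¹) •
    ContinuousMultilinearMap.alternatization (tensorMul a b)

/-- The real part of a complex-valued form. -/
def reForm {k : ℕ} (a : V [⋀^Fin k]→L[ℝ] ℂ) : V [⋀^Fin k]→L[ℝ] ℝ :=
  Complex.reCLM.compContinuousAlternatingMap a

/-- The imaginary part of a complex-valued form. -/
def imForm {k : ℕ} (a : V [⋀^Fin k]→L[ℝ] ℂ) : V [⋀^Fin k]→L[ℝ] ℝ :=
  Complex.imCLM.compContinuousAlternatingMap a

/-- The complex conjugate of a complex-valued form. -/
def conjForm {k : ℕ} (a : V [⋀^Fin k]→L[ℝ] ℂ) : V [⋀^Fin k]→L[ℝ] ℂ :=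
  (Complex.conjCLE : ℂ →L[ℝ] ℂ).compContinuousAlternatingMap a

/-- A real form, regarded as a complex-valued form. -/
def toComplexForm {k : ℕ} (a : V [⋀^Fin k]→L[ℝ] ℝ) : V [⋀^Fin k]→L[ℝ] ℂ :=
  Complex.ofRealCLM.compContinuousAlternatingMap a

/-- `insertFirst h a w` is the form `v ↦ a (w₀, …, w_{k-1}, v₀, …, v_{l-1})`. -/
def insertFirst {k l n : ℕ} (h : k + l = n) (a : V [⋀^Fin n]→L[ℝ] ℝ) (w : Fin k → V) :
    V [⋀^Fin l]→L[ℝ] ℝ where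
  toFun v := a (fun i => Fin.append w v (Fin.cast h.symm i))
  map_update_add' {inst} m i x y := by
    obtain rfl : inst = instDecidableEqFin _ := Subsingleton.elim _ _
    subst h
    have h1 : ∀ z : V, (fun j => Fin.append w (Function.update m i z) (Fin.cast rfl j)) =
        Function.update (Fin.append w m) (Fin.natAdd k i) z := fun z => by
      funext j
      refine Fin.addCases (fun j => ?_) (fun j => ?_) j
      · rw [Function.update_of_ne (by simp [Fin.ext_iff]; omega)]
        simp
      · by_cases hj : j = i
        · subst hj; simp
        · rw [Function.update_of_ne (by simpa [Fin.ext_iff] using hj)]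
          simp [hj]
    simp only [h1, a.map_update_add]
  map_update_smul' {inst} m i c x := by
    obtain rfl : inst = instDecidableEqFin _ := Subsingleton.elim _ _
    subst h
    have h1 : ∀ z : V, (fun j => Fin.append w (Function.update m i z) (Fin.cast rfl j)) =
        Function.update (Fin.append w m) (Fin.natAdd k i) z := fun z => by
      funext j
      refine Fin.addCases (fun j => ?_) (fun j => ?_) j
      · rw [Function.update_of_ne (by simp [Fin.ext_iff]; omega)]
        simp
      · by_cases hj : j = i
        · subst hj; simp
        · rw [Function.update_of_ne (by simpa [Fin.ext_iff] using hj)]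
          simp [hj]
    simp only [h1, a.map_update_smul]
  cont := by
    subst h
    refine a.coe_continuous.comp (continuous_pi fun j => ?_)
    refine Fin.addCases (fun j => ?_) (fun j => ?_) j
    · simpa using continuous_const
    · simpa using continuous_apply j
  map_eq_zero_of_eq' v i j hv hij := by
    subst h
    refine a.map_eq_zero_of_eq _ (i := Fin.natAdd k i) (j := Fin.natAdd k j) (by simpa using hv) ?_
    simpa [Fin.ext_iff] using hij

/-- The inverse Gram matrix `g^{ij}` of a function of two vectors in a basis. -/
def gramInv {ι : Type*} [Fintype ι] [DecidableEq ι] (g : V → V → ℝ) (b : ι → V) : Matrix ι ι ℝ :=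
  (Matrix.of fun i j => g (b i) (b j))⁻¹

/-- The Hodge star of the metric `g` and the volume form `vol` on `k`-forms, `k + l = n`:
in index notation `(⋆β)_{c₁…c_l} = (1 / k!) β^{a₁…a_k} vol_{a₁…a_k c₁…c_l}`, which is the
convention `α ∧ ⋆β = ⟨α, β⟩ vol`. The value does not depend on the basis used to contract. -/
def hodgeStar [FiniteDimensional ℝ V] {k l n : ℕ} (h : k + l = n) (g : V → V → ℝ)
    (vol : V [⋀^Fin n]→L[ℝ] ℝ) (β : V [⋀^Fin k]→L[ℝ] ℝ) : V [⋀^Fin l]→L[ℝ] ℝ :=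
  let b := Module.finBasis ℝ V
  let gi := gramInv g b
  ((k.factorial : ℝ)⁻¹) • ∑ i : Fin k → Fin (Module.finrank ℝ V),
    ∑ j : Fin k → Fin (Module.finrank ℝ V),
      ((∏ a, gi (i a) (j a)) * β (fun a => b (i a))) • insertFirst h vol (fun a => b (j a))

end PointwiseAlgebra

/-! ## Differential forms and metrics on a manifold -/

section Manifold

variable {E : Type*} [NormedAddCommGroup E] [NormedSpace ℝ E]
  {H : Type*} [TopologicalSpace H]

instance finiteDimensional_tangentSpace [FiniteDimensional ℝ E] (I : ModelWithCorners ℝ E H)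
    {M : Type*} [TopologicalSpace M] [ChartedSpace H M] (x : M) :
    FiniteDimensional ℝ (TangentSpace I x) :=
  inferInstanceAs (FiniteDimensional ℝ E)

/-- Differential `k`-forms on `M` with values in `F` (no regularity imposed). -/
abbrev DForm (I : ModelWithCorners ℝ E H) (M : Type*) [TopologicalSpace M] [ChartedSpace H M]
    (F : Type*) [NormedAddCommGroup F] [NormedSpace ℝ F] (k : ℕ) : Type _ :=
  (x : M) → TangentSpace I x [⋀^Fin k]→L[ℝ] F

/-- Fields of 2-tensors on `M`: real functions of two tangent vectors (the ones used are bilinear). -/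
abbrev BilinField (I : ModelWithCorners ℝ E H) (M : Type*) [TopologicalSpace M]
    [ChartedSpace H M] : Type _ :=
  (x : M) → TangentSpace I x → TangentSpace I x → ℝ

variable {I : ModelWithCorners ℝ E H} {M : Type*} [TopologicalSpace M] [ChartedSpace H M]
  {F : Type*} [NormedAddCommGroup F] [NormedSpace ℝ F]

/-- The differential at `y` of the inverse of the preferred chart at `x`. -/
def chartInvDeriv (I : ModelWithCorners ℝ E H) {M : Type*} [TopologicalSpace M]
    [ChartedSpace H M] (x : M) (y : E) : E →L[ℝ] TangentSpace I ((extChartAt I x).symm y) :=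
  mfderivWithin 𝓘(ℝ, E) I (extChartAt I x).symm (Set.range I) y

/-- The coordinate expression of a form in the preferred chart at `x`. -/
def DForm.inChart {k : ℕ} (ω : DForm I M F k) (x : M) (y : E) : E [⋀^Fin k]→L[ℝ] F :=
  (ω ((extChartAt I x).symm y)).compContinuousLinearMap (chartInvDeriv I x y)

/-- The coordinate expression of a field of bilinear forms in the preferred chart at `x`. -/
def BilinField.inChart (g : BilinField I M) (x : M) (y : E) (u v : E) : ℝ :=
  g ((extChartAt I x).symm y) (chartInvDeriv I x y u) (chartInvDeriv I x y v)

/-- Smooth forms: all coordinate expressions are smooth. -/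
def DForm.IsSmooth {k : ℕ} (ω : DForm I M F k) : Prop :=
  ∀ x : M, ContDiffOn ℝ (⊤ : ℕ∞) (ω.inChart x) (extChartAt I x).target

/-- The exterior derivative of a form on a manifold, computed at `x` in the preferred chart
at `x`. -/
def extD {k : ℕ} (ω : DForm I M F k) : DForm I M F (k + 1) := fun x =>
  (extDerivWithin (ω.inChart x) (Set.range I) (extChartAt I x x)).compContinuousLinearMap
    (mfderiv I 𝓘(ℝ, E) (extChartAt I x) x : TangentSpace I x →L[ℝ] E)

/-- Pull-back of forms along a map. -/
def DForm.pullback {E' : Type*} [NormedAddCommGroup E'] [NormedSpace ℝ E']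
    {H' : Type*} [TopologicalSpace H'] {I' : ModelWithCorners ℝ E' H'}
    {M' : Type*} [TopologicalSpace M'] [ChartedSpace H' M'] {k : ℕ}
    (ω : DForm I M F k) (f : M' → M) : DForm I' M' F k := fun x =>
  (ω (f x)).compContinuousLinearMap (mfderiv I' I f x)

section Hodge

variable [FiniteDimensional ℝ E]

/-- The Hodge star on forms on a manifold. -/
def starForm {k l n : ℕ} (h : k + l = n) (g : BilinField I M) (vol : DForm I M ℝ n)
    (β : DForm I M ℝ k) : DForm I M ℝ l := fun x => hodgeStar h (g x) (vol x) (β x)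

/-- The codifferential `d* = (-1)^{n(k+2)+1} ⋆ d ⋆` on `(k+1)`-forms on an `n`-dimensional
oriented Riemannian manifold. -/
def codiff {k l n : ℕ} (h : k + 1 + l = n) (g : BilinField I M) (vol : DForm I M ℝ n)
    (β : DForm I M ℝ (k + 1)) : DForm I M ℝ k :=
  ((-1 : ℝ) ^ (n * (k + 2) + 1)) •
    starForm (k := l + 1) (l := k) (by omega) g vol (extD (starForm h g vol β))

/-- The Hodge Laplacian `Δ = d d* + d* d` on `(k+1)`-forms on an `n`-dimensional oriented
Riemannian manifold. -/
def hodgeLaplacian {k l n : ℕ} (h : k + l + 2 = n) (g : BilinField I M) (vol : DForm I M ℝ n)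
    (β : DForm I M ℝ (k + 1)) : DForm I M ℝ (k + 1) :=
  extD (codiff (l := l + 1) (by omega) g vol β) +
    codiff (k := k + 1) (l := l) (by omega) g vol (extD β)

end Hodge

/-! ### Levi-Civita connection and torsion in coordinates -/

section Torsion

variable [FiniteDimensional ℝ E]

/-- The Christoffel symbols of the first kind at `y`,
`½ (∂_u g(v, w) + ∂_v g(u, w) - ∂_w g(u, v))`, for a metric in coordinates. -/
def christoffelFirst (s : Set E) (g : E → E → E → ℝ) (y u v w : E) : ℝ :=
  (fderivWithin ℝ (fun z => g z v w) s y u + fderivWithin ℝ (fun z => g z u w) s y v -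
    fderivWithin ℝ (fun z => g z u v) s y w) / 2

/-- The Christoffel symbols of the second kind: the vector `Γ(u, v)`. -/
def christoffel (s : Set E) (g : E → E → E → ℝ) (y u v : E) : E :=
  let b := Module.finBasis ℝ E
  ∑ i, ∑ j, (gramInv (g y) b i j * christoffelFirst s g y u v (b i)) • b j

/-- The Levi-Civita covariant derivative `(∇_u φ)(v₁, …, v_k)` in coordinates. -/
def covDeriv {k : ℕ} (s : Set E) (g : E → E → E → ℝ) (φ : E → E [⋀^Fin k]→L[ℝ] ℝ) (y u : E)
    (v : Fin k → E) : ℝ :=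
  fderivWithin ℝ (fun z => φ z v) s y u -
    ∑ a, φ y (Function.update v a (christoffel s g y u (v a)))

/-- The full torsion tensor in coordinates, `T_{am} = (1/24) (∇_a φ_{bcd}) ψ_m{}^{bcd}`. -/
def torsionInCoords (s : Set E) (g : E → E → E → ℝ) (φ : E → E [⋀^Fin 3]→L[ℝ] ℝ)
    (ψ : E → E [⋀^Fin 4]→L[ℝ] ℝ) (y u w : E) : ℝ :=
  let b := Module.finBasis ℝ E
  let gi := gramInv (g y) b
  (1 / 24) * ∑ i : Fin 3 → Fin (Module.finrank ℝ E), ∑ j : Fin 3 → Fin (Module.finrank ℝ E),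
    (∏ a, gi (i a) (j a)) * covDeriv s g φ y u (fun a => b (i a)) *
      ψ y (Matrix.vecCons w (fun a => b (j a)))

/-- The trace `Tr T = g^{am} T_{am}` of the full torsion tensor of `(φ, ψ, g)`, computed at `x`
in the preferred chart at `x`. -/
def traceTorsion (g : BilinField I M) (φ : DForm I M ℝ 3) (ψ : DForm I M ℝ 4) (x : M) : ℝ :=
  let b := Module.finBasis ℝ E
  ∑ i, ∑ j, gramInv (g.inChart x (extChartAt I x x)) b i j *
    torsionInCoords (Set.range I) (g.inChart x) (φ.inChart x) (ψ.inChart x) (extChartAt I x x)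
      (b i) (b j)

end Torsion

end Manifold

/-! ## `SU(3)`-structures on 6-manifolds -/

/-- The model space of 6-manifolds. -/
abbrev E6 : Type := EuclideanSpace ℝ (Fin 6)

/-- An `SU(3)`-structure `(g, ω, Ω)` on a 6-manifold, with its almost complex structure `J` and
its volume form `vol`. -/
structure SU3Structure (N : Type*) [TopologicalSpace N] [ChartedSpace E6 N]
    [IsManifold (𝓡 6) (⊤ : ℕ∞) N] where
  /-- the Riemannian metric -/
  g : Bundle.ContMDiffRiemannianMetric (𝓡 6) (⊤ : ℕ∞) E6 (fun x : N => TangentSpace (𝓡 6) x)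
  /-- the almost complex structure -/
  J : (x : N) → TangentSpace (𝓡 6) x →L[ℝ] TangentSpace (𝓡 6) x
  /-- the Hermitian form -/
  ω : DForm (𝓡 6) N ℝ 2
  /-- the complex volume form -/
  Ω : DForm (𝓡 6) N ℂ 3
  /-- the Riemannian volume form -/
  vol : DForm (𝓡 6) N ℝ 6
  smooth_ω : ω.IsSmooth
  smooth_Ω : Ω.IsSmooth
  J_sq : ∀ x u, J x (J x u) = -u
  J_isometry : ∀ x u v, g.inner x (J x u) (J x v) = g.inner x u v
  ω_eq : ∀ x u v, ω x ![u, v] = g.inner x (J x u) v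
  /-- `Ω` is of type `(3, 0)` -/
  Ω_type : ∀ x (v : Fin 3 → TangentSpace (𝓡 6) x) (i : Fin 3),
    Ω x (Function.update v i (J x (v i))) = Complex.I * Ω x v
  Ω_ne_zero : ∀ x, Ω x ≠ 0
  /-- `vol` is the volume form of `g`, up to the choice of orientation -/
  vol_sq : ∀ x (v : Fin 6 → TangentSpace (𝓡 6) x),
    vol x v ^ 2 = (Matrix.of fun i j => g.inner x (v i) (v j)).det
  Ω_wedge_ω : ∀ x, wedge (Ω x) (toComplexForm (ω x)) = 0
  conj_Ω_wedge_ω : ∀ x, wedge (conjForm (Ω x)) (toComplexForm (ω x)) = 0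
  ω_cubed : ∀ x, wedge (wedge (ω x) (ω x)) (ω x) = (6 : ℝ) • vol x
  Ω_wedge_conj : ∀ x,
    wedge (Ω x) (conjForm (Ω x)) = (-8 * Complex.I) • toComplexForm (vol x)

/-- The equations `dω = -3λ Re Ω`, `dΩ = 2λ i ω²`, `d(ω²) = 0`: Calabi-Yau for `λ = 0`, nearly
Kähler for `λ ≠ 0`. -/
structure SU3Structure.IsCalabiYauOrNearlyKahler {N : Type*} [TopologicalSpace N]
    [ChartedSpace E6 N] [IsManifold (𝓡 6) (⊤ : ℕ∞) N] (s : SU3Structure N) (lam : ℝ) : Prop where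
  d_ω : ∀ x, extD s.ω x = (-3 * lam) • reForm (s.Ω x)
  d_Ω : ∀ x, extD s.Ω x = (2 * lam * Complex.I : ℂ) • toComplexForm (wedge (s.ω x) (s.ω x))
  d_ω_sq : ∀ x, extD (k := 4) (fun y : N => wedge (s.ω y) (s.ω y)) x = 0

/-! ## The line factor and its coordinate derivative -/

/-- The derivative `f' = ∂f/∂r` on a 1-manifold with coframe `dr`, that is, `df = f' dr`. -/
def rDeriv {L : Type*} [TopologicalSpace L] [ChartedSpace ℝ L] (dr : DForm 𝓘(ℝ, ℝ) L ℝ 1)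
    (f : L → ℝ) (l : L) : ℝ :=
  let df : ℝ →L[ℝ] ℝ := mfderiv 𝓘(ℝ, ℝ) 𝓘(ℝ, ℝ) f l
  let drl : ℝ [⋀^Fin 1]→L[ℝ] ℝ := dr l
  df 1 / drl (fun _ => 1)

/-! ## Warped `G₂`-structures on `N × L` -/

section Warped

variable {N : Type*} [TopologicalSpace N] [ChartedSpace E6 N] [IsManifold (𝓡 6) (⊤ : ℕ∞) N]
  {L : Type*} [TopologicalSpace L] [ChartedSpace ℝ L]

/-- The model with corners of `N × L`. -/
abbrev I7 : ModelWithCorners ℝ (E6 × ℝ) (ModelProd E6 ℝ) := (𝓡 6).prod 𝓘(ℝ, ℝ)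

/-- Pull-back of forms from `N` to `N × L`. -/
def fromN {F : Type*} [NormedAddCommGroup F] [NormedSpace ℝ F] {k : ℕ}
    (η : DForm (𝓡 6) N F k) : DForm I7 (N × L) F k := η.pullback Prod.fst

/-- Pull-back of forms from `L` to `N × L`. -/
def fromL {F : Type*} [NormedAddCommGroup F] [NormedSpace ℝ F] {k : ℕ}
    (η : DForm 𝓘(ℝ, ℝ) L F k) : DForm I7 (N × L) F k := η.pullback Prod.snd

/-- `F = h e^{iθ/3}`. -/
def warpF (h θ : L → ℝ) (l : L) : ℂ := h l * Complex.exp (Complex.I * (θ l / 3 : ℝ))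

variable (s : SU3Structure N) (dr : DForm 𝓘(ℝ, ℝ) L ℝ 1) (G h θ : L → ℝ)

/-- `φ = Re (F³ Ω) + G h² dr ∧ ω`. -/
def warpedPhi : DForm I7 (N × L) ℝ 3 := fun p =>
  reForm (warpF h θ p.2 ^ 3 • fromN s.Ω p) +
    (G p.2 * h p.2 ^ 2) • wedge (fromL dr p) (fromN s.ω p)

/-- `ψ = ½ h⁴ ω² + Im (F³ Ω) ∧ G dr`. -/
def warpedPsi : DForm I7 (N × L) ℝ 4 := fun p =>
  (h p.2 ^ 4 / 2) • wedge (fromN s.ω p) (fromN s.ω p) +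
    wedge (imForm (warpF h θ p.2 ^ 3 • fromN s.Ω p)) (G p.2 • fromL dr p)

/-- `g₇ = G² dr² + h² g₆`. -/
def warpedMetric : BilinField I7 (N × L) := fun p =>
  fun u v =>
    G p.2 ^ 2 * (fromL dr p (fun _ => u) * fromL dr p (fun _ => v)) +
      h p.2 ^ 2 * s.g.inner p.1 (mfderiv I7 (𝓡 6) Prod.fst p u) (mfderiv I7 (𝓡 6) Prod.fst p v)

/-- `vol₇ = G h⁶ vol₆ ∧ dr`. -/
def warpedVol : DForm I7 (N × L) ℝ 7 := fun p =>
  (G p.2 * h p.2 ^ 6) • wedge (fromN s.vol p) (fromL dr p)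

end Warped

/-! ## Torsion parameters, the flow and the evolution equations -/

section Flow

variable {L : Type*} [TopologicalSpace L] [ChartedSpace ℝ L]

/-- `α = θ' / G`. -/
def torsionAlpha (dr : DForm 𝓘(ℝ, ℝ) L ℝ 1) (G θ : L → ℝ) (l : L) : ℝ :=
  rDeriv dr θ l / G l

/-- `β = λ h⁻¹ sin θ`. -/
def torsionBeta (lam : ℝ) (h θ : L → ℝ) (l : L) : ℝ :=
  lam * (h l)⁻¹ * Real.sin (θ l)

/-- `γ = h' / h + λ h⁻¹ G cos θ`. -/
def torsionGamma (lam : ℝ) (dr : DForm 𝓘(ℝ, ℝ) L ℝ 1) (G h θ : L → ℝ) (l : L) : ℝ :=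
  rDeriv dr h l / h l + lam * (h l)⁻¹ * G l * Real.cos (θ l)

variable {N : Type*} [TopologicalSpace N] [ChartedSpace E6 N] [IsManifold (𝓡 6) (⊤ : ℕ∞) N]

/-- The trace of the full torsion tensor of the warped `G₂`-structure. -/
def warpedTraceTorsion (s : SU3Structure N) (dr : DForm 𝓘(ℝ, ℝ) L ℝ 1) (G h θ : L → ℝ)
    (p : N × L) : ℝ :=
  traceTorsion (warpedMetric s dr G h) (warpedPhi s dr G h θ) (warpedPsi s dr G h θ) p

/-- The right-hand side `Δψ + k d((C - Tr T) φ)` of the modified Laplacian coflow. -/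
def modifiedCoflowRHS (s : SU3Structure N) (dr : DForm 𝓘(ℝ, ℝ) L ℝ 1) (k C : ℝ)
    (G h θ : L → ℝ) : DForm I7 (N × L) ℝ 4 :=
  hodgeLaplacian (k := 3) (l := 2) (n := 7) rfl (warpedMetric s dr G h) (warpedVol s dr G h)
      (warpedPsi s dr G h θ) +
    k • extD (fun p => (C - warpedTraceTorsion s dr G h θ p) • warpedPhi s dr G h θ p)

/-- The modified Laplacian coflow `∂ψ/∂t = Δψ + k d((C - Tr T) φ)` on the time interval `S`, for
the family of warped `G₂`-structures with parameters `G t`, `h t`, `θ t`; the time derivative is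
taken at each point of `N × L` and on each tuple of tangent vectors. -/
def IsModifiedCoflow (s : SU3Structure N) (dr : DForm 𝓘(ℝ, ℝ) L ℝ 1) (k C : ℝ) (S : Set ℝ)
    (G h θ : ℝ → L → ℝ) : Prop :=
  ∀ t ∈ S, ∀ (p : N × L) (v : Fin 4 → TangentSpace I7 p),
    HasDerivWithinAt (fun τ => warpedPsi s dr (G τ) (h τ) (θ τ) p v)
      (modifiedCoflowRHS s dr k C (G t) (h t) (θ t) p v) S t

/-- The evolution equations for `G`, `θ`, `h` on the time interval `S`. -/
def EvolutionEquations (lam : ℝ) (dr : DForm 𝓘(ℝ, ℝ) L ℝ 1) (k C : ℝ) (S : Set ℝ)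
    (G h θ : ℝ → L → ℝ) : Prop :=
  ∀ t ∈ S, ∀ l : L,
    let α := torsionAlpha dr (G t) (θ t)
    let β := torsionBeta lam (h t) (θ t)
    derivWithin (fun τ => G τ l) S t / G t l =
        (1 - k) * α l ^ 2 + 3 * β l ^ 2 + 6 * k * α l * β l + k * C * α l ∧
      derivWithin (fun τ => θ τ l) S t =
        (k - 1) * (G t l)⁻¹ * rDeriv dr (fun x => α x - 6 * β x) l ∧
      derivWithin (fun τ => h τ l) S t / h t l =
        3 * (1 - 2 * k) * β l ^ 2 + (k - 1) * α l * β l - k * C * β l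

end Flow

end

/-! The point is that the flow never leaves a finite-rank family of forms. Put `η = G dr`, `w = h²
ω` and `P + iQ = F³ Ω`; then `φ = P + η ∧ w` and `ψ = ½ w ∧ w - η ∧ Q`. Every form that occurs is
either `u Re Ω + v Im Ω + w dr ∧ ω` (`warpedThreeForm`) or `u ω² + v dr ∧ Re Ω + w dr ∧ Im Ω`
(`warpedFourForm`), with coefficients depending on `r` only. The `SU(3)` structure equations make
`d` act on these coefficients by explicit formulas (`extD_warpedThreeForm`, `extD_warpedFourForm`).

The Hodge star is needed only on combinations `c w ∧ w + d η ∧ Q`, which it sends to `2c η ∧ w - d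
P` (`IsAdaptedBasis.hodgeStar_comb`). This is a pointwise statement: each point has an oriented
orthonormal frame in which all the forms take their standard values on `ℂ³ ⊕ ℝ`
(`exists_isAdaptedBasis`), and there it is a finite check. The trace of the torsion is pointwise as
well: contraction with the alternating `ψ` turns `∇φ` into `dφ` and removes the symmetric
Christoffel symbols, so `Tr T` is `1/96` of the full contraction of `dφ` with `ψ`
(`torsion_trace_eq`).

Co-closedness is the single equation `γ = 0`, which expresses `h'` through `G`, `h` and `θ`. With
it, `dφ = -2β w ∧ w + (3β - α) η ∧ Q`, whence `Tr T = α - 6β`. Since `dψ = 0` and `⋆ψ = φ`, the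
Laplacian is `Δψ = d ⋆ dφ`, and the whole right-hand side of the flow becomes explicit
(`modifiedCoflowRHS_eq`). Comparing the three coefficients, and rotating the last two equations by
the angle `θ`, gives the equations for `h`, `G` and `θ` (`coflow_coefficients_iff`). The evolution
of `α` then follows by exchanging `∂/∂t` with `∂/∂r`, and that of `β` by the chain rule together
with `β' = λ h⁻¹ cos θ · G (α + β)`. -/

noncomputable section

/-! ### Contractions, wedge products and the Hodge star on one vector space. -/

section MultilinearAlgebra

variable {V : Type*} [AddCommGroup V] [Module ℝ V]

/-- If `A` is the matrix of `b` in an orthonormal basis, the Gram matrix is `Aᵀ A`, so its inverse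
is `A⁻¹ (A⁻¹)ᵀ`. This is what frees contractions from the arbitrary basis `Module.finBasis`. -/
theorem gramInv_basis {ι κ : Type*} [Fintype ι] [DecidableEq ι] [Fintype κ] [DecidableEq κ]
    (g : V → V → ℝ) (B : V →ₗ[ℝ] V →ₗ[ℝ] ℝ) (hB : ∀ u v, g u v = B u v)
    (b : Module.Basis ι ℝ V) (f : Module.Basis κ ℝ V)
    (hf : ∀ m m', g (f m) (f m') = if m = m' then 1 else 0) (i j : ι) :
    gramInv g b i j = ∑ m, b.repr (f m) i * b.repr (f m) j := by
  have key : gramInv g b = b.toMatrix f * (b.toMatrix f).transpose := by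
    refine Matrix.inv_eq_right_inv ?_
    have : (Matrix.of fun i j => g (b i) (b j)) = (f.toMatrix b).transpose * f.toMatrix b := by
      ext i j
      simp only [Matrix.of_apply, Matrix.mul_apply, Matrix.transpose_apply, 
        Module.Basis.toMatrix_apply, hB]
      rw [← f.sum_repr (b i), ← f.sum_repr (b j)]
      simp only [map_sum, map_smul, LinearMap.sum_apply, LinearMap.smul_apply, ← hB, hf]
      simp [mul_comm]
    rw [this, Matrix.mul_assoc, ← Matrix.mul_assoc (f.toMatrix b), Module.Basis.toMatrix_mul_toMatrix_flip,
      Matrix.one_mul, ← Matrix.transpose_mul, Module.Basis.toMatrix_mul_toMatrix_flip, 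
      Matrix.transpose_one]
  rw [key]
  simp [Matrix.mul_apply, Module.Basis.toMatrix_apply]

/-- Contracting two multilinear maps with a metric can be done in any orthonormal basis. -/
theorem sum_gramInv_mul {ι κ : Type*} [Fintype ι] [DecidableEq ι] [Fintype κ] [DecidableEq κ]
    (g : V → V → ℝ) (B : V →ₗ[ℝ] V →ₗ[ℝ] ℝ) (hB : ∀ u v, g u v = B u v)
    (b : Module.Basis ι ℝ V) (f : Module.Basis κ ℝ V)
    (hf : ∀ m m', g (f m) (f m') = if m = m' then 1 else 0) {k : ℕ}
    (P Q : MultilinearMap ℝ (fun _ : Fin k => V) ℝ) :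
    ∑ i : Fin k → ι, ∑ j : Fin k → ι,
      (∏ a, gramInv g b (i a) (j a)) * P (fun a => b (i a)) * Q (fun a => b (j a)) =
    ∑ m : Fin k → κ, P (fun a => f (m a)) * Q (fun a => f (m a)) := by
  have hexp : ∀ (P : MultilinearMap ℝ (fun _ : Fin k => V) ℝ) (m : Fin k → κ),
      P (fun a => f (m a)) = ∑ i : Fin k → ι, (∏ a, b.repr (f (m a)) (i a)) * P (fun a => b (i a)) := by
    intro P m
    conv_lhs => rw [show (fun a => f (m a)) = fun a => ∑ i, b.repr (f (m a)) i • b i from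
      funext fun a => (b.sum_repr _).symm]
    rw [P.map_sum]
    refine Finset.sum_congr rfl fun i _ => ?_
    rw [P.map_smul_univ]; rfl
  simp only [gramInv_basis g B hB b f hf, Finset.prod_univ_sum, Fintype.piFinset_univ, hexp P, hexp Q, Finset.sum_mul, Finset.mul_sum]
  refine (Finset.sum_congr rfl fun i _ => Finset.sum_comm).trans (Finset.sum_comm.trans ?_)
  refine Finset.sum_congr rfl fun m _ => Finset.sum_comm.trans ?_
  refine Finset.sum_congr rfl fun j _ => Finset.sum_congr rfl fun i _ => ?_
  rw [Finset.prod_mul_distrib]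
  ring

variable [TopologicalSpace V]

theorem wedge_apply {A : Type*} [NormedCommRing A] [NormedAlgebra ℝ A] {k l : ℕ}
    (a : V [⋀^Fin k]→L[ℝ] A) (b : V [⋀^Fin l]→L[ℝ] A) (v : Fin (k + l) → V) :
    wedge a b v = ((k.factorial * l.factorial : ℝ)⁻¹) • ∑ σ : Equiv.Perm (Fin (k + l)),
      Equiv.Perm.sign σ • (a (fun i => v (σ (Fin.castAdd l i))) *
        b (fun j => v (σ (Fin.natAdd k j)))) := by
  simp only [wedge, ContinuousAlternatingMap.smul_apply]
  rw [ContinuousMultilinearMap.alternatization_apply_apply]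
  rfl

/-- The permutation of `Fin (n + 1)` sending `0` to `p` and acting by `e` on the others. -/
def permCons {n : ℕ} (q : Fin (n + 1) × Equiv.Perm (Fin n)) : Equiv.Perm (Fin (n + 1)) :=
  q.1.cycleRange.symm * Equiv.Perm.decomposeFin.symm (0, q.2)

@[simp] theorem permCons_zero {n : ℕ} (q : Fin (n + 1) × Equiv.Perm (Fin n)) :
    permCons q 0 = q.1 := by
  simp [permCons]

@[simp] theorem permCons_succ {n : ℕ} (q : Fin (n + 1) × Equiv.Perm (Fin n)) (j : Fin n) :
    permCons q j.succ = q.1.succAbove (q.2 j) := by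
  simp [permCons]

theorem sign_permCons {n : ℕ} (q : Fin (n + 1) × Equiv.Perm (Fin n)) :
    Equiv.Perm.sign (permCons q) = (-1) ^ (q.1 : ℕ) * Equiv.Perm.sign q.2 := by
  simp [permCons, Equiv.Perm.decomposeFin.symm_sign]

theorem permCons_bijective {n : ℕ} :
    Function.Bijective (permCons : Fin (n + 1) × Equiv.Perm (Fin n) → _) := by
  rw [Fintype.bijective_iff_injective_and_card]
  refine ⟨fun q r h => ?_, ?_⟩
  · have h0 : q.1 = r.1 := by simpa using congrArg (fun σ => σ 0) h
    refine Prod.ext h0 (Equiv.ext fun j => ?_)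
    have := congrArg (fun σ => σ j.succ) h
    simp only [permCons_succ, h0] at this
    exact Fin.succAbove_right_injective this
  · simp [Fintype.card_perm, Nat.factorial_succ]

/-- Peeling off the image of `0` repeatedly turns a sum over a symmetric group into nested sums over
`Fin`, with signs `(-1) ^ p`; in that form the sums can be expanded or evaluated by the kernel. -/
theorem sum_perm_succ {A : Type*} [AddCommGroup A] {n : ℕ} (f : Equiv.Perm (Fin (n + 1)) → A) :
    ∑ σ, f σ = ∑ p : Fin (n + 1), ∑ e : Equiv.Perm (Fin n), f (permCons (p, e)) := by
  rw [← Fintype.sum_prod_type', ← permCons_bijective.sum_comp]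

/-- The permutations are grouped by the argument that `η` receives; the `k!` orderings of the
remaining ones contribute equally because `β` is alternating, and this cancels the normalisation. -/
theorem wedge_one_left_apply {k : ℕ} (η : V [⋀^Fin 1]→L[ℝ] ℝ) (β : V [⋀^Fin k]→L[ℝ] ℝ)
    (v : Fin (1 + k) → V) :
    wedge η β v = ∑ p : Fin (k + 1), (-1) ^ (p : ℕ) *
      (η (fun _ => v (p.cast (Nat.add_comm k 1))) *
        β (fun j => v ((p.succAbove j).cast (Nat.add_comm k 1)))) := by
  have hk : (k.factorial : ℝ) ≠ 0 := by positivity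
  have hc : k + 1 = 1 + k := Nat.add_comm k 1
  rw [wedge_apply, ← Equiv.sum_comp (Equiv.permCongr (finCongr hc)), sum_perm_succ]
  have h1 : ∀ (p : Fin (k + 1)) (e : Equiv.Perm (Fin k)),
      Equiv.Perm.sign ((finCongr hc).permCongr (permCons (p, e))) •
        (η (fun i => v ((finCongr hc).permCongr (permCons (p, e)) (Fin.castAdd k i))) *
          β (fun j => v ((finCongr hc).permCongr (permCons (p, e)) (Fin.natAdd 1 j)))) =
      (-1) ^ (p : ℕ) * (η (fun _ => v (p.cast hc)) *
        β (fun j => v ((p.succAbove j).cast hc))) := by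
    intro p e
    have ha : ∀ i : Fin 1, (finCongr hc).permCongr (permCons (p, e)) (Fin.castAdd k i) =
        p.cast hc := by
      intro i
      have : (finCongr hc).symm (Fin.castAdd k i) = 0 := by
        ext; simp
      rw [Equiv.permCongr_apply, this]; simp
    have hb : ∀ j : Fin k, (finCongr hc).permCongr (permCons (p, e)) (Fin.natAdd 1 j) =
        (p.succAbove (e j)).cast hc := by
      intro j
      have : (finCongr hc).symm (Fin.natAdd 1 j) = j.succ := by
        ext; simp
      rw [Equiv.permCongr_apply, this]; simp
    simp only [ha, hb, Equiv.Perm.sign_permCongr, sign_permCons]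
    have hβ : β ((fun j => v ((p.succAbove j).cast hc)) ∘ e) =
        Equiv.Perm.sign e • β (fun j => v ((p.succAbove j).cast hc)) :=
      β.toAlternatingMap.map_perm (fun j => v ((p.succAbove j).cast hc)) e
    rw [show (fun j => v ((p.succAbove (e j)).cast hc)) =
      (fun j => v ((p.succAbove j).cast hc)) ∘ e from rfl, hβ]
    have hs : (((Equiv.Perm.sign e : ℤˣ) : ℤ) : ℝ) * ((Equiv.Perm.sign e : ℤˣ) : ℤ) = 1 := by
      exact_mod_cast Int.units_coe_mul_self (Equiv.Perm.sign e)
    simp only [Units.smul_def, zsmul_eq_mul]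
    push_cast
    linear_combination ((-1) ^ (p : ℕ) * (η (fun _ => v (p.cast hc)) *
        β (fun j => v ((p.succAbove j).cast hc)))) * hs
  simp only [h1, Finset.sum_const, Finset.card_univ, Fintype.card_perm, Fintype.card_fin]
  rw [← Finset.smul_sum, nsmul_eq_mul, smul_eq_mul, ← mul_assoc]
  simp [hk]

/-- Conjugation by the block flip preserves the sign of a permutation, so no factor `(-1) ^ (k * l)`
appears here: it is hidden in the reordering of the arguments on the right. -/
theorem wedge_swap_apply {A : Type*} [NormedCommRing A] [NormedAlgebra ℝ A] {k l : ℕ}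
    (a : V [⋀^Fin k]→L[ℝ] A) (b : V [⋀^Fin l]→L[ℝ] A) (v : Fin (k + l) → V) :
    wedge a b v = wedge b a (fun i => v (finAddFlip i)) := by
  rw [wedge_apply, wedge_apply, ← Equiv.sum_comp (Equiv.permCongr (finAddFlip (m := l) (n := k))),
    mul_comm (k.factorial : ℝ)]
  congr 1
  refine Finset.sum_congr rfl fun σ _ => ?_
  rw [Equiv.Perm.sign_permCongr, mul_comm]
  have h1 : ∀ j, (finAddFlip (m := l) (n := k)).symm (Fin.natAdd k j) = Fin.castAdd k j :=
    fun j => by simp [Equiv.symm_apply_eq]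
  have h2 : ∀ j, (finAddFlip (m := l) (n := k)).symm (Fin.castAdd l j) = Fin.natAdd l j :=
    fun j => by simp [Equiv.symm_apply_eq]
  simp [Equiv.permCongr_apply, h1, h2]

theorem wedge_one_two_apply (η : V [⋀^Fin 1]→L[ℝ] ℝ) (β : V [⋀^Fin 2]→L[ℝ] ℝ)
    (v : Fin 3 → V) :
    wedge η β v = η (fun _ => v 0) * β ![v 1, v 2] - η (fun _ => v 1) * β ![v 0, v 2] +
      η (fun _ => v 2) * β ![v 0, v 1] := by
  refine (wedge_one_left_apply η β v).trans ?_
  have h : ∀ p : Fin 3, (fun j : Fin 2 => v ((p.succAbove j).cast rfl)) =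
      ![v (p.succAbove 0), v (p.succAbove 1)] := fun p => by
    ext j; fin_cases j <;> rfl
  rw [Fin.sum_univ_three]
  erw [h, h, h]
  simp [Fin.succAbove, Fin.lt_def]
  ring

theorem wedge_one_three_apply (η : V [⋀^Fin 1]→L[ℝ] ℝ) (β : V [⋀^Fin 3]→L[ℝ] ℝ)
    (v : Fin 4 → V) :
    wedge η β v = η (fun _ => v 0) * β ![v 1, v 2, v 3] - η (fun _ => v 1) * β ![v 0, v 2, v 3] +
      η (fun _ => v 2) * β ![v 0, v 1, v 3] - η (fun _ => v 3) * β ![v 0, v 1, v 2] := by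
  refine (wedge_one_left_apply η β v).trans ?_
  have h : ∀ p : Fin 4, (fun j : Fin 3 => v ((p.succAbove j).cast rfl)) =
      ![v (p.succAbove 0), v (p.succAbove 1), v (p.succAbove 2)] := fun p => by
    ext j; fin_cases j <;> rfl
  rw [Fin.sum_univ_four]
  erw [h, h, h, h]
  simp [Fin.succAbove, Fin.lt_def]
  ring

theorem wedge_three_one (a : V [⋀^Fin 3]→L[ℝ] ℝ) (η : V [⋀^Fin 1]→L[ℝ] ℝ) :
    wedge a η = -(wedge η a : V [⋀^Fin 4]→L[ℝ] ℝ) := by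
  ext v
  change wedge a η v = -(wedge η a v)
  rw [wedge_swap_apply]
  erw [wedge_one_three_apply, wedge_one_three_apply]
  have e0 : finAddFlip (m := 1) (n := 3) 0 = (3 : Fin 4) := rfl
  have e1 : finAddFlip (m := 1) (n := 3) 1 = (0 : Fin 4) := rfl
  have e2 : finAddFlip (m := 1) (n := 3) 2 = (1 : Fin 4) := rfl
  have e3 : finAddFlip (m := 1) (n := 3) 3 = (2 : Fin 4) := rfl
  erw [e0, e1, e2, e3]
  -- A cyclic rotation of three arguments is even.
  have hr : ∀ x y z : V, a ![z, x, y] = a ![x, y, z] := fun x y z => by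
    have := a.toAlternatingMap.map_perm ![z, x, y] (finRotate 3)
    rw [sign_finRotate, show (![z, x, y] : Fin 3 → V) ∘ finRotate 3 = ![x, y, z] by
      ext i; fin_cases i <;> simp] at this
    simpa using this.symm
  rw [hr (v 1) (v 2) (v 3), hr (v 0) (v 2) (v 3), hr (v 0) (v 1) (v 3)]
  ring

theorem wedge_two_two_apply (a : V [⋀^Fin 2]→L[ℝ] ℝ) (v : Fin 4 → V) :
    wedge a a v = 2 * (a ![v 0, v 1] * a ![v 2, v 3] - a ![v 0, v 2] * a ![v 1, v 3] +
      a ![v 0, v 3] * a ![v 1, v 2]) := by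
  have hs : ∀ x y, a ![y, x] = - a ![x, y] := fun x y => by
    have := a.toAlternatingMap.map_swap ![x, y] (i := 0) (j := 1) (by decide)
    rw [show (![x, y] : Fin 2 → V) ∘ Equiv.swap 0 1 = ![y, x] by
      ext i; fin_cases i <;> simp] at this
    exact this
  rw [wedge_apply]
  change _ • (∑ σ : Equiv.Perm (Fin 4), Equiv.Perm.sign σ • (a (fun i => v (σ (Fin.castAdd 2 i))) *
    a (fun i => v (σ (Fin.natAdd 2 i))))) = _
  have h1 : ∀ σ : Equiv.Perm (Fin 4), (fun i : Fin 2 => v (σ (Fin.castAdd 2 i))) =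
      ![v (σ 0), v (σ 1)] := fun σ => by ext i; fin_cases i <;> rfl
  have h2 : ∀ σ : Equiv.Perm (Fin 4), (fun i : Fin 2 => v (σ (Fin.natAdd 2 i))) =
      ![v (σ 2), v (σ 3)] := fun σ => by ext i; fin_cases i <;> rfl
  have p1 : ∀ {n : ℕ} (q : Fin (n + 2) × Equiv.Perm (Fin (n + 1))),
      permCons q 1 = q.1.succAbove (q.2 0) := fun q => permCons_succ q 0
  have p2 : ∀ {n : ℕ} (q : Fin (n + 3) × Equiv.Perm (Fin (n + 2))),
      permCons q 2 = q.1.succAbove (q.2 1) := fun q => permCons_succ q 1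
  have p3 : ∀ q : Fin 4 × Equiv.Perm (Fin 3),
      permCons q 3 = q.1.succAbove (q.2 2) := fun q => permCons_succ q 2
  simp only [h1, h2, sum_perm_succ, sign_permCons, p1, p2, p3, permCons_zero]
  simp only [Fin.sum_univ_succ, Finset.univ_unique, Finset.sum_singleton, Fin.succAbove, Fin.lt_def]
  simp [Units.smul_def]
  rw [hs (v 0) (v 1), hs (v 0) (v 2), hs (v 0) (v 3), hs (v 1) (v 2), hs (v 1) (v 3),
    hs (v 2) (v 3)]
  ring

theorem wedge_compContinuousLinearMap {A : Type*} [NormedCommRing A] [NormedAlgebra ℝ A]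
    {W : Type*} [AddCommGroup W] [Module ℝ W] [TopologicalSpace W] {k l : ℕ}
    (a : V [⋀^Fin k]→L[ℝ] A) (b : V [⋀^Fin l]→L[ℝ] A) (T : W →L[ℝ] V) :
    (wedge a b).compContinuousLinearMap T =
      wedge (a.compContinuousLinearMap T) (b.compContinuousLinearMap T) := by
  ext v
  rw [ContinuousAlternatingMap.compContinuousLinearMap_apply, wedge_apply, wedge_apply]
  rfl

theorem insertFirst_apply {k l n : ℕ} (h : k + l = n) (a : V [⋀^Fin n]→L[ℝ] ℝ) (w : Fin k → V)
    (v : Fin l → V) : insertFirst h a w v = a (fun i => Fin.append w v (Fin.cast h.symm i)) := rfl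

/-- The Hodge star of a form on part of an oriented orthonormal basis is the form on the
complementary part. -/
theorem hodgeStar_apply_basis [FiniteDimensional ℝ V] {k l n : ℕ} (h : k + l = n)
    (g : V → V → ℝ) (B : V →ₗ[ℝ] V →ₗ[ℝ] ℝ) (hB : ∀ u v, g u v = B u v)
    (f : Module.Basis (Fin n) ℝ V)
    (hf : ∀ m m', g (f m) (f m') = if m = m' then 1 else 0)
    (vol : V [⋀^Fin n]→L[ℝ] ℝ) (β : V [⋀^Fin k]→L[ℝ] ℝ) (σ : Equiv.Perm (Fin n)) :
    hodgeStar h g vol β (fun a => f (σ ((Fin.natAdd k a).cast h))) =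
      (Equiv.Perm.sign σ : ℤ) * vol f * β (fun a => f (σ ((Fin.castAdd l a).cast h))) := by
  subst h
  set w : Fin l → V := fun a => f (σ (Fin.natAdd k a)) with hw
  set u : Fin k → V := fun a => f (σ (Fin.castAdd l a)) with hu
  let e : Equiv.Perm (Fin (k + l)) := finAddFlip.trans (finCongr (Nat.add_comm l k))
  -- `insertFirst` puts the fixed vectors `w` in front; the sign of the block flip `e` moves them
  -- behind the free arguments.
  let Q : V [⋀^Fin k]→L[ℝ] ℝ :=
    ((Equiv.Perm.sign e : ℤ) : ℝ) • insertFirst (Nat.add_comm l k) vol w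
  have hQ : ∀ v, Q v = vol (Fin.append v w) := by
    intro v
    have h1 := vol.toAlternatingMap.map_perm
      (fun i => Fin.append w v (Fin.cast (Nat.add_comm k l) i)) e
    have h2 : (fun i => Fin.append w v (Fin.cast (Nat.add_comm k l) i)) ∘ e = Fin.append v w := by
      ext i; refine Fin.addCases (fun i => ?_) (fun i => ?_) i <;> simp [e]
    rw [h2] at h1
    change _ * insertFirst (Nat.add_comm l k) vol w v = _
    rw [insertFirst_apply]
    refine Eq.trans ?_ h1.symm
    simp [Units.smul_def]
  have h1 : hodgeStar rfl g vol β w = (k.factorial : ℝ)⁻¹ * ∑ m : Fin k → Fin (k + l),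
      β (fun a => f (m a)) * Q (fun a => f (m a)) := by
    have := sum_gramInv_mul g B hB (Module.finBasis ℝ V) f hf β.toMultilinearMap Q.toMultilinearMap
    simp only [ContinuousMultilinearMap.coe_coe,
      ContinuousAlternatingMap.coe_toContinuousMultilinearMap, hQ] at this
    simp only [hQ, ← this, hodgeStar]
    rw [ContinuousAlternatingMap.smul_apply, ContinuousAlternatingMap.sum_apply]
    simp only [ContinuousAlternatingMap.sum_apply, ContinuousAlternatingMap.smul_apply]
    rfl
  have hfac : (k.factorial : ℝ) ≠ 0 := by positivity
  change hodgeStar rfl g vol β w = _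
  -- Only index tuples that permute the first block survive: a repeated index kills `β`, and an
  -- index belonging to `w` kills `vol`. On the survivors the two signs multiply to `1`, so the sum
  -- is `k!` equal terms.
  have h2 : ∑ m : Fin k → Fin (k + l), β (fun a => f (m a)) * Q (fun a => f (m a)) =
      ∑ τ : Equiv.Perm (Fin k), β u * Q u := by
    symm
    refine Finset.sum_of_injOn (fun τ a => σ (Fin.castAdd l (τ a))) ?_ (by simp) ?_ ?_
    · intro τ _ τ' _ h
      ext a
      have := congrFun h a
      exact congrArg _ (Fin.castAdd_injective k l (σ.injective this))
    · intro m _ hm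
      by_contra hne
      have hm1 : Function.Injective m := fun x y hxy => by
        by_contra hxy'
        exact hne (by rw [β.map_eq_zero_of_eq _ (congrArg f hxy) hxy', zero_mul])
      have hm2 : ∀ a, ∃ a', σ (Fin.castAdd l a') = m a := fun a => by
        by_contra! hcon
        obtain ⟨y, hy⟩ := σ.surjective (m a)
        induction y using Fin.addCases with
        | left y => exact hcon y hy
        | right y =>
          refine hne ?_
          rw [hQ, vol.map_eq_zero_of_eq _ (i := Fin.castAdd l a) (j := Fin.natAdd k y)
            (by simp [hw, hy]) (by simp [Fin.ext_iff]; omega), mul_zero]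
      choose τ hτ using hm2
      have hτi : Function.Injective τ := fun x y hxy => hm1 (by rw [← hτ, ← hτ, hxy])
      exact hm ⟨Equiv.ofBijective τ (Finite.injective_iff_bijective.mp hτi), by simp,
        funext fun a => hτ a⟩
    · intro τ _
      have hβ := β.toAlternatingMap.map_perm u τ
      have hQ' := Q.toAlternatingMap.map_perm u τ
      have hs : (((Equiv.Perm.sign τ : ℤˣ) : ℤ) : ℝ) * ((Equiv.Perm.sign τ : ℤˣ) : ℤ) = 1 := by
        exact_mod_cast Int.units_coe_mul_self (Equiv.Perm.sign τ)
      rw [Units.smul_def, zsmul_eq_mul] at hβ hQ'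
      change _ = β (u ∘ τ) * Q (u ∘ τ)
      refine Eq.trans ?_ (congrArg₂ (· * ·) hβ hQ').symm
      change β u * Q u = (_ * β u) * (_ * Q u)
      linear_combination (-β u * Q u) * hs
  rw [h1, h2, Finset.sum_const, Finset.card_univ, Fintype.card_perm, Fintype.card_fin, hQ,
    nsmul_eq_mul, inv_mul_cancel_left₀ hfac]
  have : Fin.append u w = f ∘ σ := by
    ext i; refine Fin.addCases (fun i => ?_) (fun i => ?_) i <;> simp [hu, hw]
  rw [this]
  have hv := vol.toAlternatingMap.map_perm f σ
  rw [Units.smul_def, zsmul_eq_mul] at hv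
  change β u * vol.toAlternatingMap (f ∘ σ) = _
  rw [hv]
  exact mul_comm _ _

end MultilinearAlgebra

/-! ### Unitary frames of a 6-dimensional Hermitian space with a complex volume form. -/

section UnitaryFrame

/-- The Levi-Civita symbol on `{0, 1, 2}`. -/
def eps3 (a b c : ℕ) : ℤ := (b - a) * (c - a) * (c - b) / 2

/-- The real part of `I ^ n`. -/
def reIPow (n : ℕ) : ℤ := if n % 4 = 0 then 1 else if n % 4 = 2 then -1 else 0

/-- The imaginary part of `I ^ n`. -/
def imIPow (n : ℕ) : ℤ := if n % 4 = 1 then 1 else if n % 4 = 3 then -1 else 0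

/-- The real part of `dz₁ ∧ dz₂ ∧ dz₃` on basis vectors `x₁, y₁, x₂, y₂, x₃, y₃, r`. -/
def reOmega (i j k : ℕ) : ℤ :=
  if i < 6 ∧ j < 6 ∧ k < 6 then
    eps3 (i / 2) (j / 2) (k / 2) * reIPow (i % 2 + j % 2 + k % 2) else 0

/-- The imaginary part of `dz₁ ∧ dz₂ ∧ dz₃` on basis vectors `x₁, y₁, x₂, y₂, x₃, y₃, r`. -/
def imOmega (i j k : ℕ) : ℤ :=
  if i < 6 ∧ j < 6 ∧ k < 6 then
    eps3 (i / 2) (j / 2) (k / 2) * imIPow (i % 2 + j % 2 + k % 2) else 0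

/-- The standard Hermitian form on basis vectors `x₁, y₁, x₂, y₂, x₃, y₃, r`. -/
def stdOmega (i j : ℕ) : ℤ := if i / 2 = j / 2 then j - i else 0

theorem permCons_one {n : ℕ} (q : Fin (n + 2) × Equiv.Perm (Fin (n + 1))) :
    permCons q 1 = q.1.succAbove (q.2 0) := permCons_succ q 0

theorem permCons_two {n : ℕ} (q : Fin (n + 3) × Equiv.Perm (Fin (n + 2))) :
    permCons q 2 = q.1.succAbove (q.2 1) := permCons_succ q 1

theorem permCons_three {n : ℕ} (q : Fin (n + 4) × Equiv.Perm (Fin (n + 3))) :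
    permCons q 3 = q.1.succAbove (q.2 2) := permCons_succ q 2

theorem permCons_four {n : ℕ} (q : Fin (n + 5) × Equiv.Perm (Fin (n + 4))) :
    permCons q 4 = q.1.succAbove (q.2 3) := permCons_succ q 3

theorem permCons_five {n : ℕ} (q : Fin (n + 6) × Equiv.Perm (Fin (n + 5))) :
    permCons q 5 = q.1.succAbove (q.2 4) := permCons_succ q 4

theorem sum_perm_omega_re :
    ∑ σ : Equiv.Perm (Fin 6), (Equiv.Perm.sign σ : ℤ) *
      (reOmega (σ 0) (σ 1) (σ 2) * reOmega (σ 3) (σ 4) (σ 5) +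
        imOmega (σ 0) (σ 1) (σ 2) * imOmega (σ 3) (σ 4) (σ 5)) = 0 := by
  simp only [sum_perm_succ, sign_permCons, permCons_zero, permCons_one, permCons_two,
    permCons_three, permCons_four, permCons_five]
  decide +kernel

/-- Here `-288 = -8 · 3! · 3!`; after division by the `3! · 3!` of the wedge product, this is the
constant in `Ω ∧ Ω̄ = -8i vol`. -/
theorem sum_perm_omega_im :
    ∑ σ : Equiv.Perm (Fin 6), (Equiv.Perm.sign σ : ℤ) *
      (imOmega (σ 0) (σ 1) (σ 2) * reOmega (σ 3) (σ 4) (σ 5) -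
        reOmega (σ 0) (σ 1) (σ 2) * imOmega (σ 3) (σ 4) (σ 5)) = -288 := by
  simp only [sum_perm_succ, sign_permCons, permCons_zero, permCons_one, permCons_two,
    permCons_three, permCons_four, permCons_five]
  decide +kernel

variable {V : Type*} [AddCommGroup V] [Module ℝ V]

/-- The vectors `e₁, J e₁, e₂, J e₂, e₃, J e₃`. -/
def complexFrame (J : V → V) (e : Fin 3 → V) (i : Fin 6) : V :=
  if (i : ℕ) % 2 = 0 then e ⟨i / 2, by omega⟩ else J (e ⟨i / 2, by omega⟩)

/-- Fewer linear conditions than the dimension leave a nonzero common kernel vector, which is then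
normalised. -/
theorem exists_unit_orthogonal [FiniteDimensional ℝ V] (B : V →ₗ[ℝ] V →ₗ[ℝ] ℝ)
    (hpos : ∀ u, u ≠ 0 → 0 < B u u) {m : ℕ} (w : Fin m → V) (hm : m < Module.finrank ℝ V) :
    ∃ v, B v v = 1 ∧ ∀ i, B (w i) v = 0 := by
  have hker := LinearMap.ker_ne_bot_of_finrank_lt (f := LinearMap.pi fun i => B (w i))
    (by simpa using hm)
  obtain ⟨v, hv, hv0⟩ := (Submodule.ne_bot_iff _).mp hker
  have hp := hpos v hv0
  have hs : √(B v v) ≠ 0 := (Real.sqrt_pos.mpr hp).ne'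
  refine ⟨(√(B v v))⁻¹ • v, ?_, fun i => ?_⟩
  · simp only [map_smul, LinearMap.smul_apply, smul_eq_mul]
    have := Real.mul_self_sqrt hp.le
    field_simp
    linarith
  · have := congrFun (LinearMap.mem_ker.mp hv) i
    simp only [LinearMap.pi_apply, Pi.zero_apply] at this
    simp [this]

/-- A triple of vectors that is orthonormal for the Hermitian inner product. -/
def IsUnitaryTriple (B : V →ₗ[ℝ] V →ₗ[ℝ] ℝ) (J : V → V) (e : Fin 3 → V) : Prop :=
  ∀ i j, B (e i) (e j) = (if i = j then 1 else 0) ∧ B (e i) (J (e j)) = 0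

/-- Complex Gram–Schmidt: each new vector is taken orthogonal to the previous ones and to their
images under `J`. The relations with `J` in the other slot follow because `J` is skew for `B`. -/
theorem exists_isUnitaryTriple [FiniteDimensional ℝ V] (B : V →ₗ[ℝ] V →ₗ[ℝ] ℝ)
    (hsymm : ∀ u v, B u v = B v u) (hpos : ∀ u, u ≠ 0 → 0 < B u u) (J : V →ₗ[ℝ] V)
    (hJ : ∀ u, J (J u) = -u) (hJB : ∀ u v, B (J u) (J v) = B u v)
    (hd : Module.finrank ℝ V = 6) : ∃ e : Fin 3 → V, IsUnitaryTriple B J e := by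
  have hskew : ∀ u v, B u (J v) = -B (J u) v := fun u v => by
    rw [← hJB u (J v), hJ, map_neg]
  have hself : ∀ u, B u (J u) = 0 := fun u => by
    have := hskew u u
    rw [hsymm (J u) u] at this
    linarith
  obtain ⟨a, ha, -⟩ := exists_unit_orthogonal B hpos ![] (by omega)
  obtain ⟨b, hb, hb'⟩ := exists_unit_orthogonal B hpos ![a, J a] (by omega)
  obtain ⟨c, hc, hc'⟩ := exists_unit_orthogonal B hpos ![a, J a, b, J b] (by omega)
  have hab : B a b = 0 := hb' 0
  have hab' : B (J a) b = 0 := hb' 1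
  have hac : B a c = 0 := hc' 0
  have hac' : B (J a) c = 0 := hc' 1
  have hbc : B b c = 0 := hc' 2
  have hbc' : B (J b) c = 0 := hc' 3
  have h1 : B a (J b) = 0 := by rw [hskew, hab', neg_zero]
  have h2 : B a (J c) = 0 := by rw [hskew, hac', neg_zero]
  have h3 : B b (J c) = 0 := by rw [hskew, hbc', neg_zero]
  have h4 : B b (J a) = 0 := by rw [hsymm, hab']
  have h5 : B c (J a) = 0 := by rw [hsymm, hac']
  have h6 : B c (J b) = 0 := by rw [hsymm, hbc']
  have h7 : B b a = 0 := by rw [hsymm, hab]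
  have h8 : B c a = 0 := by rw [hsymm, hac]
  have h9 : B c b = 0 := by rw [hsymm, hbc]
  refine ⟨![a, b, c], fun i j => ?_⟩
  fin_cases i <;> fin_cases j <;>
    simp [ha, hb, hc, hab, hac, hbc, hself, h1, h2, h3, h4, h5, h6, h7, h8, h9]

theorem IsUnitaryTriple.gram {B : V →ₗ[ℝ] V →ₗ[ℝ] ℝ} (hsymm : ∀ u v, B u v = B v u)
    {J : V →ₗ[ℝ] V} (hJB : ∀ u v, B (J u) (J v) = B u v) {e : Fin 3 → V}
    (he : IsUnitaryTriple B J e) (i j : Fin 6) :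
    B (complexFrame J e i) (complexFrame J e j) = if i = j then 1 else 0 := by
  have h1 : ∀ i j, B (e i) (e j) = (if i = j then 1 else 0) := fun i j => (he i j).1
  have h2 : ∀ i j, B (e i) (J (e j)) = 0 := fun i j => (he i j).2
  have h3 : ∀ i j, B (J (e i)) (e j) = 0 := fun i j => by rw [hsymm, h2]
  simp only [complexFrame]
  rcases Nat.mod_two_eq_zero_or_one i with hi | hi <;>
    rcases Nat.mod_two_eq_zero_or_one j with hj | hj <;>
    simp only [hi, hj, one_ne_zero, if_true, if_false, hJB, h1, h2, h3, Fin.ext_iff] <;>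
    split_ifs <;> first | rfl | (exfalso; omega)

theorem IsUnitaryTriple.hermitian {B : V →ₗ[ℝ] V →ₗ[ℝ] ℝ} (hsymm : ∀ u v, B u v = B v u)
    {J : V →ₗ[ℝ] V} (hJ : ∀ u, J (J u) = -u) (hJB : ∀ u v, B (J u) (J v) = B u v)
    {e : Fin 3 → V} (he : IsUnitaryTriple B J e) (i j : Fin 6) :
    B (J (complexFrame J e i)) (complexFrame J e j) = stdOmega i j := by
  have h1 : ∀ i j, B (e i) (e j) = (if i = j then 1 else 0) := fun i j => (he i j).1
  have h2 : ∀ i j, B (e i) (J (e j)) = 0 := fun i j => (he i j).2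
  have h3 : ∀ i j, B (J (e i)) (e j) = 0 := fun i j => by rw [hsymm, h2]
  simp only [complexFrame, stdOmega]
  rcases Nat.mod_two_eq_zero_or_one i with hi | hi <;>
    rcases Nat.mod_two_eq_zero_or_one j with hj | hj <;>
    simp only [hi, hj, one_ne_zero, if_true, if_false, hJB, hJ, map_neg, LinearMap.neg_apply,
      h1, h2, h3, Fin.ext_iff] <;>
    split_ifs with h <;> simp
  all_goals
    first
    | (have : (i : ℕ) = j := by omega
       simp [this])
    | (have : (j : ℕ) = i + 1 := by omega
       simp [this])
    | (have : (i : ℕ) = j + 1 := by omega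
       simp [this])

/-- Multiplying one vector by the unit complex number `x + iy` changes the phase of `Ω e` at will
while the triple stays unitary. -/
theorem IsUnitaryTriple.rotate {B : V →ₗ[ℝ] V →ₗ[ℝ] ℝ} (hsymm : ∀ u v, B u v = B v u)
    {J : V →ₗ[ℝ] V} (hJ : ∀ u, J (J u) = -u) (hJB : ∀ u v, B (J u) (J v) = B u v)
    {e : Fin 3 → V} (he : IsUnitaryTriple B J e) {x y : ℝ} (hxy : x ^ 2 + y ^ 2 = 1) :
    IsUnitaryTriple B J (Function.update e 0 (x • e 0 + y • J (e 0))) := by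
  have h1 : ∀ i j, B (e i) (e j) = (if i = j then 1 else 0) := fun i j => (he i j).1
  have h2 : ∀ i j, B (e i) (J (e j)) = 0 := fun i j => (he i j).2
  have h3 : ∀ i j, B (J (e i)) (e j) = 0 := fun i j => by rw [hsymm, h2]
  intro i j
  by_cases hi : i = 0 <;> by_cases hj : j = 0
  · subst hi hj
    simp only [Function.update_self, map_add, map_smul, LinearMap.add_apply, LinearMap.smul_apply,
      smul_eq_mul, hJ, hJB, map_neg, h1, h2, h3]
    constructor <;> simp <;> linarith
  · subst hi
    simp [Function.update_of_ne hj, h1, h2, h3, hJB, Ne.symm hj]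
  · subst hj
    simp [h1, h2, hJ, hi]
  · simp [Function.update_of_ne hi, Function.update_of_ne hj, h1, h2]

variable [TopologicalSpace V]

theorem eps3_perm (σ : Equiv.Perm (Fin 3)) :
    eps3 (σ 0) (σ 1) (σ 2) = (Equiv.Perm.sign σ : ℤ) := by
  revert σ; decide

theorem alternating_three_apply (Ω : V [⋀^Fin 3]→L[ℝ] ℂ) (e : Fin 3 → V) (i j k : Fin 3) :
    Ω ![e i, e j, e k] = eps3 i j k * Ω e := by
  by_cases h : Function.Injective ![i, j, k]
  · let σ : Equiv.Perm (Fin 3) := Equiv.ofBijective _ (Finite.injective_iff_bijective.mp h)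
    have h1 := Ω.toAlternatingMap.map_perm e σ
    have h2 := eps3_perm σ
    rw [Units.smul_def, zsmul_eq_mul, ← h2] at h1
    rw [show (![e i, e j, e k] : Fin 3 → V) = e ∘ σ by ext a; fin_cases a <;> rfl]
    exact h1
  · have h0 : eps3 i j k = 0 := by
      revert i j k; decide
    rw [h0, Int.cast_zero, zero_mul]
    simp only [Function.Injective, not_forall] at h
    obtain ⟨a, b, hab, hne⟩ := h
    refine Ω.map_eq_zero_of_eq _ (i := a) (j := b) ?_ hne
    fin_cases a <;> fin_cases b <;> simp_all

theorem reIPow_add_imIPow (n : ℕ) : (reIPow n : ℂ) + imIPow n * Complex.I = Complex.I ^ n := by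
  rw [← Nat.mod_add_div n 4, pow_add, pow_mul, Complex.I_pow_four, one_pow, mul_one]
  have : n % 4 < 4 := Nat.mod_lt _ (by norm_num)
  simp only [reIPow, imIPow, Nat.add_mul_mod_self_left, Nat.mod_mod]
  interval_cases n % 4 <;> simp [Complex.I_sq, pow_three]

/-- By type `(3, 0)` each `J` contributes a factor `I`; what remains is `Ω` on three of the vectors
`e`, where alternation contributes the Levi-Civita symbol. -/
theorem complexFrame_omega (J : V → V) (Ω : V [⋀^Fin 3]→L[ℝ] ℂ)
    (hΩ : ∀ (v : Fin 3 → V) (i : Fin 3), Ω (Function.update v i (J (v i))) = Complex.I * Ω v)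
    (e : Fin 3 → V) (i j k : Fin 6) :
    Ω ![complexFrame J e i, complexFrame J e j, complexFrame J e k] =
      ((reOmega i j k : ℂ) + imOmega i j k * Complex.I) * Ω e := by
  have h0 : ∀ u v w, Ω ![J u, v, w] = Complex.I * Ω ![u, v, w] := fun u v w => by
    have := hΩ ![u, v, w] 0
    rwa [show Function.update ![u, v, w] 0 (J (![u, v, w] 0)) = ![J u, v, w] by
      ext a; fin_cases a <;> simp] at this
  have h1 : ∀ u v w, Ω ![u, J v, w] = Complex.I * Ω ![u, v, w] := fun u v w => by
    have := hΩ ![u, v, w] 1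
    rwa [show Function.update ![u, v, w] 1 (J (![u, v, w] 1)) = ![u, J v, w] by
      ext a; fin_cases a <;> simp] at this
  have h2 : ∀ u v w, Ω ![u, v, J w] = Complex.I * Ω ![u, v, w] := fun u v w => by
    have := hΩ ![u, v, w] 2
    rwa [show Function.update ![u, v, w] 2 (J (![u, v, w] 2)) = ![u, v, J w] by
      ext a; fin_cases a <;> simp] at this
  have hI := reIPow_add_imIPow ((i : ℕ) % 2 + (j : ℕ) % 2 + (k : ℕ) % 2)
  have he := alternating_three_apply Ω e ⟨i / 2, by omega⟩ ⟨j / 2, by omega⟩ ⟨k / 2, by omega⟩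
  have hl : (i : ℕ) < 6 ∧ (j : ℕ) < 6 ∧ (k : ℕ) < 6 := ⟨i.2, j.2, k.2⟩
  simp only [reOmega, imOmega, if_pos hl]
  push_cast
  rw [show (eps3 (i / 2) (j / 2) (k / 2) * reIPow (i % 2 + j % 2 + k % 2) +
    eps3 (i / 2) (j / 2) (k / 2) * imIPow (i % 2 + j % 2 + k % 2) * Complex.I) * Ω e =
    Complex.I ^ ((i : ℕ) % 2 + j % 2 + k % 2) * (eps3 (i / 2) (j / 2) (k / 2) * Ω e) by
      rw [← hI]; ring]
  simp only at he
  rw [← he]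
  simp only [complexFrame]
  rcases Nat.mod_two_eq_zero_or_one i with hi | hi <;>
    rcases Nat.mod_two_eq_zero_or_one j with hj | hj <;>
    rcases Nat.mod_two_eq_zero_or_one k with hk | hk <;>
    simp [hi, hj, hk, h0, h1, h2] <;> ring_nf <;> simp [pow_three]

theorem wedge_conj_complexFrame (J : V → V) (Ω : V [⋀^Fin 3]→L[ℝ] ℂ)
    (hΩ : ∀ (v : Fin 3 → V) (i : Fin 3), Ω (Function.update v i (J (v i))) = Complex.I * Ω v)
    (e : Fin 3 → V) :
    wedge Ω (conjForm Ω) (complexFrame J e) = -8 * Complex.I * Complex.normSq (Ω e) := by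
  rw [wedge_apply]
  change _ • (∑ σ : Equiv.Perm (Fin 6), Equiv.Perm.sign σ •
    (Ω (fun i => complexFrame J e (σ (Fin.castAdd 3 i))) *
      (starRingEnd ℂ) (Ω (fun i => complexFrame J e (σ (Fin.natAdd 3 i)))))) = _
  have h1 : ∀ σ : Equiv.Perm (Fin 6), (fun i : Fin 3 => complexFrame J e (σ (Fin.castAdd 3 i))) =
      ![complexFrame J e (σ 0), complexFrame J e (σ 1), complexFrame J e (σ 2)] :=
    fun σ => by ext i; fin_cases i <;> rfl
  have h2 : ∀ σ : Equiv.Perm (Fin 6), (fun i : Fin 3 => complexFrame J e (σ (Fin.natAdd 3 i))) =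
      ![complexFrame J e (σ 3), complexFrame J e (σ 4), complexFrame J e (σ 5)] :=
    fun σ => by ext i; fin_cases i <;> rfl
  simp only [h1, h2, complexFrame_omega J Ω hΩ, map_mul, map_add, Complex.conj_I, map_intCast]
  have hre := congrArg (fun n : ℤ => (n : ℂ)) sum_perm_omega_re
  have him := congrArg (fun n : ℤ => (n : ℂ)) sum_perm_omega_im
  push_cast at hre him
  have hn : Ω e * (starRingEnd ℂ) (Ω e) = Complex.normSq (Ω e) := Complex.mul_conj _
  have hterm : ∀ σ : Equiv.Perm (Fin 6), Equiv.Perm.sign σ •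
      ((((reOmega (σ 0) (σ 1) (σ 2) : ℂ) + imOmega (σ 0) (σ 1) (σ 2) * Complex.I) * Ω e) *
      (((reOmega (σ 3) (σ 4) (σ 5) : ℂ) + imOmega (σ 3) (σ 4) (σ 5) * -Complex.I) *
        (starRingEnd ℂ) (Ω e))) =
      ((Equiv.Perm.sign σ : ℤ) * ((reOmega (σ 0) (σ 1) (σ 2) : ℂ) * reOmega (σ 3) (σ 4) (σ 5) +
        imOmega (σ 0) (σ 1) (σ 2) * imOmega (σ 3) (σ 4) (σ 5))) * Complex.normSq (Ω e) +
      ((Equiv.Perm.sign σ : ℤ) * ((imOmega (σ 0) (σ 1) (σ 2) : ℂ) * reOmega (σ 3) (σ 4) (σ 5) -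
        reOmega (σ 0) (σ 1) (σ 2) * imOmega (σ 3) (σ 4) (σ 5))) *
          (Complex.I * Complex.normSq (Ω e)) := by
    intro σ
    rw [Units.smul_def, zsmul_eq_mul, ← hn]
    linear_combination (-(Equiv.Perm.sign σ : ℤ) * imOmega (σ 0) (σ 1) (σ 2) *
      imOmega (σ 3) (σ 4) (σ 5) * (Ω e * (starRingEnd ℂ) (Ω e))) * Complex.I_sq
  simp only [hterm, Finset.sum_add_distrib, ← Finset.sum_mul, hre, him]
  norm_num [Nat.factorial, Complex.real_smul]
  ring

/-- An oriented unitary frame with prescribed value of the complex volume form. -/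
theorem exists_su3_frame [FiniteDimensional ℝ V] (B : V →ₗ[ℝ] V →ₗ[ℝ] ℝ)
    (hsymm : ∀ u v, B u v = B v u) (hpos : ∀ u, u ≠ 0 → 0 < B u u) (J : V →ₗ[ℝ] V)
    (hJ : ∀ u, J (J u) = -u) (hJB : ∀ u v, B (J u) (J v) = B u v)
    (hd : Module.finrank ℝ V = 6) (Ω : V [⋀^Fin 3]→L[ℝ] ℂ) (vol : V [⋀^Fin 6]→L[ℝ] ℝ)
    (hΩ : ∀ (v : Fin 3 → V) (i : Fin 3), Ω (Function.update v i (J (v i))) = Complex.I * Ω v)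
    (hvol : ∀ v : Fin 6 → V, vol v ^ 2 = (Matrix.of fun i j => B (v i) (v j)).det)
    (hΩvol : wedge Ω (conjForm Ω) = (-8 * Complex.I) • toComplexForm vol)
    (c : ℂ) (hc : Complex.normSq c = 1) :
    ∃ e : Fin 3 → V, IsUnitaryTriple B J e ∧ Ω e = c ∧ vol (complexFrame J e) = 1 := by
  -- Evaluating `Ω ∧ Ω̄ = -8i vol` on the frame gives `vol = |Ω e|² ≥ 0`, and the Gram determinant
  -- gives `vol² = 1`, so both equal `1`. The orientation of a unitary frame is therefore forced.
  have key : ∀ e, IsUnitaryTriple B J e →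
      Complex.normSq (Ω e) = 1 ∧ vol (complexFrame J e) = 1 := by
    intro e he
    have h1 := wedge_conj_complexFrame J Ω hΩ e
    rw [hΩvol] at h1
    have h2 : (-8 * Complex.I) * ((vol (complexFrame J e) : ℝ) : ℂ) =
      -8 * Complex.I * Complex.normSq (Ω e) := h1
    have h3 : vol (complexFrame J e) = Complex.normSq (Ω e) := by
      exact_mod_cast mul_left_cancel₀ (by simp) h2
    have h4 := hvol (complexFrame J e)
    have h5 : (Matrix.of fun i j => B (complexFrame J e i) (complexFrame J e j)) = 1 := by
      ext i j
      simp [he.gram hsymm hJB, Matrix.one_apply]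
    rw [h5, Matrix.det_one] at h4
    have h6 := Complex.normSq_nonneg (Ω e)
    have h7 : vol (complexFrame J e) = 1 := by nlinarith
    exact ⟨by rw [← h3, h7], h7⟩
  obtain ⟨e, he⟩ := exists_isUnitaryTriple B hsymm hpos J hJ hJB hd
  set z := Ω e with hz
  have hz1 := (key e he).1
  have hz0 : z ≠ 0 := fun h => by rw [← hz, h] at hz1; simp at hz1
  have hw : Complex.normSq (c / z) = 1 := by rw [map_div₀, hc, hz1, div_one]
  have hxy : (c / z).re ^ 2 + (c / z).im ^ 2 = 1 := by
    rw [Complex.normSq_apply] at hw; nlinarith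
  -- The unit number `c / z` corrects the phase `z` of `Ω e` to the prescribed `c`.
  have he' := he.rotate hsymm hJ hJB hxy
  refine ⟨_, he', ?_, (key _ he').2⟩
  rw [Ω.map_update_add, Ω.map_update_smul, Ω.map_update_smul, hΩ, Function.update_eq_self, ← hz,
    Complex.real_smul, Complex.real_smul]
  calc ((c / z).re : ℂ) * z + (c / z).im * (Complex.I * z)
      = ((c / z).re + (c / z).im * Complex.I) * z := by ring
    _ = c := by rw [Complex.re_add_im, div_mul_cancel₀ _ hz0]

end UnitaryFrame

/-! ### The standard forms on `ℂ³ ⊕ ℝ` and their Hodge stars. -/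

section AdaptedBasis

/-- The 4-form `ω ∧ ω` on basis vectors. -/
def stdOmegaSq (a b c d : ℕ) : ℤ :=
  2 * (stdOmega a b * stdOmega c d - stdOmega a c * stdOmega b d + stdOmega a d * stdOmega b c)

/-- The form `dr` on basis vectors. -/
def stdDr (a : ℕ) : ℤ := if a = 6 then 1 else 0

/-- The 3-form `dr ∧ ω` on basis vectors. -/
def stdDrOmega (a b c : ℕ) : ℤ :=
  stdDr a * stdOmega b c - stdDr b * stdOmega a c + stdDr c * stdOmega a b

/-- The 4-form `dr ∧ Im Ω` on basis vectors. -/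
def stdDrIm (a b c d : ℕ) : ℤ :=
  stdDr a * imOmega b c d - stdDr b * imOmega a c d + stdDr c * imOmega a b d -
    stdDr d * imOmega a b c

/-- The indices `p`, `p.succAbove q`, `p.succAbove (q.succAbove r)` run over all ordered triples of
distinct elements of `Fin 7`. The remaining four indices come in increasing order, and `(-1) ^ (p +
q + r)` is the sign of the resulting permutation. -/
theorem star_stdOmegaSq : ∀ (p : Fin 7) (q : Fin 6) (r : Fin 5),
    (-1) ^ ((p : ℕ) + q + r) *
      stdOmegaSq (p.succAbove (q.succAbove (r.succAbove 0)))
        (p.succAbove (q.succAbove (r.succAbove 1))) (p.succAbove (q.succAbove (r.succAbove 2)))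
        (p.succAbove (q.succAbove (r.succAbove 3))) =
      2 * stdDrOmega p (p.succAbove q) (p.succAbove (q.succAbove r)) := by
  decide +kernel

theorem star_stdDrIm : ∀ (p : Fin 7) (q : Fin 6) (r : Fin 5),
    (-1) ^ ((p : ℕ) + q + r) *
      stdDrIm (p.succAbove (q.succAbove (r.succAbove 0)))
        (p.succAbove (q.succAbove (r.succAbove 1))) (p.succAbove (q.succAbove (r.succAbove 2)))
        (p.succAbove (q.succAbove (r.succAbove 3))) =
      -reOmega p (p.succAbove q) (p.succAbove (q.succAbove r)) := by
  decide +kernel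

/-- Summing over all ordered tuples counts each squared norm `4!` times: `288 = 24 · 12` with `|ω²|²
= 12`. Likewise the `96` below is `24 · 4`, from the four components `±1` of `Im Ω`. -/
theorem sum_stdOmegaSq_sq : ∑ a : Fin 7, ∑ b : Fin 7, ∑ c : Fin 7, ∑ d : Fin 7,
    stdOmegaSq a b c d * stdOmegaSq a b c d = 288 := by
  decide +kernel

theorem sum_stdDrIm_sq : ∑ a : Fin 7, ∑ b : Fin 7, ∑ c : Fin 7, ∑ d : Fin 7,
    stdDrIm a b c d * stdDrIm a b c d = 96 := by
  decide +kernel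

theorem sum_stdOmegaSq_mul_stdDrIm : ∑ a : Fin 7, ∑ b : Fin 7, ∑ c : Fin 7, ∑ d : Fin 7,
    stdOmegaSq a b c d * stdDrIm a b c d = 0 := by
  decide +kernel

variable {V : Type*} [AddCommGroup V] [Module ℝ V] [TopologicalSpace V]

theorem sum_fin_four_fun {A : Type*} [AddCommMonoid A] {n : ℕ} (F : (Fin 4 → Fin n) → A) :
    ∑ m, F m = ∑ a, ∑ b, ∑ c, ∑ d, F ![a, b, c, d] := by
  have h : ∀ {k : ℕ} (F : (Fin (k + 1) → Fin n) → A),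
      ∑ m, F m = ∑ a, ∑ m, F (Matrix.vecCons a m) := fun {k} F => by
    rw [← Fintype.sum_prod_type', ← (Fin.consEquiv fun _ : Fin (k + 1) => Fin n).sum_comp]
    rfl
  simp only [h, Finset.univ_unique, Finset.sum_singleton]
  refine Finset.sum_congr rfl fun a _ => Finset.sum_congr rfl fun b _ =>
    Finset.sum_congr rfl fun c _ => Finset.sum_congr rfl fun d _ => ?_
  congr

theorem exists_succAbove_of_injective {n : ℕ} {j : Fin 3 → Fin (n + 3)}
    (hj : Function.Injective j) :
    ∃ (p : Fin (n + 3)) (q : Fin (n + 2)) (r : Fin (n + 1)),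
      j = ![p, p.succAbove q, p.succAbove (q.succAbove r)] := by
  obtain ⟨q, hq⟩ := Fin.exists_succAbove_eq (hj.ne (show (1 : Fin 3) ≠ 0 by decide))
  obtain ⟨s, hs⟩ := Fin.exists_succAbove_eq (hj.ne (show (2 : Fin 3) ≠ 0 by decide))
  have hsq : s ≠ q := fun h => by
    rw [h, hq] at hs
    exact absurd (hj hs) (by decide)
  obtain ⟨r, hr⟩ := Fin.exists_succAbove_eq hsq
  refine ⟨j 0, q, r, ?_⟩
  ext i
  fin_cases i <;> simp [hq, hr, hs]

/-- An alternating form is determined by its values on basis vectors with distinct indices, and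
`succAbove` parametrises those triples. -/
theorem ext_three_form {n : ℕ} (f : Module.Basis (Fin (n + 3)) ℝ V) (X Y : V [⋀^Fin 3]→L[ℝ] ℝ)
    (h : ∀ p q r, X ![f p, f (p.succAbove q), f (p.succAbove (q.succAbove r))] =
      Y ![f p, f (p.succAbove q), f (p.succAbove (q.succAbove r))]) : X = Y := by
  apply ContinuousAlternatingMap.toAlternatingMap_injective
  refine f.ext_alternating fun j hj => ?_
  obtain ⟨p, q, r, rfl⟩ := exists_succAbove_of_injective hj
  have : (fun i => f (![p, p.succAbove q, p.succAbove (q.succAbove r)] i)) =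
      ![f p, f (p.succAbove q), f (p.succAbove (q.succAbove r))] := by
    ext i; fin_cases i <;> rfl
  rw [this]
  exact h p q r

theorem hodgeStar_four_apply_basis [FiniteDimensional ℝ V] (h : 4 + 3 = 7)
    (g : V → V → ℝ) (B : V →ₗ[ℝ] V →ₗ[ℝ] ℝ) (hB : ∀ u v, g u v = B u v)
    (f : Module.Basis (Fin 7) ℝ V) (hf : ∀ m m', g (f m) (f m') = if m = m' then 1 else 0)
    (vol : V [⋀^Fin 7]→L[ℝ] ℝ) (β : V [⋀^Fin 4]→L[ℝ] ℝ) (p : Fin 7) (q : Fin 6) (r : Fin 5) :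
    hodgeStar h g vol β ![f p, f (p.succAbove q), f (p.succAbove (q.succAbove r))] =
      ((-1) ^ ((p : ℕ) + q + r) : ℤ) * vol f *
        β (fun i => f (p.succAbove (q.succAbove (r.succAbove i)))) := by
  let π : Equiv.Perm (Fin 7) := permCons (p, permCons (q, permCons (r, 1)))
  -- `hodgeStar_apply_basis` expects the arguments of the star in the last three places, while `π`
  -- puts them first; the flip of blocks of lengths 4 and 3 is even, so it costs no sign.
  let τ : Equiv.Perm (Fin 7) := finAddFlip (m := 4) (n := 3)
  have h1 := hodgeStar_apply_basis h g B hB f hf vol β (τ.trans π)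
  have hτ : Equiv.Perm.sign τ = 1 := by decide
  have hπ : (Equiv.Perm.sign π : ℤ) = (-1) ^ ((p : ℕ) + q + r) := by
    simp [π, sign_permCons, pow_add, mul_assoc]
  have h2 : (fun a : Fin 3 => f ((τ.trans π) ((Fin.natAdd 4 a).cast h))) =
      ![f p, f (p.succAbove q), f (p.succAbove (q.succAbove r))] := by
    have e0 : τ ((Fin.natAdd 4 (0 : Fin 3)).cast h) = 0 := rfl
    have e1 : τ ((Fin.natAdd 4 (1 : Fin 3)).cast h) = 1 := rfl
    have e2 : τ ((Fin.natAdd 4 (2 : Fin 3)).cast h) = 2 := rfl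
    ext i
    fin_cases i
    · exact congrArg f ((congrArg π e0).trans (by simp [π]))
    · exact congrArg f ((congrArg π e1).trans (by simp [π, permCons_one]))
    · exact congrArg f ((congrArg π e2).trans (by simp [π, permCons_one, permCons_two]))
  have h3 : (fun a : Fin 4 => f ((τ.trans π) ((Fin.castAdd 3 a).cast h))) =
      fun i => f (p.succAbove (q.succAbove (r.succAbove i))) := by
    have e : ∀ a : Fin 4, τ ((Fin.castAdd 3 a).cast h) = a.succ.succ.succ := by
      intro a; fin_cases a <;> rfl
    ext a
    exact congrArg f ((congrArg π (e a)).trans (by simp [π]))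
  rw [h2, h3] at h1
  rw [h1, ← hπ]
  simp [Equiv.Perm.sign_trans, hτ]

/-- A basis in which a metric, a volume form, a 1-form `η`, a Hermitian form `w` and the real and
imaginary parts `P`, `Q` of a complex volume form take their standard values on `ℂ³ ⊕ ℝ`. -/
structure IsAdaptedBasis (f : Module.Basis (Fin 7) ℝ V) (g : V → V → ℝ)
    (vol : V [⋀^Fin 7]→L[ℝ] ℝ) (η : V [⋀^Fin 1]→L[ℝ] ℝ) (w : V [⋀^Fin 2]→L[ℝ] ℝ)
    (P Q : V [⋀^Fin 3]→L[ℝ] ℝ) : Prop where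
  gram : ∀ i j, g (f i) (f j) = if i = j then 1 else 0
  vol_eq : vol f = 1
  η_eq : ∀ i, η (fun _ => f i) = stdDr i
  w_eq : ∀ i j, w ![f i, f j] = stdOmega i j
  P_eq : ∀ i j k, P ![f i, f j, f k] = reOmega i j k
  Q_eq : ∀ i j k, Q ![f i, f j, f k] = imOmega i j k

section

variable {f : Module.Basis (Fin 7) ℝ V} {g : V → V → ℝ} {vol : V [⋀^Fin 7]→L[ℝ] ℝ}
  {η : V [⋀^Fin 1]→L[ℝ] ℝ} {w : V [⋀^Fin 2]→L[ℝ] ℝ} {P Q : V [⋀^Fin 3]→L[ℝ] ℝ}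

theorem IsAdaptedBasis.wedge_w_w (hf : IsAdaptedBasis f g vol η w P Q) (a : Fin 4 → Fin 7) :
    wedge w w (fun i => f (a i)) = stdOmegaSq (a 0) (a 1) (a 2) (a 3) := by
  refine (wedge_two_two_apply w fun i => f (a i)).trans ?_
  simp only [hf.w_eq, stdOmegaSq]
  push_cast
  rfl

theorem IsAdaptedBasis.wedge_η_Q (hf : IsAdaptedBasis f g vol η w P Q) (a : Fin 4 → Fin 7) :
    wedge η Q (fun i => f (a i)) = stdDrIm (a 0) (a 1) (a 2) (a 3) := by
  refine (wedge_one_three_apply η Q fun i => f (a i)).trans ?_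
  simp only [hf.η_eq, hf.Q_eq, stdDrIm]
  push_cast
  rfl

theorem IsAdaptedBasis.hodgeStar_w_w [FiniteDimensional ℝ V]
    (hf : IsAdaptedBasis f g vol η w P Q) (h : 4 + 3 = 7)
    (B : V →ₗ[ℝ] V →ₗ[ℝ] ℝ) (hB : ∀ u v, g u v = B u v) :
    hodgeStar h g vol (wedge w w) = (2 : ℝ) • (wedge η w : V [⋀^Fin 3]→L[ℝ] ℝ) := by
  refine ext_three_form f _ _ fun p q r => ?_
  have key := star_stdOmegaSq p q r
  refine (hodgeStar_four_apply_basis h g B hB f hf.gram vol _ p q r).trans ?_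
  have h1 := hf.wedge_w_w fun i => p.succAbove (q.succAbove (r.succAbove i))
  have h2 := wedge_one_two_apply η w ![f p, f (p.succAbove q), f (p.succAbove (q.succAbove r))]
  simp only [Matrix.cons_val_zero, Matrix.cons_val_one, Matrix.cons_val, hf.η_eq, hf.w_eq] at h2
  change _ = (2 : ℝ) * wedge η w _
  rw [hf.vol_eq, h2]
  refine (congrArg _ h1).trans ?_
  rw [mul_one]
  simp only [stdDrOmega] at key
  exact_mod_cast key

theorem IsAdaptedBasis.hodgeStar_η_Q [FiniteDimensional ℝ V]
    (hf : IsAdaptedBasis f g vol η w P Q) (h : 4 + 3 = 7)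
    (B : V →ₗ[ℝ] V →ₗ[ℝ] ℝ) (hB : ∀ u v, g u v = B u v) :
    hodgeStar h g vol (wedge η Q : V [⋀^Fin 4]→L[ℝ] ℝ) = -P := by
  refine ext_three_form f _ _ fun p q r => ?_
  have key := star_stdDrIm p q r
  refine (hodgeStar_four_apply_basis h g B hB f hf.gram vol _ p q r).trans ?_
  have h1 := hf.wedge_η_Q fun i => p.succAbove (q.succAbove (r.succAbove i))
  change _ = - P _
  rw [hf.vol_eq, hf.P_eq]
  refine (congrArg _ h1).trans ?_
  rw [mul_one]
  exact_mod_cast key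

theorem IsAdaptedBasis.sum_w_w_w_w (hf : IsAdaptedBasis f g vol η w P Q) :
    ∑ m : Fin 4 → Fin 7, wedge w w (fun i => f (m i)) * wedge w w (fun i => f (m i)) = 288 := by
  have h : ∀ m : Fin 4 → Fin 7, wedge w w (fun i => f (m i)) = _ := hf.wedge_w_w
  simp only [sum_fin_four_fun, h]
  exact_mod_cast sum_stdOmegaSq_sq

theorem IsAdaptedBasis.sum_η_Q_η_Q (hf : IsAdaptedBasis f g vol η w P Q) :
    ∑ m : Fin 4 → Fin 7, wedge η Q (fun i => f (m i)) * wedge η Q (fun i => f (m i)) = 96 := by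
  have h : ∀ m : Fin 4 → Fin 7, wedge η Q (fun i => f (m i)) = _ := hf.wedge_η_Q
  simp only [sum_fin_four_fun, h]
  exact_mod_cast sum_stdDrIm_sq

theorem IsAdaptedBasis.sum_w_w_η_Q (hf : IsAdaptedBasis f g vol η w P Q) :
    ∑ m : Fin 4 → Fin 7, wedge w w (fun i => f (m i)) * wedge η Q (fun i => f (m i)) = 0 := by
  have h : ∀ m : Fin 4 → Fin 7, wedge w w (fun i => f (m i)) = _ := hf.wedge_w_w
  have h' : ∀ m : Fin 4 → Fin 7, wedge η Q (fun i => f (m i)) = _ := hf.wedge_η_Q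
  simp only [sum_fin_four_fun, h, h']
  exact_mod_cast sum_stdOmegaSq_mul_stdDrIm

end

theorem hodgeStar_add [FiniteDimensional ℝ V] {k l n : ℕ} (h : k + l = n) (g : V → V → ℝ)
    (vol : V [⋀^Fin n]→L[ℝ] ℝ) (β β' : V [⋀^Fin k]→L[ℝ] ℝ) :
    hodgeStar h g vol (β + β') = hodgeStar h g vol β + hodgeStar h g vol β' := by
  simp only [hodgeStar, ContinuousAlternatingMap.add_apply, mul_add, add_smul,
    Finset.sum_add_distrib, smul_add]

theorem hodgeStar_smul [FiniteDimensional ℝ V] {k l n : ℕ} (h : k + l = n) (g : V → V → ℝ)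
    (vol : V [⋀^Fin n]→L[ℝ] ℝ) (c : ℝ) (β : V [⋀^Fin k]→L[ℝ] ℝ) :
    hodgeStar h g vol (c • β) = c • hodgeStar h g vol β := by
  simp only [hodgeStar, ContinuousAlternatingMap.smul_apply, smul_eq_mul, mul_left_comm _ c,
    mul_smul c]
  rw [smul_comm c, Finset.smul_sum]
  simp only [Finset.smul_sum]

theorem hodgeStar_zero [FiniteDimensional ℝ V] {k l n : ℕ} (h : k + l = n) (g : V → V → ℝ)
    (vol : V [⋀^Fin n]→L[ℝ] ℝ) :
    hodgeStar h g vol (0 : V [⋀^Fin k]→L[ℝ] ℝ) = 0 := by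
  simp [hodgeStar]

end AdaptedBasis

/-! ### Left multiplication by a 1-form, with the degree written `k + 1` to match `extD`. -/

section OneWedge

variable {V : Type*} [AddCommGroup V] [Module ℝ V] [TopologicalSpace V]

/-- The wedge product with a 1-form on the left, as a form of degree `k + 1`. -/
def oneWedge {k : ℕ} (η : V [⋀^Fin 1]→L[ℝ] ℝ) (β : V [⋀^Fin k]→L[ℝ] ℝ) :
    V [⋀^Fin (k + 1)]→L[ℝ] ℝ :=
  Nat.add_comm 1 k ▸ wedge η β

theorem oneWedge_apply {k : ℕ} (η : V [⋀^Fin 1]→L[ℝ] ℝ) (β : V [⋀^Fin k]→L[ℝ] ℝ)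
    (v : Fin (k + 1) → V) :
    oneWedge η β v = ∑ p : Fin (k + 1), (-1) ^ (p : ℕ) *
      (η (fun _ => v p) * β (fun j => v (p.succAbove j))) := by
  have h : ∀ {n m : ℕ} (h : n = m) (a : V [⋀^Fin n]→L[ℝ] ℝ) (v : Fin m → V),
      (h ▸ a : V [⋀^Fin m]→L[ℝ] ℝ) v = a (fun i => v (i.cast h)) := by
    intro n m h a v; subst h; rfl
  rw [oneWedge, h, wedge_one_left_apply]
  rfl

theorem oneWedge_add_right {k : ℕ} (η : V [⋀^Fin 1]→L[ℝ] ℝ) (β β' : V [⋀^Fin k]→L[ℝ] ℝ) :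
    oneWedge η (β + β') = oneWedge η β + oneWedge η β' := by
  ext v
  simp [oneWedge_apply, mul_add, Finset.sum_add_distrib]

theorem oneWedge_smul_right {k : ℕ} (c : ℝ) (η : V [⋀^Fin 1]→L[ℝ] ℝ) (β : V [⋀^Fin k]→L[ℝ] ℝ) :
    oneWedge η (c • β) = c • oneWedge η β := by
  ext v
  simp [oneWedge_apply, Finset.mul_sum, mul_left_comm _ c]

theorem oneWedge_smul_left {k : ℕ} (c : ℝ) (η : V [⋀^Fin 1]→L[ℝ] ℝ) (β : V [⋀^Fin k]→L[ℝ] ℝ) :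
    oneWedge (c • η) β = c • oneWedge η β := by
  ext v
  simp [oneWedge_apply, Finset.mul_sum, mul_left_comm _ c, mul_assoc]

theorem oneWedge_compContinuousLinearMap {W : Type*} [AddCommGroup W] [Module ℝ W]
    [TopologicalSpace W] {k : ℕ} (η : V [⋀^Fin 1]→L[ℝ] ℝ) (β : V [⋀^Fin k]→L[ℝ] ℝ)
    (T : W →L[ℝ] V) : (oneWedge η β).compContinuousLinearMap T =
      oneWedge (η.compContinuousLinearMap T) (β.compContinuousLinearMap T) := by
  ext v
  simp only [ContinuousAlternatingMap.compContinuousLinearMap_apply, oneWedge_apply]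
  rfl

end OneWedge

/-! ### Continuity of the wedge product, used for the smoothness of `ω²`. -/

section WedgeCLM

variable {E : Type*} [NormedAddCommGroup E] [NormedSpace ℝ E]

/-- The wedge product as a continuous bilinear map. -/
def wedgeCLM (k l : ℕ) :
    (E [⋀^Fin k]→L[ℝ] ℝ) →L[ℝ] (E [⋀^Fin l]→L[ℝ] ℝ) →L[ℝ] E [⋀^Fin (k + l)]→L[ℝ] ℝ :=
  LinearMap.mkContinuous₂
    (LinearMap.mk₂ ℝ (fun a b => wedge a b)
      (fun a a' b => by
        ext v
        simp [wedge_apply, add_mul, smul_add, Finset.sum_add_distrib, mul_add])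
      (fun c a b => by
        ext v
        simp only [wedge_apply, ContinuousAlternatingMap.smul_apply, smul_eq_mul, mul_assoc,
          ← mul_smul_comm, Finset.mul_sum, mul_left_comm _ c])
      (fun a b b' => by
        ext v
        simp [wedge_apply, smul_add, Finset.sum_add_distrib, mul_add])
      (fun c a b => by
        ext v
        simp only [wedge_apply, ContinuousAlternatingMap.smul_apply, smul_eq_mul,
          ← mul_smul_comm, Finset.mul_sum, mul_left_comm _ c]))
    (‖((k.factorial * l.factorial : ℝ)⁻¹)‖ * Fintype.card (Equiv.Perm (Fin (k + l))))
    (fun a b => by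
      refine ContinuousAlternatingMap.opNorm_le_bound _ (by positivity) fun v => ?_
      change ‖wedge a b v‖ ≤ _
      rw [wedge_apply, norm_smul]
      simp only [mul_assoc]
      refine mul_le_mul_of_nonneg_left ?_ (norm_nonneg _)
      have : ∀ σ ∈ (Finset.univ : Finset (Equiv.Perm (Fin (k + l)))),
          ‖Equiv.Perm.sign σ • (a (fun i => v (σ (Fin.castAdd l i))) *
            b (fun j => v (σ (Fin.natAdd k j))))‖ ≤ ‖a‖ * (‖b‖ * ∏ i, ‖v i‖) := by
        intro σ _
        have h1 : ‖Equiv.Perm.sign σ • (a (fun i => v (σ (Fin.castAdd l i))) *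
            b (fun j => v (σ (Fin.natAdd k j))))‖ =
            ‖a (fun i => v (σ (Fin.castAdd l i)))‖ * ‖b (fun j => v (σ (Fin.natAdd k j)))‖ := by
          rw [← norm_mul]
          rcases Int.units_eq_one_or (Equiv.Perm.sign σ) with h | h <;> simp [h]
        have h2 : ∏ i, ‖v i‖ = (∏ i : Fin k, ‖v (σ (Fin.castAdd l i))‖) *
            ∏ j : Fin l, ‖v (σ (Fin.natAdd k j))‖ := by
          rw [← Fin.prod_univ_add (fun i => ‖v (σ i)‖), Equiv.prod_comp σ fun i => ‖v i‖]
        rw [h1, h2]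
        calc _ ≤ (‖a‖ * ∏ i : Fin k, ‖v (σ (Fin.castAdd l i))‖) *
              (‖b‖ * ∏ j : Fin l, ‖v (σ (Fin.natAdd k j))‖) := by
              gcongr
              · exact a.le_opNorm _
              · exact b.le_opNorm _
          _ = _ := by ring
      refine (norm_sum_le_of_le _ this).trans_eq ?_
      rw [Finset.sum_const, nsmul_eq_mul]
      rfl)

@[simp] theorem wedgeCLM_apply {k l : ℕ} (a : E [⋀^Fin k]→L[ℝ] ℝ) (b : E [⋀^Fin l]→L[ℝ] ℝ) :
    wedgeCLM k l a b = wedge a b := rfl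

end WedgeCLM

/-! ### Exterior derivatives of warped forms on `E × ℝ`. -/

section ExteriorDerivative

variable {E : Type*} [NormedAddCommGroup E] [NormedSpace ℝ E]

open ContinuousAlternatingMap

/-- This identifies the wedge with the alternatization that defines `extDeriv`, so the Leibniz rule
becomes the product rule for `fderiv`. -/
theorem oneWedge_ofSubsingleton {k : ℕ} (L : E →L[ℝ] ℝ) (β : E [⋀^Fin k]→L[ℝ] ℝ) :
    oneWedge (ofSubsingleton ℝ E ℝ (0 : Fin 1) L) β = alternatizeUncurryFin (L.smulRight β) := by
  ext v
  rw [oneWedge_apply, alternatizeUncurryFin_apply]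
  simp
  rfl

/-- The coefficient `L x * L y` is symmetric in `x` and `y`, so alternating twice gives zero, by the
mechanism behind `d ∘ d = 0`. -/
theorem oneWedge_oneWedge {k : ℕ} (L : E →L[ℝ] ℝ) (β : E [⋀^Fin k]→L[ℝ] ℝ) :
    oneWedge (ofSubsingleton ℝ E ℝ (0 : Fin 1) L)
      (oneWedge (ofSubsingleton ℝ E ℝ (0 : Fin 1) L) β) = 0 := by
  rw [oneWedge_ofSubsingleton, oneWedge_ofSubsingleton]
  have := alternatizeUncurryFin_alternatizeUncurryFinCLM_comp_of_symmetric
    (f := L.smulRight (L.smulRight β)) (fun x y => by simp [smul_smul, mul_comm])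
  rw [← this]
  congr 1
  ext x v
  simp

theorem extDeriv_fun_mul {k : ℕ} {f : E → ℝ} {ω : E → E [⋀^Fin k]→L[ℝ] ℝ} {x : E}
    (hf : DifferentiableAt ℝ f x) (hω : DifferentiableAt ℝ ω x) :
    extDeriv (fun z => f z • ω z) x =
      oneWedge (ofSubsingleton ℝ E ℝ (0 : Fin 1) (fderiv ℝ f x)) (ω x) + f x • extDeriv ω x := by
  rw [extDeriv, fderiv_fun_smul hf hω, alternatizeUncurryFin_add, alternatizeUncurryFin_smul,
    oneWedge_ofSubsingleton]
  exact add_comm _ _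

theorem extDeriv_comp_fst {F : Type*} [NormedAddCommGroup F] [NormedSpace ℝ F] {k : ℕ}
    {η : E → E [⋀^Fin k]→L[ℝ] ℝ} {z : E × F}
    (hη : DifferentiableAt ℝ η z.1) :
    extDeriv (fun z : E × F => (η z.1).compContinuousLinearMap (ContinuousLinearMap.fst ℝ E F)) z =
      (extDeriv η z.1).compContinuousLinearMap (ContinuousLinearMap.fst ℝ E F) := by
  have := extDeriv_pullback (ω := η) (f := (Prod.fst : E × F → E)) (x := z) (r := 2) hη
    contDiff_fst.contDiffAt (by simp)
  simpa [fderiv_fst] using this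

/-- The form `dr` on `E × ℝ`. -/
def dsnd (E : Type*) [NormedAddCommGroup E] [NormedSpace ℝ E] : (E × ℝ) [⋀^Fin 1]→L[ℝ] ℝ :=
  ofSubsingleton ℝ (E × ℝ) ℝ (0 : Fin 1) (ContinuousLinearMap.snd ℝ E ℝ)

/-- The pull-back of a form from `E` to `E × ℝ`. -/
def pullFst {k : ℕ} (β : E [⋀^Fin k]→L[ℝ] ℝ) : (E × ℝ) [⋀^Fin k]→L[ℝ] ℝ :=
  β.compContinuousLinearMap (ContinuousLinearMap.fst ℝ E ℝ)

theorem contDiffAt_pullFst {k : ℕ} {n : WithTop ℕ∞} {η : E → E [⋀^Fin k]→L[ℝ] ℝ} {z : E × ℝ}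
    (hη : ContDiffAt ℝ n η z.1) : ContDiffAt ℝ n (fun z : E × ℝ => pullFst (η z.1)) z := by
  have h := (compContinuousLinearMapCLM (ι := Fin k) (F := ℝ)
    (ContinuousLinearMap.fst ℝ E ℝ)).contDiff (n := n)
  exact h.contDiffAt.comp z (hη.comp z contDiffAt_fst)

theorem differentiableAt_pullFst {k : ℕ} {η : E → E [⋀^Fin k]→L[ℝ] ℝ} {z : E × ℝ}
    (hη : DifferentiableAt ℝ η z.1) :
    DifferentiableAt ℝ (fun z : E × ℝ => pullFst (η z.1)) z := by
  have h := (compContinuousLinearMapCLM (ι := Fin k) (F := ℝ)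
    (ContinuousLinearMap.fst ℝ E ℝ)).differentiable
  exact (h _).comp z (hη.comp z differentiableAt_fst)

theorem differentiableAt_mul_pullFst {k : ℕ} {u : ℝ → ℝ} {η : E → E [⋀^Fin k]→L[ℝ] ℝ}
    {z : E × ℝ} (hu : DifferentiableAt ℝ u z.2) (hη : DifferentiableAt ℝ η z.1) :
    DifferentiableAt ℝ (fun z : E × ℝ => u z.2 • pullFst (η z.1)) z :=
  (hu.comp z differentiableAt_snd).smul (differentiableAt_pullFst hη)

theorem contDiffAt_extDeriv {k : ℕ} {η : E → E [⋀^Fin k]→L[ℝ] ℝ} {x : E}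
    (hη : ContDiffAt ℝ (⊤ : ℕ∞) η x) : ContDiffAt ℝ (⊤ : ℕ∞) (extDeriv η) x := by
  have hb : IsBoundedLinearMap ℝ
      (fun L : E →L[ℝ] E [⋀^Fin k]→L[ℝ] ℝ => alternatizeUncurryFin L) :=
    IsLinearMap.with_bound ⟨alternatizeUncurryFin_add, alternatizeUncurryFin_smul⟩ (k + 1)
      norm_alternatizeUncurryFin_le
  have h : ContDiff ℝ (⊤ : ℕ∞)
      (fun L : E →L[ℝ] E [⋀^Fin k]→L[ℝ] ℝ => alternatizeUncurryFin L) :=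
    IsBoundedLinearMap.contDiff (𝕜 := ℝ) (E := E →L[ℝ] E [⋀^Fin k]→L[ℝ] ℝ)
      (F := E [⋀^Fin (k + 1)]→L[ℝ] ℝ) hb
  exact h.contDiffAt.comp x (hη.fderiv_right (m := (⊤ : ℕ∞)) (by simp))

theorem fderiv_comp_snd {u : ℝ → ℝ} {z : E × ℝ} (hu : DifferentiableAt ℝ u z.2) :
    fderiv ℝ (fun z : E × ℝ => u z.2) z = deriv u z.2 • ContinuousLinearMap.snd ℝ E ℝ := by
  have h : HasFDerivAt (fun z : E × ℝ => u z.2) (deriv u z.2 • ContinuousLinearMap.snd ℝ E ℝ) z :=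
    hu.hasDerivAt.comp_hasFDerivAt z hasFDerivAt_snd
  exact h.fderiv

theorem oneWedge_dsnd_smul {k : ℕ} (c : ℝ) (β : (E × ℝ) [⋀^Fin k]→L[ℝ] ℝ) :
    oneWedge (ofSubsingleton ℝ (E × ℝ) ℝ (0 : Fin 1) (c • ContinuousLinearMap.snd ℝ E ℝ)) β =
      c • oneWedge (dsnd E) β := by
  ext v
  simp [oneWedge_apply, dsnd, Finset.mul_sum, mul_left_comm, mul_assoc]

theorem extDeriv_mul_pullFst {k : ℕ} {u : ℝ → ℝ} {η : E → E [⋀^Fin k]→L[ℝ] ℝ} {z : E × ℝ}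
    (hu : DifferentiableAt ℝ u z.2) (hη : DifferentiableAt ℝ η z.1) :
    extDeriv (fun z : E × ℝ => u z.2 • pullFst (η z.1)) z =
      deriv u z.2 • oneWedge (dsnd E) (pullFst (η z.1)) + u z.2 • pullFst (extDeriv η z.1) := by
  rw [extDeriv_fun_mul (f := fun z : E × ℝ => u z.2) (hu.comp z differentiableAt_snd)
    (differentiableAt_pullFst hη), fderiv_comp_snd hu, oneWedge_dsnd_smul]
  congr 2
  exact extDeriv_comp_fst hη

/-- The identity `dr ∧ η = d(r η) - r dη` reduces both the smoothness and the exterior derivative of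
`dr ∧ η` to facts about `extDeriv`. -/
theorem oneWedge_dsnd_pullFst_eventuallyEq {k : ℕ} {η : E → E [⋀^Fin k]→L[ℝ] ℝ} {z : E × ℝ}
    (hη : ContDiffAt ℝ (⊤ : ℕ∞) η z.1) :
    (fun z : E × ℝ => oneWedge (dsnd E) (pullFst (η z.1))) =ᶠ[nhds z]
      fun z => extDeriv (fun z : E × ℝ => z.2 • pullFst (η z.1)) z +
        (-1 : ℝ) • z.2 • pullFst (extDeriv η z.1) := by
  have h1 : ∀ᶠ y in nhds z.1, DifferentiableAt ℝ η y := by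
    have h2 : ∀ᶠ y in nhds z.1, ContDiffAt ℝ 1 η y :=
      (hη.of_le (by exact_mod_cast le_top)).eventually (by simp)
    exact h2.mono fun y hy => hy.differentiableAt (by simp)
  filter_upwards [continuousAt_fst.eventually h1] with y hy
  have := extDeriv_mul_pullFst (u := id) (z := y) differentiableAt_id hy
  simp only [id_eq, deriv_id, one_smul] at this
  rw [this]
  module

theorem two_le_infty : (2 : WithTop ℕ∞) ≤ ((⊤ : ℕ∞) : WithTop ℕ∞) :=
  WithTop.coe_le_coe.mpr (le_top : (2 : ℕ∞) ≤ ⊤)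

theorem contDiffAt_oneWedge_dsnd_pullFst {k : ℕ} {η : E → E [⋀^Fin k]→L[ℝ] ℝ} {z : E × ℝ}
    (hη : ContDiffAt ℝ (⊤ : ℕ∞) η z.1) :
    ContDiffAt ℝ (⊤ : ℕ∞) (fun z : E × ℝ => oneWedge (dsnd E) (pullFst (η z.1))) z := by
  refine ContDiffAt.congr_of_eventuallyEq ?_ (oneWedge_dsnd_pullFst_eventuallyEq hη)
  exact (contDiffAt_extDeriv (contDiffAt_snd.smul (contDiffAt_pullFst hη))).add
    (ContDiffAt.const_smul (-1 : ℝ) <| contDiffAt_snd.smul (contDiffAt_pullFst (contDiffAt_extDeriv hη)))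

/-- Apply `d` to `dr ∧ η = d(r η) - r dη`: the first term dies by `d ∘ d = 0`, and the second leaves
`-dr ∧ dη` for the same reason. -/
theorem extDeriv_oneWedge_dsnd_pullFst {k : ℕ} {η : E → E [⋀^Fin k]→L[ℝ] ℝ} {z : E × ℝ}
    (hη : ContDiffAt ℝ (⊤ : ℕ∞) η z.1) :
    extDeriv (fun z : E × ℝ => oneWedge (dsnd E) (pullFst (η z.1))) z =
      -oneWedge (dsnd E) (pullFst (extDeriv η z.1)) := by
  have hY : ContDiffAt ℝ (⊤ : ℕ∞) (fun z : E × ℝ => z.2 • pullFst (η z.1)) z :=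
    contDiffAt_snd.smul (contDiffAt_pullFst hη)
  have hdη := contDiffAt_extDeriv hη
  have h1 : DifferentiableAt ℝ (fun z => extDeriv (fun z : E × ℝ => z.2 • pullFst (η z.1)) z) z :=
    (contDiffAt_extDeriv hY).differentiableAt (by simp)
  have h2 : DifferentiableAt ℝ (fun z : E × ℝ => z.2 • pullFst (extDeriv η z.1)) z :=
    (contDiffAt_snd.smul (contDiffAt_pullFst hdη)).differentiableAt (by simp)
  rw [(oneWedge_dsnd_pullFst_eventuallyEq hη).extDeriv_eq]
  have h3 : extDeriv (fun z => extDeriv (fun z : E × ℝ => z.2 • pullFst (η z.1)) z) z = 0 :=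
    extDeriv_extDeriv_apply hY (by simpa using two_le_infty)
  have h4 : extDeriv (extDeriv η) z.1 = 0 :=
    extDeriv_extDeriv_apply hη (by simpa using two_le_infty)
  have h5 := extDeriv_mul_pullFst (u := id) (z := z) differentiableAt_id
    (hdη.differentiableAt (by simp))
  simp only [id_eq, deriv_id, one_smul, h4] at h5
  refine (extDeriv_fun_add h1 (h2.fun_const_smul (-1 : ℝ))).trans ?_
  have h6 : extDeriv (fun z : E × ℝ => (-1 : ℝ) • z.2 • pullFst (extDeriv η z.1)) z =
      (-1 : ℝ) • extDeriv (fun z : E × ℝ => z.2 • pullFst (extDeriv η z.1)) z :=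
    extDeriv_smul (-1 : ℝ) _
  have h7 : pullFst (0 : E [⋀^Fin (k + 1 + 1)]→L[ℝ] ℝ) = 0 := rfl
  rw [h6, h3, h5, h7]
  simp

theorem extDeriv_mul_oneWedge_dsnd_pullFst {k : ℕ} {u : ℝ → ℝ} {η : E → E [⋀^Fin k]→L[ℝ] ℝ}
    {z : E × ℝ} (hu : DifferentiableAt ℝ u z.2) (hη : ContDiffAt ℝ (⊤ : ℕ∞) η z.1) :
    extDeriv (fun z : E × ℝ => u z.2 • oneWedge (dsnd E) (pullFst (η z.1))) z =
      -u z.2 • oneWedge (dsnd E) (pullFst (extDeriv η z.1)) := by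
  rw [extDeriv_fun_mul (f := fun z : E × ℝ => u z.2) (hu.comp z differentiableAt_snd)
    ((contDiffAt_oneWedge_dsnd_pullFst hη).differentiableAt (by simp)), fderiv_comp_snd hu,
    oneWedge_dsnd_smul, extDeriv_oneWedge_dsnd_pullFst hη]
  have : oneWedge (dsnd E) (oneWedge (dsnd E) (pullFst (η z.1))) = 0 := oneWedge_oneWedge _ _
  rw [this]
  rw [smul_zero, zero_add, smul_neg]
  exact (neg_smul _ _).symm

theorem differentiableAt_mul_oneWedge_dsnd_pullFst {k : ℕ} {u : ℝ → ℝ}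
    {η : E → E [⋀^Fin k]→L[ℝ] ℝ}
    {z : E × ℝ} (hu : DifferentiableAt ℝ u z.2) (hη : ContDiffAt ℝ (⊤ : ℕ∞) η z.1) :
    DifferentiableAt ℝ (fun z : E × ℝ => u z.2 • oneWedge (dsnd E) (pullFst (η z.1))) z :=
  (hu.comp z differentiableAt_snd).smul
    ((contDiffAt_oneWedge_dsnd_pullFst hη).differentiableAt (by simp))

end ExteriorDerivative

/-! ### Forms and exterior derivatives in the preferred chart. -/

section ChartLemmas

variable {E : Type*} [NormedAddCommGroup E] [NormedSpace ℝ E]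
  {H : Type*} [TopologicalSpace H] {I : ModelWithCorners ℝ E H} [I.Boundaryless]
  {M : Type*} [TopologicalSpace M] [ChartedSpace H M] [IsManifold I 1 M]
  {F : Type*} [NormedAddCommGroup F] [NormedSpace ℝ F]

theorem chartInvDeriv_base_apply (x : M) (v : E) :
    (chartInvDeriv I x (extChartAt I x x) v : E) = v := by
  have h := mfderivWithin_range_extChartAt_symm (I := I) (x := x)
  exact congrArg (fun T : E →L[ℝ] E => T v) h

theorem DForm.inChart_base_apply {k : ℕ} (ω : DForm I M F k) (x : M) (v : Fin k → E) :
    ω.inChart x (extChartAt I x x) v = ω x v := by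
  have h1 : ∀ (z : M) (_ : z = x) (v : Fin k → E), (ω z : E [⋀^Fin k]→L[ℝ] F) v = ω x v := by
    rintro z rfl v; rfl
  have h2 : (fun i => (chartInvDeriv I x (extChartAt I x x) (v i) : E)) = v :=
    funext fun i => chartInvDeriv_base_apply x (v i)
  exact (h1 _ (extChartAt_to_inv x) _).trans (congrArg (ω x) h2)

/-- The tangent space at `x` is the model space through the chart preferred at `x`, so that chart
has identity derivative at its base point and the pull-back in `extD` disappears. -/
theorem extD_apply {k : ℕ} (ω : DForm I M F k) (x : M) (v : Fin (k + 1) → E) :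
    extD ω x v = extDeriv (ω.inChart x) (extChartAt I x x) v := by
  have h : (mfderiv I 𝓘(ℝ, E) (extChartAt I x) x : E →L[ℝ] E) = ContinuousLinearMap.id ℝ E :=
    mfderiv_extChartAt_self
  have h2 : (fun i => (mfderiv I 𝓘(ℝ, E) (extChartAt I x) x : E →L[ℝ] E) (v i)) = v := by
    rw [h]; rfl
  have h3 : extDerivWithin (ω.inChart x) (Set.range I) = extDeriv (ω.inChart x) := by
    rw [I.range_eq_univ, extDerivWithin_univ]
  rw [← h3]
  exact congrArg (extDerivWithin (ω.inChart x) (Set.range I) (extChartAt I x x)) h2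

theorem DForm.IsSmooth.contDiffAt {k : ℕ} {ω : DForm I M F k} (h : ω.IsSmooth) (x : M) :
    ContDiffAt ℝ (⊤ : ℕ∞) (ω.inChart x) (extChartAt I x x) :=
  (h x).contDiffAt (extChartAt_target_mem_nhds x)

/-- A form is differentiable at `x` in the preferred chart at `x`. -/
def DForm.DiffAt {k : ℕ} (ω : DForm I M F k) (x : M) : Prop :=
  DifferentiableAt ℝ (ω.inChart x) (extChartAt I x x)

theorem extD_add {k : ℕ} {ω ω' : DForm I M F k} {x : M} (h : ω.DiffAt x) (h' : ω'.DiffAt x) :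
    extD (ω + ω') x = extD ω x + extD ω' x := by
  ext v
  refine (extD_apply (ω + ω') x v).trans ?_
  have h1 : (ω + ω').inChart x = ω.inChart x + ω'.inChart x := rfl
  rw [h1, extDeriv_add h h']
  exact (congrArg₂ (· + ·) (extD_apply ω x v) (extD_apply ω' x v)).symm

theorem DForm.DiffAt.add {k : ℕ} {ω ω' : DForm I M F k} {x : M} (h : ω.DiffAt x)
    (h' : ω'.DiffAt x) : (ω + ω').DiffAt x :=
  DifferentiableAt.add h h'

end ChartLemmas

/-! ### The preferred chart of `N × L` as a product chart. -/

section ProductChart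

variable {N : Type*} [TopologicalSpace N] [ChartedSpace E6 N] [IsManifold (𝓡 6) (⊤ : ℕ∞) N]
  {L : Type*} [TopologicalSpace L] [ChartedSpace ℝ L] [IsManifold 𝓘(ℝ, ℝ) (⊤ : ℕ∞) L]

theorem extChartAt_prod_target {p : N × L} {z : E6 × ℝ} (hz : z ∈ (extChartAt I7 p).target) :
    z.1 ∈ (extChartAt (𝓡 6) p.1).target ∧ z.2 ∈ (extChartAt 𝓘(ℝ, ℝ) p.2).target := by
  rw [extChartAt_prod] at hz
  exact hz

theorem extChartAt_prod_symm (p : N × L) (z : E6 × ℝ) :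
    (extChartAt I7 p).symm z =
      ((extChartAt (𝓡 6) p.1).symm z.1, (extChartAt 𝓘(ℝ, ℝ) p.2).symm z.2) := by
  rw [extChartAt_prod]
  rfl

theorem mdifferentiableAt_extChartAt_symm {E H M : Type*} [NormedAddCommGroup E] [NormedSpace ℝ E]
    [TopologicalSpace H] {I : ModelWithCorners ℝ E H} [I.Boundaryless]
    [TopologicalSpace M] [ChartedSpace H M] [IsManifold I 1 M] {x : M} {y : E}
    (hy : y ∈ (extChartAt I x).target) : MDifferentiableAt 𝓘(ℝ, E) I (extChartAt I x).symm y := by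
  have := mdifferentiableWithinAt_extChartAt_symm hy
  rwa [I.range_eq_univ, mdifferentiableWithinAt_univ] at this

theorem chartInvDeriv_eq_mfderiv {E H M : Type*} [NormedAddCommGroup E] [NormedSpace ℝ E]
    [TopologicalSpace H] {I : ModelWithCorners ℝ E H} [I.Boundaryless]
    [TopologicalSpace M] [ChartedSpace H M] (x : M) (y : E) :
    chartInvDeriv I x y = mfderiv 𝓘(ℝ, E) I (extChartAt I x).symm y := by
  rw [chartInvDeriv, I.range_eq_univ, mfderivWithin_univ]

/-- Used for maps that are equal only propositionally: the derivatives, compared as maps of model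
spaces, need no transport between tangent spaces. -/
theorem HasMFDerivAt.unique_of_eq {E H M E' H' M' : Type*} [NormedAddCommGroup E]
    [NormedSpace ℝ E] [TopologicalSpace H] {I : ModelWithCorners ℝ E H}
    [TopologicalSpace M] [ChartedSpace H M] [NormedAddCommGroup E']
    [NormedSpace ℝ E'] [TopologicalSpace H'] {I' : ModelWithCorners ℝ E' H'}
    [TopologicalSpace M'] [ChartedSpace H' M'] {f g : M → M'} {x : M} {D D' : E →L[ℝ] E'}
    (hf : HasMFDerivAt I I' f x D) (hg : HasMFDerivAt I I' g x D') (h : f = g) : D = D' := by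
  subst h
  exact hasMFDerivAt_unique hf hg

/-- The inverse product chart followed by the projection to `N` is the projection followed by the
inverse chart of `N`; both sides are the chain rule for this one map. -/
theorem mfderiv_fst_chartInvDeriv {p : N × L} {z : E6 × ℝ} (hz : z ∈ (extChartAt I7 p).target)
    (v : E6 × ℝ) :
    (mfderiv I7 (𝓡 6) Prod.fst ((extChartAt I7 p).symm z) (chartInvDeriv I7 p z v) : E6) =
      chartInvDeriv (𝓡 6) p.1 z.1 v.1 := by
  have hz1 := (extChartAt_prod_target hz).1
  have h1 := (mdifferentiableAt_extChartAt_symm hz).hasMFDerivAt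
  have h2 := (mdifferentiableAt_extChartAt_symm hz1).hasMFDerivAt
  have h3 := HasMFDerivAt.comp z
    (mdifferentiableAt_fst (I := 𝓡 6) (I' := 𝓘(ℝ, ℝ))
      (x := (extChartAt I7 p).symm z)).hasMFDerivAt h1
  have h4 := HasMFDerivAt.comp (I := 𝓘(ℝ, E6 × ℝ)) z h2
    (ContinuousLinearMap.fst ℝ E6 ℝ).hasMFDerivAt
  have h5 : (Prod.fst ∘ (extChartAt I7 p).symm : E6 × ℝ → N) =
      (extChartAt (𝓡 6) p.1).symm ∘ (ContinuousLinearMap.fst ℝ E6 ℝ) :=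
    funext fun w => congrArg Prod.fst (extChartAt_prod_symm p w)
  rw [chartInvDeriv_eq_mfderiv, chartInvDeriv_eq_mfderiv]
  exact congrArg (fun T : (E6 × ℝ) →L[ℝ] E6 => T v) (HasMFDerivAt.unique_of_eq h3 h4 h5)

theorem mfderiv_snd_chartInvDeriv {p : N × L} {z : E6 × ℝ} (hz : z ∈ (extChartAt I7 p).target)
    (v : E6 × ℝ) :
    (mfderiv I7 𝓘(ℝ, ℝ) Prod.snd ((extChartAt I7 p).symm z) (chartInvDeriv I7 p z v) : ℝ) =
      chartInvDeriv 𝓘(ℝ, ℝ) p.2 z.2 v.2 := by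
  have hz2 := (extChartAt_prod_target hz).2
  have h1 := (mdifferentiableAt_extChartAt_symm hz).hasMFDerivAt
  have h2 := (mdifferentiableAt_extChartAt_symm hz2).hasMFDerivAt
  have h3 := HasMFDerivAt.comp z
    (mdifferentiableAt_snd (I := 𝓡 6) (I' := 𝓘(ℝ, ℝ))
      (x := (extChartAt I7 p).symm z)).hasMFDerivAt h1
  have h4 := HasMFDerivAt.comp (I := 𝓘(ℝ, E6 × ℝ)) z h2
    (ContinuousLinearMap.snd ℝ E6 ℝ).hasMFDerivAt
  have h5 : (Prod.snd ∘ (extChartAt I7 p).symm : E6 × ℝ → L) =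
      (extChartAt 𝓘(ℝ, ℝ) p.2).symm ∘ (ContinuousLinearMap.snd ℝ E6 ℝ) :=
    funext fun w => congrArg Prod.snd (extChartAt_prod_symm p w)
  rw [chartInvDeriv_eq_mfderiv, chartInvDeriv_eq_mfderiv]
  exact congrArg (fun T : (E6 × ℝ) →L[ℝ] ℝ => T v) (HasMFDerivAt.unique_of_eq h3 h4 h5)

theorem fromN_inChart {F : Type*} [NormedAddCommGroup F] [NormedSpace ℝ F] {k : ℕ}
    (η : DForm (𝓡 6) N F k) {p : N × L} {z : E6 × ℝ} (hz : z ∈ (extChartAt I7 p).target) :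
    (fromN η : DForm I7 (N × L) F k).inChart p z =
      (η.inChart p.1 z.1).compContinuousLinearMap (ContinuousLinearMap.fst ℝ E6 ℝ) := by
  ext v
  have h1 : ∀ (y : N) (_ : y = (extChartAt (𝓡 6) p.1).symm z.1) (w : Fin k → E6),
      (η y : E6 [⋀^Fin k]→L[ℝ] F) w = η ((extChartAt (𝓡 6) p.1).symm z.1) w := by
    rintro y rfl w; rfl
  have h2 : (fun i => (mfderiv I7 (𝓡 6) Prod.fst ((extChartAt I7 p).symm z)
      (chartInvDeriv I7 p z (v i)) : E6)) = fun i => chartInvDeriv (𝓡 6) p.1 z.1 (v i).1 :=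
    funext fun i => mfderiv_fst_chartInvDeriv hz (v i)
  exact (h1 _ (congrArg Prod.fst (extChartAt_prod_symm p z)) _).trans
    (congrArg (η ((extChartAt (𝓡 6) p.1).symm z.1)) h2)

theorem fromL_inChart {F : Type*} [NormedAddCommGroup F] [NormedSpace ℝ F] {k : ℕ}
    (η : DForm 𝓘(ℝ, ℝ) L F k) {p : N × L} {z : E6 × ℝ} (hz : z ∈ (extChartAt I7 p).target) :
    (fromL η : DForm I7 (N × L) F k).inChart p z =
      (η.inChart p.2 z.2).compContinuousLinearMap (ContinuousLinearMap.snd ℝ E6 ℝ) := by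
  ext v
  have h1 : ∀ (y : L) (_ : y = (extChartAt 𝓘(ℝ, ℝ) p.2).symm z.2) (w : Fin k → ℝ),
      (η y : ℝ [⋀^Fin k]→L[ℝ] F) w = η ((extChartAt 𝓘(ℝ, ℝ) p.2).symm z.2) w := by
    rintro y rfl w; rfl
  have h2 : (fun i => (mfderiv I7 𝓘(ℝ, ℝ) Prod.snd ((extChartAt I7 p).symm z)
      (chartInvDeriv I7 p z (v i)) : ℝ)) = fun i => chartInvDeriv 𝓘(ℝ, ℝ) p.2 z.2 (v i).2 :=
    funext fun i => mfderiv_snd_chartInvDeriv hz (v i)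
  exact (h1 _ (congrArg Prod.snd (extChartAt_prod_symm p z)) _).trans
    (congrArg (η ((extChartAt 𝓘(ℝ, ℝ) p.2).symm z.2)) h2)

theorem fromN_apply {F : Type*} [NormedAddCommGroup F] [NormedSpace ℝ F] {k : ℕ}
    (η : DForm (𝓡 6) N F k) (p : N × L) (v : Fin k → E6 × ℝ) :
    (fromN η : DForm I7 (N × L) F k) p v = η p.1 (fun i => (v i).1) := by
  have h : (mfderiv I7 (𝓡 6) Prod.fst p : (E6 × ℝ) →L[ℝ] E6) = ContinuousLinearMap.fst ℝ E6 ℝ :=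
    mfderiv_fst
  have h2 : (fun i => (mfderiv I7 (𝓡 6) Prod.fst p : (E6 × ℝ) →L[ℝ] E6) (v i)) =
      fun i => (v i).1 := by rw [h]; rfl
  exact congrArg (η p.1) h2

theorem fromL_apply {F : Type*} [NormedAddCommGroup F] [NormedSpace ℝ F] {k : ℕ}
    (η : DForm 𝓘(ℝ, ℝ) L F k) (p : N × L) (v : Fin k → E6 × ℝ) :
    (fromL η : DForm I7 (N × L) F k) p v = η p.2 (fun i => (v i).2) := by
  have h : (mfderiv I7 𝓘(ℝ, ℝ) Prod.snd p : (E6 × ℝ) →L[ℝ] ℝ) = ContinuousLinearMap.snd ℝ E6 ℝ :=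
    mfderiv_snd
  have h2 : (fun i => (mfderiv I7 𝓘(ℝ, ℝ) Prod.snd p : (E6 × ℝ) →L[ℝ] ℝ) (v i)) =
      fun i => (v i).2 := by rw [h]; rfl
  exact congrArg (η p.2) h2

end ProductChart

/-! ### The derivative along the line factor in a chart. -/

section LineDerivative

variable {L : Type*} [TopologicalSpace L] [ChartedSpace ℝ L]

/-- The coefficient of a 1-form on a 1-manifold in the preferred chart at the point. -/
def lineCoeff (dr : DForm 𝓘(ℝ, ℝ) L ℝ 1) (l : L) : ℝ :=
  let drl : ℝ [⋀^Fin 1]→L[ℝ] ℝ := dr l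
  drl (fun _ => 1)

theorem oneForm_real_apply (a : ℝ [⋀^Fin 1]→L[ℝ] ℝ) (v : Fin 1 → ℝ) :
    a v = v 0 * a (fun _ => 1) := by
  have : v = fun i => v 0 • (1 : ℝ) := by
    ext i; fin_cases i; simp
  conv_lhs => rw [this]
  have h := a.map_smul_univ (fun _ => v 0) (fun _ => (1 : ℝ))
  simpa using h

theorem lineForm_apply (dr : DForm 𝓘(ℝ, ℝ) L ℝ 1) (l : L) (v : Fin 1 → ℝ) :
    dr l v = v 0 * lineCoeff dr l :=
  oneForm_real_apply (dr l) v

theorem lineCoeff_ne_zero {dr : DForm 𝓘(ℝ, ℝ) L ℝ 1} {l : L} (h : dr l ≠ 0) :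
    lineCoeff dr l ≠ 0 := by
  intro h0
  refine h (ContinuousAlternatingMap.ext fun v => ?_)
  refine (lineForm_apply dr l v).trans ?_
  rw [h0]
  exact mul_zero (M₀ := ℝ) (v 0)

theorem MDifferentiableAt.differentiableAt_inChart {f : L → ℝ} {l : L}
    (hf : MDifferentiableAt 𝓘(ℝ, ℝ) 𝓘(ℝ, ℝ) f l) :
    DifferentiableAt ℝ (f ∘ (extChartAt 𝓘(ℝ, ℝ) l).symm) (extChartAt 𝓘(ℝ, ℝ) l l) := by
  have h := hf.differentiableWithinAt_writtenInExtChartAt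
  rwa [ModelWithCorners.range_eq_univ, differentiableWithinAt_univ] at h

theorem rDeriv_eq {dr : DForm 𝓘(ℝ, ℝ) L ℝ 1} {f : L → ℝ} {l : L}
    (hf : MDifferentiableAt 𝓘(ℝ, ℝ) 𝓘(ℝ, ℝ) f l) :
    rDeriv dr f l = deriv (f ∘ (extChartAt 𝓘(ℝ, ℝ) l).symm) (extChartAt 𝓘(ℝ, ℝ) l l) /
      lineCoeff dr l := by
  have h : (mfderiv 𝓘(ℝ, ℝ) 𝓘(ℝ, ℝ) f l : ℝ →L[ℝ] ℝ) =
      fderiv ℝ (f ∘ (extChartAt 𝓘(ℝ, ℝ) l).symm) (extChartAt 𝓘(ℝ, ℝ) l l) := by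
    rw [hf.mfderiv, ModelWithCorners.range_eq_univ, fderivWithin_univ]
    rfl
  exact congrArg (fun T : ℝ →L[ℝ] ℝ => T 1 / lineCoeff dr l) h

theorem deriv_inChart_eq {dr : DForm 𝓘(ℝ, ℝ) L ℝ 1} (hdr0 : ∀ l, dr l ≠ 0) {f : L → ℝ} {l : L}
    (hf : MDifferentiableAt 𝓘(ℝ, ℝ) 𝓘(ℝ, ℝ) f l) :
    deriv (f ∘ (extChartAt 𝓘(ℝ, ℝ) l).symm) (extChartAt 𝓘(ℝ, ℝ) l l) =
      rDeriv dr f l * lineCoeff dr l := by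
  rw [rDeriv_eq hf, div_mul_cancel₀ _ (lineCoeff_ne_zero (hdr0 l))]

end LineDerivative

/-! ### Exterior derivatives of `u η` and `u dr ∧ η` on `N × L`. -/

section WarpedForms

variable {N : Type*} [TopologicalSpace N] [ChartedSpace E6 N] [IsManifold (𝓡 6) (⊤ : ℕ∞) N]
  {L : Type*} [TopologicalSpace L] [ChartedSpace ℝ L] [IsManifold 𝓘(ℝ, ℝ) (⊤ : ℕ∞) L]

theorem inChart_smul_fromN_eventuallyEq {k : ℕ} (u : L → ℝ) (η : DForm (𝓡 6) N ℝ k) (p : N × L) :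
    DForm.inChart (fun q : N × L => u q.2 • fromN η q : DForm I7 (N × L) ℝ k) p
      =ᶠ[nhds (extChartAt I7 p p)] fun z =>
        (u ∘ (extChartAt 𝓘(ℝ, ℝ) p.2).symm) z.2 • pullFst (η.inChart p.1 z.1) := by
  filter_upwards [extChartAt_target_mem_nhds (I := I7) p] with z hz
  have h1 : DForm.inChart (fun q : N × L => u q.2 • fromN η q : DForm I7 (N × L) ℝ k) p z =
      u ((extChartAt I7 p).symm z).2 • (fromN η : DForm I7 (N × L) ℝ k).inChart p z := rfl
  rw [h1, fromN_inChart η hz, extChartAt_prod_symm]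
  rfl

theorem inChart_smul_oneWedge_eventuallyEq {k : ℕ} (dr : DForm 𝓘(ℝ, ℝ) L ℝ 1) (u : L → ℝ)
    (η : DForm (𝓡 6) N ℝ k) (p : N × L) :
    DForm.inChart (fun q : N × L => u q.2 • oneWedge (fromL dr q) (fromN η q) :
        DForm I7 (N × L) ℝ (k + 1)) p
      =ᶠ[nhds (extChartAt I7 p p)] fun z =>
        ((u ∘ (extChartAt 𝓘(ℝ, ℝ) p.2).symm) z.2 * dr.inChart p.2 z.2 (fun _ => 1)) •
          oneWedge (dsnd E6) (pullFst (η.inChart p.1 z.1)) := by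
  filter_upwards [extChartAt_target_mem_nhds (I := I7) p] with z hz
  have h1 : DForm.inChart (fun q : N × L => u q.2 • oneWedge (fromL dr q) (fromN η q) :
        DForm I7 (N × L) ℝ (k + 1)) p z =
      u ((extChartAt I7 p).symm z).2 • oneWedge ((fromL dr : DForm I7 (N × L) ℝ 1).inChart p z)
        ((fromN η : DForm I7 (N × L) ℝ k).inChart p z) :=
    congrArg (u ((extChartAt I7 p).symm z).2 • ·) (oneWedge_compContinuousLinearMap _ _ _)
  have h2 : (dr.inChart p.2 z.2).compContinuousLinearMap (ContinuousLinearMap.snd ℝ E6 ℝ) =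
      dr.inChart p.2 z.2 (fun _ => 1) • dsnd E6 := by
    ext v
    refine (oneForm_real_apply (dr.inChart p.2 z.2) fun i => (v i).2).trans ?_
    rw [mul_comm]
    rfl
  rw [h1, fromN_inChart η hz, fromL_inChart dr hz, h2, oneWedge_smul_left, extChartAt_prod_symm,
    smul_smul]
  rfl

theorem oneWedge_fromL_apply {k : ℕ} (dr : DForm 𝓘(ℝ, ℝ) L ℝ 1)
    (η : DForm (𝓡 6) N ℝ k) (p : N × L) (v : Fin (k + 1) → E6 × ℝ) :
    oneWedge (fromL dr p) (fromN η p) v =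
      lineCoeff dr p.2 * oneWedge (dsnd E6)
        (pullFst (η.inChart p.1 (extChartAt (𝓡 6) p.1 p.1))) v := by
  refine (oneWedge_apply _ _ v).trans ?_
  rw [oneWedge_apply, Finset.mul_sum]
  refine Finset.sum_congr rfl fun i _ => ?_
  have h1 : (fromL dr : DForm I7 (N × L) ℝ 1) p (fun _ => v i) = (v i).2 * lineCoeff dr p.2 :=
    (fromL_apply dr p fun _ => v i).trans (lineForm_apply dr p.2 fun _ => (v i).2)
  have h2 : (fromN η : DForm I7 (N × L) ℝ k) p (fun j => v (i.succAbove j)) =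
      pullFst (η.inChart p.1 (extChartAt (𝓡 6) p.1 p.1)) (fun j => v (i.succAbove j)) :=
    (fromN_apply η p fun j => v (i.succAbove j)).trans
      (DForm.inChart_base_apply η p.1 fun j => (v (i.succAbove j)).1).symm
  have h3 : dsnd E6 (fun _ => v i) = (v i).2 := rfl
  refine (congrArg _ (congrArg₂ (· * ·) h1 h2)).trans ?_
  rw [h3]
  ring

theorem diffAt_smul_fromN {k : ℕ} {u : L → ℝ} {η : DForm (𝓡 6) N ℝ k} (hη : η.IsSmooth)
    {p : N × L} (hu : MDifferentiableAt 𝓘(ℝ, ℝ) 𝓘(ℝ, ℝ) u p.2) :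
    DForm.DiffAt (fun q : N × L => u q.2 • fromN η q : DForm I7 (N × L) ℝ k) p := by
  have h1 := hu.differentiableAt_inChart
  have h2 := (hη.contDiffAt p.1).differentiableAt (by simp)
  refine DifferentiableAt.congr_of_eventuallyEq ?_ (inChart_smul_fromN_eventuallyEq u η p)
  exact differentiableAt_mul_pullFst (z := extChartAt I7 p p) h1 h2

theorem extD_smul_fromN {k : ℕ} {dr : DForm 𝓘(ℝ, ℝ) L ℝ 1} (hdr0 : ∀ l, dr l ≠ 0) {u : L → ℝ}
    {η : DForm (𝓡 6) N ℝ k} (hη : η.IsSmooth)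
    {p : N × L} (hu : MDifferentiableAt 𝓘(ℝ, ℝ) 𝓘(ℝ, ℝ) u p.2) :
    extD (fun q : N × L => u q.2 • fromN η q : DForm I7 (N × L) ℝ k) p =
      rDeriv dr u p.2 • oneWedge (fromL dr p) (fromN η p) + u p.2 • fromN (extD η) p := by
  have h1 := hu.differentiableAt_inChart
  have h2 := (hη.contDiffAt p.1).differentiableAt (by simp)
  refine ContinuousAlternatingMap.ext fun (v : Fin (k + 1) → E6 × ℝ) => ?_
  refine (extD_apply _ p v).trans ?_
  refine (congrArg (fun T : (E6 × ℝ) [⋀^Fin (k + 1)]→L[ℝ] ℝ => T v)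
    ((inChart_smul_fromN_eventuallyEq u η p).extDeriv_eq.trans
      (extDeriv_mul_pullFst (z := extChartAt I7 p p) h1 h2))).trans ?_
  have h3 : (u ∘ (extChartAt 𝓘(ℝ, ℝ) p.2).symm) (extChartAt 𝓘(ℝ, ℝ) p.2 p.2) = u p.2 :=
    congrArg u (extChartAt_to_inv p.2)
  have h4 : (fromN (extD η) : DForm I7 (N × L) ℝ (k + 1)) p v =
      pullFst (extDeriv (η.inChart p.1) (extChartAt (𝓡 6) p.1 p.1)) v :=
    (fromN_apply (extD η) p v).trans (extD_apply η p.1 fun i => (v i).1)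
  change deriv (u ∘ (extChartAt 𝓘(ℝ, ℝ) p.2).symm) (extChartAt 𝓘(ℝ, ℝ) p.2 p.2) *
      oneWedge (dsnd E6) (pullFst (η.inChart p.1 (extChartAt (𝓡 6) p.1 p.1))) v +
      (u ∘ (extChartAt 𝓘(ℝ, ℝ) p.2).symm) (extChartAt 𝓘(ℝ, ℝ) p.2 p.2) *
        pullFst (extDeriv (η.inChart p.1) (extChartAt (𝓡 6) p.1 p.1)) v =
    rDeriv dr u p.2 * oneWedge (fromL dr p) (fromN η p) v + u p.2 * fromN (extD η) p v
  rw [deriv_inChart_eq hdr0 hu, h3, h4, oneWedge_fromL_apply, mul_assoc]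

theorem differentiableAt_lineCoeff_inChart {dr : DForm 𝓘(ℝ, ℝ) L ℝ 1} (hdr : dr.IsSmooth)
    (l : L) : DifferentiableAt ℝ (fun r => dr.inChart l r (fun _ => 1))
      (extChartAt 𝓘(ℝ, ℝ) l l) :=
  ((hdr.contDiffAt l).differentiableAt (by simp)).continuousAlternatingMap_apply_const _

theorem diffAt_smul_oneWedge {k : ℕ} {dr : DForm 𝓘(ℝ, ℝ) L ℝ 1} (hdr : dr.IsSmooth) {u : L → ℝ}
    {η : DForm (𝓡 6) N ℝ k} (hη : η.IsSmooth)
    {p : N × L} (hu : MDifferentiableAt 𝓘(ℝ, ℝ) 𝓘(ℝ, ℝ) u p.2) :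
    DForm.DiffAt (fun q : N × L => u q.2 • oneWedge (fromL dr q) (fromN η q) :
        DForm I7 (N × L) ℝ (k + 1)) p := by
  have h1 := hu.differentiableAt_inChart.mul (differentiableAt_lineCoeff_inChart hdr p.2)
  refine DifferentiableAt.congr_of_eventuallyEq ?_ (inChart_smul_oneWedge_eventuallyEq dr u η p)
  exact differentiableAt_mul_oneWedge_dsnd_pullFst (z := extChartAt I7 p p) h1 (hη.contDiffAt p.1)

/-- Both `u` and the coefficient of `dr` in the chart depend on `r` alone, so their differentials
are multiples of `dr` and are killed by the factor `dr`. -/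
theorem extD_smul_oneWedge {k : ℕ} {dr : DForm 𝓘(ℝ, ℝ) L ℝ 1} (hdr : dr.IsSmooth) {u : L → ℝ}
    {η : DForm (𝓡 6) N ℝ k} (hη : η.IsSmooth)
    {p : N × L} (hu : MDifferentiableAt 𝓘(ℝ, ℝ) 𝓘(ℝ, ℝ) u p.2) :
    extD (fun q : N × L => u q.2 • oneWedge (fromL dr q) (fromN η q) :
        DForm I7 (N × L) ℝ (k + 1)) p =
      (-u p.2) • oneWedge (fromL dr p) (fromN (extD η) p) := by
  have h1 := hu.differentiableAt_inChart.mul (differentiableAt_lineCoeff_inChart hdr p.2)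
  refine ContinuousAlternatingMap.ext fun (v : Fin (k + 1 + 1) → E6 × ℝ) => ?_
  refine (extD_apply _ p v).trans ?_
  refine (congrArg (fun T : (E6 × ℝ) [⋀^Fin (k + 1 + 1)]→L[ℝ] ℝ => T v)
    ((inChart_smul_oneWedge_eventuallyEq dr u η p).extDeriv_eq.trans
      (extDeriv_mul_oneWedge_dsnd_pullFst (z := extChartAt I7 p p) h1
        (hη.contDiffAt p.1)))).trans ?_
  have h3 : (u ∘ (extChartAt 𝓘(ℝ, ℝ) p.2).symm) (extChartAt 𝓘(ℝ, ℝ) p.2 p.2) = u p.2 :=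
    congrArg u (extChartAt_to_inv p.2)
  have h4 : dr.inChart p.2 (extChartAt 𝓘(ℝ, ℝ) p.2 p.2) (fun _ => 1) = lineCoeff dr p.2 :=
    DForm.inChart_base_apply dr p.2 _
  have h5 : (extD η).inChart p.1 (extChartAt (𝓡 6) p.1 p.1) =
      extDeriv (η.inChart p.1) (extChartAt (𝓡 6) p.1 p.1) := by
    ext w
    exact (DForm.inChart_base_apply (extD η) p.1 w).trans (extD_apply η p.1 w)
  change -((u ∘ (extChartAt 𝓘(ℝ, ℝ) p.2).symm) (extChartAt 𝓘(ℝ, ℝ) p.2 p.2) *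
      dr.inChart p.2 (extChartAt 𝓘(ℝ, ℝ) p.2 p.2) (fun _ => 1)) *
      oneWedge (dsnd E6) (pullFst (extDeriv (η.inChart p.1) (extChartAt (𝓡 6) p.1 p.1))) v =
    (-u p.2) * oneWedge (fromL dr p) (fromN (extD η) p) v
  rw [h3, h4, oneWedge_fromL_apply, h5]
  ring

end WarpedForms

/-! ### The trace of the full torsion tensor as a contraction of `dφ` with `ψ`. -/

section Torsion

/-- Contracting against an alternating map antisymmetrizes the other factor. -/
theorem sum_gramInv_comp_perm {V ι : Type*} [AddCommGroup V] [Module ℝ V] [TopologicalSpace V]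
    [Fintype ι] (gi : Matrix ι ι ℝ) (b : ι → V) {n : ℕ} (ψ : V [⋀^Fin n]→L[ℝ] ℝ)
    (X : (Fin n → ι) → ℝ) (σ : Equiv.Perm (Fin n)) :
    ∑ I : Fin n → ι, ∑ J : Fin n → ι, (∏ a, gi (I a) (J a)) * X (I ∘ σ) * ψ (fun a => b (J a)) =
      (Equiv.Perm.sign σ : ℤ) * ∑ I : Fin n → ι, ∑ J : Fin n → ι,
        (∏ a, gi (I a) (J a)) * X I * ψ (fun a => b (J a)) := by
  rw [← (σ.arrowCongr (Equiv.refl ι)).sum_comp, Finset.mul_sum]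
  refine Finset.sum_congr rfl fun I _ => ?_
  rw [← (σ.arrowCongr (Equiv.refl ι)).sum_comp, Finset.mul_sum]
  refine Finset.sum_congr rfl fun J _ => ?_
  have h1 : ∀ I : Fin n → ι, (σ.arrowCongr (Equiv.refl ι)) I = I ∘ σ.symm := fun I => rfl
  have h2 : ψ (fun a => b ((J ∘ σ.symm) a)) =
      ((Equiv.Perm.sign σ : ℤ) : ℝ) * ψ (fun a => b (J a)) := by
    have := ψ.toAlternatingMap.map_perm (fun a => b (J a)) σ.symm
    rw [Equiv.Perm.sign_symm, Units.smul_def, zsmul_eq_mul] at this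
    exact this
  have h3 : ∏ a, gi ((I ∘ σ.symm) a) ((J ∘ σ.symm) a) = ∏ a, gi (I a) (J a) :=
    Equiv.prod_comp σ.symm fun a => gi (I a) (J a)
  rw [h1, h1, h2, h3, Function.comp_assoc]
  simp
  ring

theorem christoffel_symm {E : Type*} [NormedAddCommGroup E] [NormedSpace ℝ E]
    [FiniteDimensional ℝ E] (s : Set E) {g : E → E → E → ℝ} (hg : ∀ z u v, g z u v = g z v u)
    (y u v : E) : christoffel s g y u v = christoffel s g y v u := by
  simp only [christoffel, christoffelFirst]
  refine Finset.sum_congr rfl fun i _ => Finset.sum_congr rfl fun j _ => ?_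
  rw [add_comm (fderivWithin ℝ _ s y u), show (fun z => g z u v) = fun z => g z v u from
    funext fun z => hg z u v]

theorem sum_fin_succ_fun {A ι : Type*} [AddCommMonoid A] [Fintype ι] {k : ℕ}
    (F : (Fin (k + 1) → ι) → A) :
    ∑ I, F I = ∑ i, ∑ I, F (Matrix.vecCons i I) := by
  rw [← Fintype.sum_prod_type', ← (Fin.consEquiv fun _ : Fin (k + 1) => ι).sum_comp]
  rfl


/-- The full contraction of `X` and `ψ` in the basis `b` with coefficients `gi`. -/
def contractWith {V ι : Type*} [AddCommGroup V] [Module ℝ V] [TopologicalSpace V]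
    [Fintype ι] (gi : Matrix ι ι ℝ) (b : ι → V) {n : ℕ} (ψ : V [⋀^Fin n]→L[ℝ] ℝ)
    (X : (Fin n → ι) → ℝ) : ℝ :=
  ∑ I : Fin n → ι, ∑ J : Fin n → ι, (∏ a, gi (I a) (J a)) * X I * ψ (fun a => b (J a))

section ContractWith

variable {V ι : Type*} [AddCommGroup V] [Module ℝ V] [TopologicalSpace V]
  [Fintype ι] (gi : Matrix ι ι ℝ) (b : ι → V) {n : ℕ} (ψ : V [⋀^Fin n]→L[ℝ] ℝ)

theorem contractWith_comp_perm (X : (Fin n → ι) → ℝ) (σ : Equiv.Perm (Fin n)) :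
    contractWith gi b ψ (fun I => X (I ∘ σ)) =
      (Equiv.Perm.sign σ : ℤ) * contractWith gi b ψ X :=
  sum_gramInv_comp_perm gi b ψ X σ

theorem contractWith_sub (X Y : (Fin n → ι) → ℝ) :
    contractWith gi b ψ (fun I => X I - Y I) = contractWith gi b ψ X - contractWith gi b ψ Y := by
  simp only [contractWith, mul_sub, sub_mul, Finset.sum_sub_distrib]

theorem contractWith_mul (c : ℝ) (X : (Fin n → ι) → ℝ) :
    contractWith gi b ψ (fun I => c * X I) = c * contractWith gi b ψ X := by
  simp only [contractWith, Finset.mul_sum]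
  refine Finset.sum_congr rfl fun I _ => Finset.sum_congr rfl fun J _ => ?_
  ring

theorem contractWith_sum {m : ℕ} (X : Fin m → (Fin n → ι) → ℝ) :
    contractWith gi b ψ (fun I => ∑ i, X i I) = ∑ i, contractWith gi b ψ (X i) := by
  simp only [contractWith, Finset.mul_sum, Finset.sum_mul]
  rw [Finset.sum_comm (s := (Finset.univ : Finset (Fin m)))]
  exact Finset.sum_congr rfl fun I _ => Finset.sum_comm

/-- An array symmetric in two indices has zero contraction with an alternating form. -/
theorem contractWith_eq_zero_of_swap {X : (Fin n → ι) → ℝ} {i j : Fin n} (hij : i ≠ j)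
    (h : ∀ I : Fin n → ι, X (I ∘ Equiv.swap i j) = X I) : contractWith gi b ψ X = 0 := by
  have := contractWith_comp_perm gi b ψ X (Equiv.swap i j)
  rw [funext h, Equiv.Perm.sign_swap hij] at this
  have h2 : contractWith gi b ψ X = -contractWith gi b ψ X := by simpa using this
  linarith

end ContractWith

section TraceTorsion

variable {E : Type*} [NormedAddCommGroup E] [NormedSpace ℝ E]

/-- The `n + 1` terms of the alternatization differ by cycles, whose signs cancel against those
produced by `ψ`; they all contribute the same amount. -/
theorem contractWith_extDeriv {ι : Type*} [Fintype ι] (gi : Matrix ι ι ℝ) (b : ι → E) {n : ℕ}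
    (φ : E → E [⋀^Fin n]→L[ℝ] ℝ) (ψ : E [⋀^Fin (n + 1)]→L[ℝ] ℝ) (y : E) :
    contractWith gi b ψ (fun I => extDeriv φ y (fun a => b (I a))) =
      (n + 1) * contractWith gi b ψ
        (fun I => fderiv ℝ φ y (b (I 0)) (fun a => b (I (Fin.succ a)))) := by
  have h : ∀ I : Fin (n + 1) → ι, extDeriv φ y (fun a => b (I a)) =
      ∑ i : Fin (n + 1), (-1 : ℝ) ^ (i : ℕ) *
        (fun I : Fin (n + 1) → ι => fderiv ℝ φ y (b (I 0)) (fun a => b (I (Fin.succ a))))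
          (I ∘ (Fin.cycleRange i).symm) := by
    intro I
    rw [extDeriv, ContinuousAlternatingMap.alternatizeUncurryFin_apply]
    refine Finset.sum_congr rfl fun i _ => ?_
    simp only [Function.comp_apply, Fin.cycleRange_symm_zero, Fin.cycleRange_symm_succ]
    rw [zsmul_eq_mul]
    push_cast
    rfl
  rw [funext h, contractWith_sum]
  have : ∀ i : Fin (n + 1), contractWith gi b ψ (fun I => (-1 : ℝ) ^ (i : ℕ) *
        (fun I : Fin (n + 1) → ι => fderiv ℝ φ y (b (I 0)) (fun a => b (I (Fin.succ a))))
          (I ∘ (Fin.cycleRange i).symm)) = contractWith gi b ψ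
        (fun I => fderiv ℝ φ y (b (I 0)) (fun a => b (I (Fin.succ a)))) := by
    intro i
    rw [contractWith_mul, contractWith_comp_perm gi b ψ (fun I : Fin (n + 1) → ι =>
      fderiv ℝ φ y (b (I 0)) (fun a => b (I (Fin.succ a)))), Equiv.Perm.sign_symm, Fin.sign_cycleRange,
      ← mul_assoc]
    push_cast
    rw [← mul_pow]
    simp
  rw [Finset.sum_congr rfl fun i _ => this i]
  simp

/-- The Christoffel term is symmetric in the direction of differentiation and the slot `c`, because
the Levi-Civita connection is torsion-free. -/
theorem contractWith_christoffel [FiniteDimensional ℝ E] {ι : Type*} [Fintype ι]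
    (gi : Matrix ι ι ℝ) (b : ι → E) (s : Set E) {g : E → E → E → ℝ}
    (hg : ∀ z u v, g z u v = g z v u) {n : ℕ} (φ : E [⋀^Fin n]→L[ℝ] ℝ)
    (ψ : E [⋀^Fin (n + 1)]→L[ℝ] ℝ) (y : E) (c : Fin n) :
    contractWith gi b ψ (fun I => φ (Function.update (fun a => b (I (Fin.succ a))) c
      (christoffel s g y (b (I 0)) (b (I c.succ))))) = 0 := by
  refine contractWith_eq_zero_of_swap gi b ψ (Fin.succ_ne_zero c).symm fun I => ?_
  congr 1
  funext a
  by_cases ha : a = c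
  · subst ha
    simp [christoffel_symm s hg y (b (I a.succ))]
  · simp [Function.update_of_ne ha, Equiv.swap_apply_of_ne_of_ne (Fin.succ_ne_zero a)
      (fun h => ha (Fin.succ_injective _ h))]

theorem sum_torsionInCoords [FiniteDimensional ℝ E] (s : Set E) (g : E → E → E → ℝ)
    (φ : E → E [⋀^Fin 3]→L[ℝ] ℝ) (ψ : E → E [⋀^Fin 4]→L[ℝ] ℝ) (y : E) :
    ∑ i, ∑ j, gramInv (g y) (Module.finBasis ℝ E) i j *
      torsionInCoords s g φ ψ y (Module.finBasis ℝ E i) (Module.finBasis ℝ E j) =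
    (1 / 24) * contractWith (gramInv (g y) (Module.finBasis ℝ E)) (Module.finBasis ℝ E) (ψ y)
      (fun I => covDeriv s g φ y (Module.finBasis ℝ E (I 0))
        (fun a => Module.finBasis ℝ E (I (Fin.succ a)))) := by
  unfold contractWith
  rw [sum_fin_succ_fun, Finset.mul_sum]
  refine Finset.sum_congr rfl fun i _ => ?_
  simp_rw [sum_fin_succ_fun (k := 3)]
  rw [Finset.sum_comm, Finset.mul_sum]
  refine Finset.sum_congr rfl fun j _ => ?_
  rw [torsionInCoords, mul_left_comm, Finset.mul_sum]
  congr 1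
  refine Finset.sum_congr rfl fun I _ => ?_
  rw [Finset.mul_sum]
  refine Finset.sum_congr rfl fun J _ => ?_
  have h1 : ∏ a : Fin 4, gramInv (g y) (Module.finBasis ℝ E) (Matrix.vecCons i I a)
      (Matrix.vecCons j J a) = gramInv (g y) (Module.finBasis ℝ E) i j *
        ∏ a, gramInv (g y) (Module.finBasis ℝ E) (I a) (J a) := Fin.prod_univ_succ _
  have h2 : (fun a : Fin 4 => Module.finBasis ℝ E (Matrix.vecCons j J a)) =
      Matrix.vecCons (Module.finBasis ℝ E j) fun a => Module.finBasis ℝ E (J a) :=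
    funext fun a => Fin.cases rfl (fun a => rfl) a
  rw [h1, h2, ← mul_assoc, ← mul_assoc]
  rfl

/-- The factor `1/96` is `1/24 · 1/4`: contraction against `ψ` sees only a quarter of `dφ` in `∇φ`,
the Christoffel terms having dropped out. The contraction is finally moved to an orthonormal basis.
-/
theorem torsion_trace_eq [FiniteDimensional ℝ E] {g : E → E → E → ℝ}
    (hg : ∀ z u v, g z u v = g z v u)
    {φ : E → E [⋀^Fin 3]→L[ℝ] ℝ} {ψ : E → E [⋀^Fin 4]→L[ℝ] ℝ} {y : E}
    (hφ : DifferentiableAt ℝ φ y) (B : E →ₗ[ℝ] E →ₗ[ℝ] ℝ) (hB : ∀ u v, g y u v = B u v)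
    {κ : Type*} [Fintype κ] [DecidableEq κ] (f : Module.Basis κ ℝ E)
    (hf : ∀ m m', g y (f m) (f m') = if m = m' then 1 else 0) :
    ∑ i, ∑ j, gramInv (g y) (Module.finBasis ℝ E) i j *
      torsionInCoords Set.univ g φ ψ y (Module.finBasis ℝ E i) (Module.finBasis ℝ E j) =
    (1 / 96) * ∑ m : Fin 4 → κ, extDeriv φ y (fun a => f (m a)) * ψ y (fun a => f (m a)) := by
  rw [sum_torsionInCoords]
  have hcov : ∀ I : Fin 4 → Fin (Module.finrank ℝ E),
      covDeriv Set.univ g φ y (Module.finBasis ℝ E (I 0))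
        (fun a => Module.finBasis ℝ E (I (Fin.succ a))) =
      fderiv ℝ φ y (Module.finBasis ℝ E (I 0)) (fun a => Module.finBasis ℝ E (I (Fin.succ a))) -
      ∑ c : Fin 3, φ y (Function.update (fun a => Module.finBasis ℝ E (I (Fin.succ a))) c
        (christoffel Set.univ g y (Module.finBasis ℝ E (I 0)) (Module.finBasis ℝ E (I c.succ)))) := by
    intro I
    rw [covDeriv, fderivWithin_univ,
      fderiv_continuousAlternatingMap_apply_const_apply hφ]
  rw [funext hcov, contractWith_sub, contractWith_sum]
  simp only [contractWith_christoffel _ _ _ hg]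
  have h1 := contractWith_extDeriv (gramInv (g y) (Module.finBasis ℝ E)) (Module.finBasis ℝ E)
    φ (ψ y) y
  have hR := sum_gramInv_mul (g y) B hB (Module.finBasis ℝ E) f hf
    (extDeriv φ y).toMultilinearMap (ψ y).toMultilinearMap
  have hR' : contractWith (gramInv (g y) (Module.finBasis ℝ E)) (Module.finBasis ℝ E) (ψ y)
      (fun I => extDeriv φ y (fun a => Module.finBasis ℝ E (I a))) =
    ∑ m : Fin 4 → κ, extDeriv φ y (fun a => f (m a)) * ψ y (fun a => f (m a)) := hR
  rw [← hR', h1]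
  push_cast
  simp only [Finset.sum_const_zero, sub_zero]
  ring

theorem traceTorsion_eq [FiniteDimensional ℝ E] {H : Type*} [TopologicalSpace H]
    {I : ModelWithCorners ℝ E H} [I.Boundaryless]
    {M : Type*} [TopologicalSpace M] [ChartedSpace H M] [IsManifold I 1 M]
    {g : BilinField I M} (hg : ∀ x u v, g x u v = g x v u)
    {φ : DForm I M ℝ 3} {ψ : DForm I M ℝ 4} {x : M} (hφ : φ.DiffAt x)
    (B : E →ₗ[ℝ] E →ₗ[ℝ] ℝ) (hB : ∀ u v, g x u v = B u v)
    {κ : Type*} [Fintype κ] [DecidableEq κ] (f : Module.Basis κ ℝ E)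
    (hf : ∀ m m', g x (f m) (f m') = if m = m' then 1 else 0) :
    traceTorsion g φ ψ x =
      (1 / 96) * ∑ m : Fin 4 → κ, extD φ x (fun a => f (m a)) * ψ x (fun a => f (m a)) := by
  have hbase : ∀ u v, g.inChart x (extChartAt I x x) u v = g x u v := by
    intro u v
    have h1 : ∀ (z : M) (_ : z = x) (u v : E), g z u v = g x u v := by
      rintro z rfl u v; rfl
    exact (h1 _ (extChartAt_to_inv x) _ _).trans
      (congrArg₂ (g x) (chartInvDeriv_base_apply x u) (chartInvDeriv_base_apply x v))
  have h := torsion_trace_eq (g := g.inChart x) (fun z u v => hg _ _ _) (ψ := ψ.inChart x) hφ B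
    (fun u v => (hbase u v).trans (hB u v)) f (fun m m' => (hbase _ _).trans (hf m m'))
  unfold traceTorsion
  rw [I.range_eq_univ]
  refine h.trans ?_
  congr 1
  refine Finset.sum_congr rfl fun m _ => ?_
  exact congrArg₂ (· * ·) (extD_apply φ x _).symm (DForm.inChart_base_apply ψ x _)

end TraceTorsion

end Torsion

/-! ### Calculus of `∂/∂r` on the line factor. -/

section LineCalculus

variable {L : Type*} [TopologicalSpace L] [ChartedSpace ℝ L]

/-- `f` is differentiable at `l` and `df = a dr` there. -/
def HasRDerivAt (dr : DForm 𝓘(ℝ, ℝ) L ℝ 1) (f : L → ℝ) (a : ℝ) (l : L) : Prop :=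
  ContinuousAt f l ∧ HasDerivAt (f ∘ (extChartAt 𝓘(ℝ, ℝ) l).symm) (a * lineCoeff dr l)
    (extChartAt 𝓘(ℝ, ℝ) l l)

namespace HasRDerivAt

variable {dr : DForm 𝓘(ℝ, ℝ) L ℝ 1} {f g : L → ℝ} {a b : ℝ} {l : L}

theorem mdifferentiableAt (h : HasRDerivAt dr f a l) :
    MDifferentiableAt 𝓘(ℝ, ℝ) 𝓘(ℝ, ℝ) f l := by
  rw [mdifferentiableAt_iff, ModelWithCorners.range_eq_univ, differentiableWithinAt_univ]
  exact ⟨h.1, h.2.differentiableAt⟩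

theorem rDeriv_eq (h : HasRDerivAt dr f a l) (h0 : dr l ≠ 0) : rDeriv dr f l = a := by
  rw [_root_.rDeriv_eq h.mdifferentiableAt, h.2.deriv, mul_div_cancel_right₀ _ (lineCoeff_ne_zero h0)]

theorem const (c : ℝ) : HasRDerivAt dr (fun _ => c) 0 l :=
  ⟨continuousAt_const, by rw [zero_mul]; exact hasDerivAt_const _ c⟩

theorem base_eq (f : L → ℝ) (l : L) :
    (f ∘ (extChartAt 𝓘(ℝ, ℝ) l).symm) (extChartAt 𝓘(ℝ, ℝ) l l) = f l :=
  congrArg f (extChartAt_to_inv l)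

theorem sub (hf : HasRDerivAt dr f a l) (hg : HasRDerivAt dr g b l) :
    HasRDerivAt dr (fun x => f x - g x) (a - b) l :=
  ⟨hf.1.sub hg.1, by rw [sub_mul]; exact hf.2.sub hg.2⟩

theorem neg (hf : HasRDerivAt dr f a l) : HasRDerivAt dr (fun x => -f x) (-a) l :=
  ⟨hf.1.neg, by rw [neg_mul]; exact hf.2.neg⟩

theorem mul (hf : HasRDerivAt dr f a l) (hg : HasRDerivAt dr g b l) :
    HasRDerivAt dr (fun x => f x * g x) (a * g l + f l * b) l := by
  refine ⟨hf.1.mul hg.1, ?_⟩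
  have h := hf.2.mul hg.2
  rw [base_eq, base_eq] at h
  rwa [show (a * g l + f l * b) * lineCoeff dr l =
    a * lineCoeff dr l * g l + f l * (b * lineCoeff dr l) by ring]

theorem const_mul (c : ℝ) (hf : HasRDerivAt dr f a l) :
    HasRDerivAt dr (fun x => c * f x) (c * a) l := by
  simpa using (const c).mul hf

theorem comp {p : ℝ → ℝ} {p' : ℝ} (hp : HasDerivAt p p' (f l)) (hf : HasRDerivAt dr f a l) :
    HasRDerivAt dr (fun x => p (f x)) (p' * a) l := by
  refine ⟨hp.continuousAt.comp hf.1, ?_⟩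
  rw [← base_eq f l] at hp
  have h := hp.comp _ hf.2
  rw [← mul_assoc] at h
  exact h

theorem pow (n : ℕ) (hf : HasRDerivAt dr f a l) :
    HasRDerivAt dr (fun x => f x ^ n) (n * f l ^ (n - 1) * a) l :=
  comp (hasDerivAt_pow n (f l)) hf

theorem inv (hf : HasRDerivAt dr f a l) (h0 : f l ≠ 0) :
    HasRDerivAt dr (fun x => (f x)⁻¹) (-(f l ^ 2)⁻¹ * a) l :=
  comp (hasDerivAt_inv h0) hf

theorem cos (hf : HasRDerivAt dr f a l) :
    HasRDerivAt dr (fun x => Real.cos (f x)) (-Real.sin (f l) * a) l :=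
  comp (Real.hasDerivAt_cos (f l)) hf

theorem sin (hf : HasRDerivAt dr f a l) :
    HasRDerivAt dr (fun x => Real.sin (f x)) (Real.cos (f l) * a) l :=
  comp (Real.hasDerivAt_sin (f l)) hf

end HasRDerivAt

theorem MDifferentiableAt.hasRDerivAt {dr : DForm 𝓘(ℝ, ℝ) L ℝ 1} (hdr0 : ∀ l, dr l ≠ 0)
    {f : L → ℝ} {l : L} (hf : MDifferentiableAt 𝓘(ℝ, ℝ) 𝓘(ℝ, ℝ) f l) :
    HasRDerivAt dr f (rDeriv dr f l) l :=
  ⟨hf.continuousAt, by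
    rw [← deriv_inChart_eq hdr0 hf]; exact hf.differentiableAt_inChart.hasDerivAt⟩

variable [IsManifold 𝓘(ℝ, ℝ) (⊤ : ℕ∞) L]

theorem chartInvDeriv_one_ne_zero {l₀ : L} {y : ℝ} (hy : y ∈ (extChartAt 𝓘(ℝ, ℝ) l₀).target) :
    (chartInvDeriv 𝓘(ℝ, ℝ) l₀ y 1 : ℝ) ≠ 0 := by
  intro h
  have : IsManifold 𝓘(ℝ, ℝ) 1 L := IsManifold.of_le (n := ((⊤ : ℕ∞) : WithTop ℕ∞)) (by norm_cast)
  obtain ⟨T, hT⟩ := isInvertible_mfderivWithin_extChartAt_symm (I := 𝓘(ℝ, ℝ)) hy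
  have h1 : T (1 : ℝ) = chartInvDeriv 𝓘(ℝ, ℝ) l₀ y 1 := congrArg (fun A => A (1 : ℝ)) hT
  exact one_ne_zero (α := ℝ) (T.injective ((h1.trans h).trans (T.map_zero).symm))

/-- `rDeriv` is defined at each point through that point's own chart. Passing to the fixed chart at
`l₀` multiplies `df` and `dr` by the same nonzero factor `c`, so their quotient is unchanged. -/
theorem rDeriv_extChartAt_symm (dr : DForm 𝓘(ℝ, ℝ) L ℝ 1) {f : L → ℝ}
    (hf : MDifferentiable 𝓘(ℝ, ℝ) 𝓘(ℝ, ℝ) f) {l₀ : L} {y : ℝ}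
    (hy : y ∈ (extChartAt 𝓘(ℝ, ℝ) l₀).target) :
    rDeriv dr f ((extChartAt 𝓘(ℝ, ℝ) l₀).symm y) =
      deriv (f ∘ (extChartAt 𝓘(ℝ, ℝ) l₀).symm) y / dr.inChart l₀ y (fun _ => 1) := by
  have : IsManifold 𝓘(ℝ, ℝ) 1 L := IsManifold.of_le (n := ((⊤ : ℕ∞) : WithTop ℕ∞)) (by norm_cast)
  have h1 := (mdifferentiableAt_extChartAt_symm (I := 𝓘(ℝ, ℝ)) hy).hasMFDerivAt
  set c : ℝ := chartInvDeriv 𝓘(ℝ, ℝ) l₀ y 1 with hc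
  have hc0 : c ≠ 0 := chartInvDeriv_one_ne_zero hy
  set l := (extChartAt 𝓘(ℝ, ℝ) l₀).symm y
  let df : ℝ →L[ℝ] ℝ := mfderiv 𝓘(ℝ, ℝ) 𝓘(ℝ, ℝ) f l
  have h3 : dr.inChart l₀ y (fun _ => 1) = c * lineCoeff dr l := lineForm_apply dr l fun _ => c
  have h4 : (mfderiv 𝓘(ℝ, ℝ) 𝓘(ℝ, ℝ) (extChartAt 𝓘(ℝ, ℝ) l₀).symm y (1 : ℝ) : ℝ) = c := by
    exact congrArg (fun A : ℝ →L[ℝ] ℝ => A 1) (chartInvDeriv_eq_mfderiv (I := 𝓘(ℝ, ℝ)) l₀ y).symm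
  have h5 : df c = c * df 1 := by
    have := df.map_smul c 1
    simpa using this
  rw [h3]
  have h6 : (((mfderiv 𝓘(ℝ, ℝ) 𝓘(ℝ, ℝ) f l).comp
      (mfderiv 𝓘(ℝ, ℝ) 𝓘(ℝ, ℝ) (extChartAt 𝓘(ℝ, ℝ) l₀).symm y) : ℝ →L[ℝ] ℝ)) (1 : ℝ) = c * df 1 :=
    (congrArg df h4).trans h5
  have h7 : HasFDerivAt (f ∘ (extChartAt 𝓘(ℝ, ℝ) l₀).symm) (_ : ℝ →L[ℝ] ℝ) y :=
    (HasMFDerivAt.comp y (hf _).hasMFDerivAt h1).hasFDerivAt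
  have h8 : deriv (f ∘ (extChartAt 𝓘(ℝ, ℝ) l₀).symm) y = c * df 1 := h7.hasDerivAt.deriv.trans h6
  rw [h8]
  rw [mul_div_mul_left _ _ hc0]
  rfl

theorem inChart_one_ne_zero {dr : DForm 𝓘(ℝ, ℝ) L ℝ 1} (hdr0 : ∀ l, dr l ≠ 0) {l₀ : L} {y : ℝ}
    (hy : y ∈ (extChartAt 𝓘(ℝ, ℝ) l₀).target) : dr.inChart l₀ y (fun _ => 1) ≠ 0 := by
  have h3 : dr.inChart l₀ y (fun _ => 1) = (show ℝ from chartInvDeriv 𝓘(ℝ, ℝ) l₀ y 1) *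
      lineCoeff dr ((extChartAt 𝓘(ℝ, ℝ) l₀).symm y) :=
    lineForm_apply dr _ fun _ => (chartInvDeriv 𝓘(ℝ, ℝ) l₀ y 1 : ℝ)
  rw [h3]
  exact mul_ne_zero (chartInvDeriv_one_ne_zero hy) (lineCoeff_ne_zero (hdr0 _))

theorem contDiffAt_continuousAlternatingMap_apply {E V : Type*} [NormedAddCommGroup E]
    [NormedSpace ℝ E] [NormedAddCommGroup V] [NormedSpace ℝ V] {k : ℕ} {n : WithTop ℕ∞}
    {w : E → V [⋀^Fin k]→L[ℝ] ℝ} {x : E} (hw : ContDiffAt ℝ n w x) (v : Fin k → V) :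
    ContDiffAt ℝ n (fun y => w y v) x :=
  (ContinuousAlternatingMap.apply ℝ V ℝ v).contDiff.contDiffAt.comp x hw

/-- In one fixed chart `f'` is a quotient of smooth functions on the whole chart target, with
denominator nonzero at the base point. -/
theorem contMDiff_rDeriv {dr : DForm 𝓘(ℝ, ℝ) L ℝ 1} (hdr : dr.IsSmooth) (hdr0 : ∀ l, dr l ≠ 0)
    {f : L → ℝ} (hf : ContMDiff 𝓘(ℝ, ℝ) 𝓘(ℝ, ℝ) (⊤ : ℕ∞) f) :
    ContMDiff 𝓘(ℝ, ℝ) 𝓘(ℝ, ℝ) (⊤ : ℕ∞) (rDeriv dr f) := by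
  intro l₀
  have h1 := hf l₀
  rw [contMDiffAt_iff_source, ModelWithCorners.range_eq_univ, contMDiffWithinAt_univ,
    contMDiffAt_iff_contDiffAt] at h1 ⊢
  have hev : rDeriv dr f ∘ (extChartAt 𝓘(ℝ, ℝ) l₀).symm =ᶠ[nhds (extChartAt 𝓘(ℝ, ℝ) l₀ l₀)]
      fun y => deriv (f ∘ (extChartAt 𝓘(ℝ, ℝ) l₀).symm) y / dr.inChart l₀ y (fun _ => 1) := by
    filter_upwards [extChartAt_target_mem_nhds (I := 𝓘(ℝ, ℝ)) l₀] with y hy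
    exact rDeriv_extChartAt_symm dr (hf.mdifferentiable (by simp)) hy
  refine ContDiffAt.congr_of_eventuallyEq ?_ hev
  refine ContDiffAt.div ?_ ?_ (inChart_one_ne_zero hdr0 (mem_extChartAt_target l₀))
  · have := h1.fderiv_right (m := (⊤ : ℕ∞)) (by simp)
    exact this.clm_apply contDiffAt_const
  · exact contDiffAt_continuousAlternatingMap_apply (hdr.contDiffAt l₀) _

theorem contMDiff_slice {S : Set ℝ} {u : ℝ → L → ℝ}
    (hu : ContMDiffOn (𝓘(ℝ, ℝ).prod 𝓘(ℝ, ℝ)) 𝓘(ℝ, ℝ) (⊤ : ℕ∞)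
      (fun q : ℝ × L => u q.1 q.2) (S ×ˢ Set.univ)) {t : ℝ} (ht : t ∈ S) :
    ContMDiff 𝓘(ℝ, ℝ) 𝓘(ℝ, ℝ) (⊤ : ℕ∞) (u t) := by
  rw [← contMDiffOn_univ]
  exact hu.comp (f := fun l : L => (t, l)) (contMDiffOn_const.prodMk contMDiffOn_id)
    fun l _ => ⟨ht, trivial⟩

theorem contDiffOn_chart {S : Set ℝ} {u : ℝ → L → ℝ}
    (hu : ContMDiffOn (𝓘(ℝ, ℝ).prod 𝓘(ℝ, ℝ)) 𝓘(ℝ, ℝ) (⊤ : ℕ∞)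
      (fun q : ℝ × L => u q.1 q.2) (S ×ˢ Set.univ)) (l : L) :
    ContDiffOn ℝ (⊤ : ℕ∞) (fun q : ℝ × ℝ => u q.1 ((extChartAt 𝓘(ℝ, ℝ) l).symm q.2))
      (S ×ˢ (extChartAt 𝓘(ℝ, ℝ) l).target) := by
  have h1 : ContMDiffOn 𝓘(ℝ, ℝ × ℝ) (𝓘(ℝ, ℝ).prod 𝓘(ℝ, ℝ)) (⊤ : ℕ∞)
      (fun q : ℝ × ℝ => (q.1, (extChartAt 𝓘(ℝ, ℝ) l).symm q.2))
      (S ×ˢ (extChartAt 𝓘(ℝ, ℝ) l).target) := by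
    refine ContMDiffOn.prodMk contDiff_fst.contMDiff.contMDiffOn ?_
    exact (contMDiffOn_extChartAt_symm l).comp contDiff_snd.contMDiff.contMDiffOn fun q hq => hq.2
  exact (hu.comp h1 fun q hq => ⟨hq.1, trivial⟩).contDiffOn

end LineCalculus

/-! ### Commuting time and space derivatives up to the end points of the interval. -/

section MixedDerivatives

variable {S T : Set ℝ} {w : ℝ × ℝ → ℝ}

theorem hasDerivWithinAt_fst_slice (hw : DifferentiableOn ℝ w (S ×ˢ T)) {t r : ℝ} (ht : t ∈ S)
    (hr : r ∈ T) :
    HasDerivWithinAt (fun τ => w (τ, r)) (fderivWithin ℝ w (S ×ˢ T) (t, r) (1, 0)) S t := by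
  exact (hw (t, r) ⟨ht, hr⟩).hasFDerivWithinAt.comp_hasDerivWithinAt t
    ((hasDerivAt_id t).prodMk (hasDerivAt_const t r)).hasDerivWithinAt
    (show Set.MapsTo (fun τ => (τ, r)) S (S ×ˢ T) from fun τ hτ => ⟨hτ, hr⟩)

theorem hasDerivAt_snd_slice (hT : IsOpen T) (hw : DifferentiableOn ℝ w (S ×ˢ T)) {t r : ℝ}
    (ht : t ∈ S) (hr : r ∈ T) :
    HasDerivAt (fun ρ => w (t, ρ)) (fderivWithin ℝ w (S ×ˢ T) (t, r) (0, 1)) r := by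
  have h := (hw (t, r) ⟨ht, hr⟩).hasFDerivWithinAt
  have h2 := h.comp_hasDerivWithinAt (s := T) r
    ((hasDerivAt_const r t).prodMk (hasDerivAt_id r)).hasDerivWithinAt
    (show Set.MapsTo (fun ρ => (t, ρ)) T (S ×ˢ T) from fun ρ hρ => ⟨ht, hρ⟩)
  exact h2.hasDerivAt (hT.mem_nhds hr)

theorem uniqueDiffOn_of_ordConnected (hS : S.OrdConnected) (hS' : S.Nontrivial) :
    UniqueDiffOn ℝ S :=
  uniqueDiffOn_convex hS.convex (by
    obtain ⟨a, ha, b, hb, hab⟩ := hS'.exists_lt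
    refine (Set.nonempty_Ioo.2 hab).mono ?_
    rw [← interior_Icc]
    exact interior_mono (hS.out ha hb))

theorem subset_closure_interior_of_ordConnected (hS : S.OrdConnected) (hS' : S.Nontrivial) :
    S ⊆ closure (interior S) := by
  have : (interior S).Nonempty := by
    obtain ⟨a, ha, b, hb, hab⟩ := hS'.exists_lt
    refine (Set.nonempty_Ioo.2 hab).mono ?_
    rw [← interior_Icc]
    exact interior_mono (hS.out ha hb)
  rw [(convex_iff_ordConnected.2 hS).closure_interior_eq_closure_of_nonempty_interior this]
  exact subset_closure

/-- Mixed partial derivatives on `S × T` commute, also at the end points of `S`. -/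
theorem hasDerivWithinAt_deriv_snd (hS : S.OrdConnected) (hS' : S.Nontrivial) (hT : IsOpen T)
    (hw : ContDiffOn ℝ (⊤ : ℕ∞) w (S ×ˢ T)) {t r : ℝ} (ht : t ∈ S) (hr : r ∈ T) :
    HasDerivWithinAt (fun τ => deriv (fun ρ => w (τ, ρ)) r)
      (deriv (fun ρ => derivWithin (fun τ => w (τ, ρ)) S t) r) S t := by
  have hu : UniqueDiffOn ℝ (S ×ˢ T) := (uniqueDiffOn_of_ordConnected hS hS').prod hT.uniqueDiffOn
  have hd : DifferentiableOn ℝ w (S ×ˢ T) := hw.differentiableOn (by simp)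
  set D := fderivWithin ℝ w (S ×ˢ T) with hD
  have hdD : DifferentiableOn ℝ D (S ×ˢ T) :=
    (hw.fderivWithin (m := 1) hu (by norm_cast)).differentiableOn (by simp)
  -- At an end point of `S` symmetry of the second derivative is inherited by continuity from
  -- interior points, hence the need for `S ⊆ closure (interior S)`.
  have hsymm : IsSymmSndFDerivWithinAt ℝ w (S ×ˢ T) (t, r) := by
    refine (hw (t, r) ⟨ht, hr⟩).isSymmSndFDerivWithinAt (by
      rw [minSmoothness_of_isRCLikeNormedField]; exact two_le_infty) hu ?_ ⟨ht, hr⟩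
    rw [interior_prod_eq, closure_prod_eq, hT.interior_eq]
    exact ⟨subset_closure_interior_of_ordConnected hS hS' ht, subset_closure hr⟩
  have h1 : HasDerivWithinAt (fun τ => D (τ, r) (0, 1))
      (fderivWithin ℝ D (S ×ˢ T) (t, r) (1, 0) (0, 1)) S t := by
    have h := (hdD (t, r) ⟨ht, hr⟩).hasFDerivWithinAt.comp_hasDerivWithinAt t
      ((hasDerivAt_id t).prodMk (hasDerivAt_const t r)).hasDerivWithinAt
      (show Set.MapsTo (fun τ => (τ, r)) S (S ×ˢ T) from fun τ hτ => ⟨hτ, hr⟩)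
    exact (ContinuousLinearMap.apply ℝ ℝ ((0 : ℝ), (1 : ℝ))).hasFDerivAt.comp_hasDerivWithinAt t h
  have h2 : HasDerivAt (fun ρ => D (t, ρ) (1, 0))
      (fderivWithin ℝ D (S ×ˢ T) (t, r) (0, 1) (1, 0)) r := by
    have h := ((hdD (t, r) ⟨ht, hr⟩).hasFDerivWithinAt.comp_hasDerivWithinAt r
      ((hasDerivAt_const r t).prodMk (hasDerivAt_id r)).hasDerivWithinAt
      (show Set.MapsTo (fun ρ => (t, ρ)) T (S ×ˢ T) from fun τ hτ => ⟨ht, hτ⟩)).hasDerivAt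
        (hT.mem_nhds hr)
    exact (ContinuousLinearMap.apply ℝ ℝ ((1 : ℝ), (0 : ℝ))).hasFDerivAt.comp_hasDerivAt r h
  have h3 : deriv (fun ρ => derivWithin (fun τ => w (τ, ρ)) S t) r =
      fderivWithin ℝ D (S ×ˢ T) (t, r) (0, 1) (1, 0) := by
    rw [← h2.deriv]
    refine Filter.EventuallyEq.deriv_eq ?_
    filter_upwards [hT.mem_nhds hr] with ρ hρ
    exact (hasDerivWithinAt_fst_slice hd ht hρ).derivWithin
      (uniqueDiffOn_of_ordConnected hS hS' t ht)
  rw [h3, hsymm (0, 1) (1, 0)]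
  refine h1.congr (fun τ hτ => ?_) ?_
  · exact (hasDerivAt_snd_slice hT hd hτ hr).deriv
  · exact (hasDerivAt_snd_slice hT hd ht hr).deriv

end MixedDerivatives

/-! ### Time derivatives of functions on `L` and of their `r`-derivatives. -/

section TimeDerivative

variable {L : Type*} [TopologicalSpace L] [ChartedSpace ℝ L] [IsManifold 𝓘(ℝ, ℝ) (⊤ : ℕ∞) L]
  {S : Set ℝ} {u : ℝ → L → ℝ}

theorem hasDerivWithinAt_time
    (hu : ContMDiffOn (𝓘(ℝ, ℝ).prod 𝓘(ℝ, ℝ)) 𝓘(ℝ, ℝ) (⊤ : ℕ∞)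
      (fun q : ℝ × L => u q.1 q.2) (S ×ˢ Set.univ)) {t : ℝ} (ht : t ∈ S) (l : L) :
    HasDerivWithinAt (fun τ => u τ l) (derivWithin (fun τ => u τ l) S t) S t := by
  have h := (contDiffOn_chart hu l).differentiableOn (by simp)
  have h2 := (hasDerivWithinAt_fst_slice h ht (mem_extChartAt_target (I := 𝓘(ℝ, ℝ)) l)).differentiableWithinAt
  simp only [extChartAt_to_inv] at h2
  exact h2.hasDerivWithinAt

/-- In the chart at `l` this is equality of mixed partials, since the coefficient of `dr` does not
depend on time. -/
theorem hasDerivWithinAt_rDeriv (hS : S.OrdConnected) (hS' : S.Nontrivial)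
    (dr : DForm 𝓘(ℝ, ℝ) L ℝ 1)
    (hu : ContMDiffOn (𝓘(ℝ, ℝ).prod 𝓘(ℝ, ℝ)) 𝓘(ℝ, ℝ) (⊤ : ℕ∞)
      (fun q : ℝ × L => u q.1 q.2) (S ×ˢ Set.univ)) {t : ℝ} (ht : t ∈ S) {v : L → ℝ}
    (hv : ∀ l, derivWithin (fun τ => u τ l) S t = v l) {l : L}
    (hv' : MDifferentiableAt 𝓘(ℝ, ℝ) 𝓘(ℝ, ℝ) v l) :
    HasDerivWithinAt (fun τ => rDeriv dr (u τ) l) (rDeriv dr v l) S t := by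
  have h := hasDerivWithinAt_deriv_snd hS hS' (isOpen_extChartAt_target (I := 𝓘(ℝ, ℝ)) l)
    (contDiffOn_chart hu l) ht (mem_extChartAt_target l)
  rw [rDeriv_eq hv']
  have h2 : (fun ρ => derivWithin (fun τ => u τ ((extChartAt 𝓘(ℝ, ℝ) l).symm ρ)) S t) =
      v ∘ (extChartAt 𝓘(ℝ, ℝ) l).symm := funext fun ρ => hv _
  simp only [h2] at h
  refine (h.div_const (lineCoeff dr l)).congr (fun τ hτ => ?_) ?_
  · exact rDeriv_eq ((contMDiff_slice hu hτ).mdifferentiable (by simp) l)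
  · exact rDeriv_eq ((contMDiff_slice hu ht).mdifferentiable (by simp) l)

end TimeDerivative

/-! ### Real and imaginary parts and wedge products of smooth forms. -/

section ComplexForms

variable {E : Type*} [NormedAddCommGroup E] [NormedSpace ℝ E]
  {H : Type*} [TopologicalSpace H] {I : ModelWithCorners ℝ E H}
  {M : Type*} [TopologicalSpace M] [ChartedSpace H M]
  {F F' : Type*} [NormedAddCommGroup F] [NormedSpace ℝ F] [NormedAddCommGroup F'] [NormedSpace ℝ F']

/-- Post-composition of a form with a continuous linear map of the coefficients. -/
def DForm.postcomp (T : F →L[ℝ] F') {k : ℕ} (ω : DForm I M F k) : DForm I M F' k :=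
  fun x => T.compContinuousAlternatingMap (ω x)

theorem DForm.IsSmooth.postcomp (T : F →L[ℝ] F') {k : ℕ} {ω : DForm I M F k} (h : ω.IsSmooth) :
    (ω.postcomp T).IsSmooth := by
  intro x
  have := (ContinuousLinearMap.compContinuousAlternatingMapCLM (ι := Fin k) ℝ E F F' T).contDiff
    (n := ((⊤ : ℕ∞) : WithTop ℕ∞))
  exact this.comp_contDiffOn (h x)

theorem extD_postcomp [I.Boundaryless] [IsManifold I 1 M] (T : F →L[ℝ] F') {k : ℕ} {ω : DForm I M F k} (h : ω.IsSmooth) (x : M) :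
    extD (ω.postcomp T) x = T.compContinuousAlternatingMap (extD ω x) := by
  refine ContinuousAlternatingMap.ext fun (v : Fin (k + 1) → E) => ?_
  refine (extD_apply _ x v).trans ?_
  refine Eq.trans ?_ (congrArg T (extD_apply ω x v)).symm
  have hd : DifferentiableAt ℝ (ω.inChart x) (extChartAt I x x) :=
    (h.contDiffAt x).differentiableAt (by simp)
  have h1 : fderiv ℝ ((ω.postcomp T).inChart x) (extChartAt I x x) =
      (ContinuousLinearMap.compContinuousAlternatingMapCLM (ι := Fin k) ℝ E F F' T).comp
        (fderiv ℝ (ω.inChart x) (extChartAt I x x)) :=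
    ((ContinuousLinearMap.compContinuousAlternatingMapCLM (ι := Fin k) ℝ E F F' T).hasFDerivAt.comp
      _ hd.hasFDerivAt).fderiv
  rw [extDeriv, extDeriv, h1, ContinuousAlternatingMap.alternatizeUncurryFin_apply,
    ContinuousAlternatingMap.alternatizeUncurryFin_apply, map_sum]
  refine Finset.sum_congr rfl fun i _ => ?_
  rw [map_zsmul]
  rfl

theorem DForm.IsSmooth.wedge {k l : ℕ} {ω : DForm I M ℝ k} {η : DForm I M ℝ l} (hω : ω.IsSmooth)
    (hη : η.IsSmooth) : DForm.IsSmooth (I := I) (M := M) (k := k + l)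
      fun x => _root_.wedge (ω x) (η x) := by
  intro x
  have h : ContDiffOn ℝ (⊤ : ℕ∞) (fun y => wedgeCLM k l (ω.inChart x y) (η.inChart x y))
      (extChartAt I x).target := by
    have hc : ContDiff ℝ (⊤ : ℕ∞) (fun a : E [⋀^Fin k]→L[ℝ] ℝ => wedgeCLM (E := E) k l a) :=
      ContinuousLinearMap.contDiff (𝕜 := ℝ) (E := E [⋀^Fin k]→L[ℝ] ℝ)
        (F := (E [⋀^Fin l]→L[ℝ] ℝ) →L[ℝ] E [⋀^Fin (k + l)]→L[ℝ] ℝ) (wedgeCLM k l)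
    have h1 := hc.comp_contDiffOn (hω x)
    exact h1.clm_apply (hη x)
  refine h.congr fun y _ => ?_
  rw [wedgeCLM_apply]
  exact wedge_compContinuousLinearMap _ _ _

end ComplexForms

/-! ### The structure equations for `Re Ω` and `Im Ω`. -/

section SU3Forms

variable {N : Type*} [TopologicalSpace N] [ChartedSpace E6 N] [IsManifold (𝓡 6) (⊤ : ℕ∞) N]

namespace SU3Structure

variable (s : SU3Structure N)

/-- The real part of the complex volume form. -/
def reΩ : DForm (𝓡 6) N ℝ 3 := fun x => reForm (s.Ω x)

/-- The imaginary part of the complex volume form. -/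
def imΩ : DForm (𝓡 6) N ℝ 3 := fun x => imForm (s.Ω x)

/-- The form `ω²`. -/
def ωSq : DForm (𝓡 6) N ℝ 4 := fun x => wedge (s.ω x) (s.ω x)

theorem smooth_reΩ : s.reΩ.IsSmooth :=
  s.smooth_Ω.postcomp Complex.reCLM

theorem smooth_imΩ : s.imΩ.IsSmooth :=
  s.smooth_Ω.postcomp Complex.imCLM

theorem smooth_ωSq : s.ωSq.IsSmooth :=
  s.smooth_ω.wedge s.smooth_ω

variable {s} {lam : ℝ}

/-- `dΩ = 2λ i ω²` is purely imaginary, since `λ` and `ω` are real. -/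
theorem IsCalabiYauOrNearlyKahler.extD_reΩ (hs : s.IsCalabiYauOrNearlyKahler lam) : extD s.reΩ = 0 := by
  funext x
  refine (extD_postcomp Complex.reCLM s.smooth_Ω x).trans ?_
  rw [hs.d_Ω x]
  ext v
  change ((2 * lam * Complex.I : ℂ) * ((wedge (s.ω x) (s.ω x) v : ℝ) : ℂ)).re = 0
  simp

theorem IsCalabiYauOrNearlyKahler.extD_imΩ (hs : s.IsCalabiYauOrNearlyKahler lam) :
    extD s.imΩ = fun x => (2 * lam) • s.ωSq x := by
  funext x
  refine (extD_postcomp Complex.imCLM s.smooth_Ω x).trans ?_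
  rw [hs.d_Ω x]
  ext v
  change ((2 * lam * Complex.I : ℂ) * ((wedge (s.ω x) (s.ω x) v : ℝ) : ℂ)).im =
    (2 * lam) * wedge (s.ω x) (s.ω x) v
  simp

end SU3Structure

end SU3Forms

/-! ### The two invariant families of forms and the action of `d` on them. -/

section WarpedForms

variable {N : Type*} [TopologicalSpace N] [ChartedSpace E6 N] [IsManifold (𝓡 6) (⊤ : ℕ∞) N]
  {L : Type*} [TopologicalSpace L] [ChartedSpace ℝ L]

/-- The 3-form `u Re Ω + v Im Ω + w dr ∧ ω` on `N × L`. -/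
def warpedThreeForm (s : SU3Structure N) (dr : DForm 𝓘(ℝ, ℝ) L ℝ 1) (u v w : L → ℝ) :
    DForm I7 (N × L) ℝ 3 :=
  (fun p => u p.2 • fromN s.reΩ p) + (fun p => v p.2 • fromN s.imΩ p) +
    (fun p => w p.2 • oneWedge (fromL dr p) (fromN s.ω p))

/-- The 4-form `u ω² + v dr ∧ Re Ω + w dr ∧ Im Ω` on `N × L`. -/
def warpedFourForm (s : SU3Structure N) (dr : DForm 𝓘(ℝ, ℝ) L ℝ 1) (u v w : L → ℝ) :
    DForm I7 (N × L) ℝ 4 :=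
  (fun p => u p.2 • fromN s.ωSq p) + (fun p => v p.2 • oneWedge (fromL dr p) (fromN s.reΩ p)) +
    (fun p => w p.2 • oneWedge (fromL dr p) (fromN s.imΩ p))

variable {s : SU3Structure N} {dr : DForm 𝓘(ℝ, ℝ) L ℝ 1}

theorem warpF_pow_three (h θ : L → ℝ) (l : L) :
    warpF h θ l ^ 3 = ((h l ^ 3 * Real.cos (θ l) : ℝ) : ℂ) +
      ((h l ^ 3 * Real.sin (θ l) : ℝ) : ℂ) * Complex.I := by
  have h1 : Complex.exp (Complex.I * ((θ l / 3 : ℝ) : ℂ)) ^ 3 =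
      Complex.cos (θ l) + Complex.sin (θ l) * Complex.I := by
    rw [← Complex.exp_nat_mul, ← Complex.exp_mul_I]
    congr 1
    push_cast
    ring
  rw [warpF, mul_pow, h1]
  push_cast
  ring

theorem reForm_smul_fromN (a b : ℝ) (p : N × L) :
    reForm (((a : ℂ) + (b : ℂ) * Complex.I) • fromN s.Ω p) =
      a • fromN s.reΩ p - b • fromN s.imΩ p := by
  ext v
  change (((a : ℂ) + (b : ℂ) * Complex.I) * (fromN s.Ω p v)).re =
    a * (fromN s.Ω p v).re - b * (fromN s.Ω p v).im
  simp

theorem imForm_smul_fromN (a b : ℝ) (p : N × L) :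
    imForm (((a : ℂ) + (b : ℂ) * Complex.I) • fromN s.Ω p) =
      b • fromN s.reΩ p + a • fromN s.imΩ p := by
  ext v
  change (((a : ℂ) + (b : ℂ) * Complex.I) * (fromN s.Ω p v)).im =
    b * (fromN s.Ω p v).re + a * (fromN s.Ω p v).im
  simp
  ring

theorem warpedPhi_eq (s : SU3Structure N) (dr : DForm 𝓘(ℝ, ℝ) L ℝ 1) (G h θ : L → ℝ) :
    warpedPhi s dr G h θ = warpedThreeForm s dr (fun l => h l ^ 3 * Real.cos (θ l))
      (fun l => -(h l ^ 3 * Real.sin (θ l))) (fun l => G l * h l ^ 2) := by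
  funext p
  rw [warpedPhi, warpF_pow_three, reForm_smul_fromN, sub_eq_add_neg, ← neg_smul]
  rfl

/-- The minus signs come from moving the 1-form `G dr` past the 3-form `Im (F³ Ω)`. -/
theorem warpedPsi_eq (s : SU3Structure N) (dr : DForm 𝓘(ℝ, ℝ) L ℝ 1) (G h θ : L → ℝ) :
    warpedPsi s dr G h θ = warpedFourForm s dr (fun l => h l ^ 4 / 2)
      (fun l => -(G l * (h l ^ 3 * Real.sin (θ l))))
      (fun l => -(G l * (h l ^ 3 * Real.cos (θ l)))) := by
  funext p
  have h1 : wedge (imForm (warpF h θ p.2 ^ 3 • fromN s.Ω p)) (G p.2 • fromL dr p) =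
      (-(G p.2 * (h p.2 ^ 3 * Real.sin (θ p.2)))) • oneWedge (fromL dr p) (fromN s.reΩ p) +
      (-(G p.2 * (h p.2 ^ 3 * Real.cos (θ p.2)))) • oneWedge (fromL dr p) (fromN s.imΩ p) := by
    refine (wedge_three_one _ _).trans ?_
    change -oneWedge _ _ = _
    rw [warpF_pow_three, imForm_smul_fromN, oneWedge_smul_left, oneWedge_add_right,
      oneWedge_smul_right, oneWedge_smul_right]
    module
  have h2 : wedge (fromN s.ω p) (fromN s.ω p) = fromN s.ωSq p :=
    (wedge_compContinuousLinearMap _ _ _).symm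
  rw [warpedPsi, h1, h2, ← add_assoc]
  rfl

variable [IsManifold 𝓘(ℝ, ℝ) (⊤ : ℕ∞) L]

theorem diffAt_warpedThreeForm (hdr : dr.IsSmooth) {u v w : L → ℝ} {p : N × L}
    (hu : MDifferentiableAt 𝓘(ℝ, ℝ) 𝓘(ℝ, ℝ) u p.2) (hv : MDifferentiableAt 𝓘(ℝ, ℝ) 𝓘(ℝ, ℝ) v p.2)
    (hw : MDifferentiableAt 𝓘(ℝ, ℝ) 𝓘(ℝ, ℝ) w p.2) : (warpedThreeForm s dr u v w).DiffAt p :=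
  ((diffAt_smul_fromN s.smooth_reΩ hu).add (diffAt_smul_fromN s.smooth_imΩ hv)).add
    (diffAt_smul_oneWedge hdr s.smooth_ω hw)

theorem extD_warpedThreeForm {lam : ℝ} (hs : s.IsCalabiYauOrNearlyKahler lam)
    (hdr : dr.IsSmooth) (hdr0 : ∀ l, dr l ≠ 0) {u v w : L → ℝ}
    (hu : MDifferentiable 𝓘(ℝ, ℝ) 𝓘(ℝ, ℝ) u) (hv : MDifferentiable 𝓘(ℝ, ℝ) 𝓘(ℝ, ℝ) v)
    (hw : MDifferentiable 𝓘(ℝ, ℝ) 𝓘(ℝ, ℝ) w) :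
    extD (warpedThreeForm s dr u v w) = warpedFourForm s dr (fun l => 2 * lam * v l)
      (fun l => rDeriv dr u l + 3 * lam * w l) (rDeriv dr v) := by
  funext p
  have h1 := diffAt_smul_fromN s.smooth_reΩ (hu p.2)
  have h2 := diffAt_smul_fromN s.smooth_imΩ (hv p.2)
  have h3 := diffAt_smul_oneWedge hdr s.smooth_ω (hw p.2)
  have e1 : fromN (extD s.reΩ) p = (0 : TangentSpace I7 p [⋀^Fin 4]→L[ℝ] ℝ) := by
    rw [hs.extD_reΩ]; rfl
  have e2 : (fromN (extD s.imΩ) p : TangentSpace I7 p [⋀^Fin 4]→L[ℝ] ℝ) =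
      (2 * lam) • fromN s.ωSq p := by
    rw [hs.extD_imΩ]; rfl
  have e3 : (fromN (extD s.ω) p : TangentSpace I7 p [⋀^Fin 3]→L[ℝ] ℝ) =
      (-3 * lam) • fromN s.reΩ p := by
    rw [show extD s.ω = fun x => (-3 * lam) • s.reΩ x from funext hs.d_ω]; rfl
  refine (extD_add (h1.add h2) h3).trans ?_
  rw [extD_add h1 h2, extD_smul_fromN hdr0 s.smooth_reΩ (hu p.2),
    extD_smul_fromN hdr0 s.smooth_imΩ (hv p.2), extD_smul_oneWedge hdr s.smooth_ω (hw p.2)]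
  simp only [Nat.reduceAdd] at *
  rw [e1, e2, e3, oneWedge_smul_right]
  change _ = (2 * lam * v p.2) • fromN s.ωSq p + (rDeriv dr u p.2 + 3 * lam * w p.2) •
    oneWedge (fromL dr p) (fromN s.reΩ p) + rDeriv dr v p.2 • oneWedge (fromL dr p) (fromN s.imΩ p)
  module

/-- Of the possible terms only `dr ∧ ω²` is left: `ω²` and `Re Ω` are closed, and `d Im Ω = 2λ ω²`.
Hence co-closedness is one scalar equation. -/
theorem extD_warpedFourForm {lam : ℝ} (hs : s.IsCalabiYauOrNearlyKahler lam)
    (hdr : dr.IsSmooth) (hdr0 : ∀ l, dr l ≠ 0) {u v w : L → ℝ}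
    (hu : MDifferentiable 𝓘(ℝ, ℝ) 𝓘(ℝ, ℝ) u) (hv : MDifferentiable 𝓘(ℝ, ℝ) 𝓘(ℝ, ℝ) v)
    (hw : MDifferentiable 𝓘(ℝ, ℝ) 𝓘(ℝ, ℝ) w) (p : N × L) :
    extD (warpedFourForm s dr u v w) p =
      (rDeriv dr u p.2 - 2 * lam * w p.2) • oneWedge (fromL dr p) (fromN s.ωSq p) := by
  have h1 := diffAt_smul_fromN s.smooth_ωSq (hu p.2)
  have h2 := diffAt_smul_oneWedge hdr s.smooth_reΩ (hv p.2)
  have h3 := diffAt_smul_oneWedge hdr s.smooth_imΩ (hw p.2)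
  have e1 : fromN (extD s.reΩ) p = (0 : TangentSpace I7 p [⋀^Fin 4]→L[ℝ] ℝ) := by
    rw [hs.extD_reΩ]; rfl
  have e2 : (fromN (extD s.imΩ) p : TangentSpace I7 p [⋀^Fin 4]→L[ℝ] ℝ) =
      (2 * lam) • fromN s.ωSq p := by
    rw [hs.extD_imΩ]; rfl
  have e3 : (fromN (extD s.ωSq) p : TangentSpace I7 p [⋀^Fin 5]→L[ℝ] ℝ) = 0 := by
    rw [show extD s.ωSq = 0 from funext hs.d_ω_sq]; rfl
  refine (extD_add (h1.add h2) h3).trans ?_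
  rw [extD_add h1 h2, extD_smul_fromN hdr0 s.smooth_ωSq (hu p.2),
    extD_smul_oneWedge hdr s.smooth_reΩ (hv p.2), extD_smul_oneWedge hdr s.smooth_imΩ (hw p.2)]
  simp only [Nat.reduceAdd] at *
  have e0 : oneWedge (fromL dr p) (0 : TangentSpace I7 p [⋀^Fin 4]→L[ℝ] ℝ) = 0 := by
    ext v
    simp [oneWedge_apply]
  rw [e1, e2, e3, oneWedge_smul_right, e0]
  module

end WarpedForms

/-! ### Orthonormal frames on `N × L` adapted to the warped structure. -/

section AdaptedFrame

/-- Only the term in which `η` receives the last vector survives, and its sign is `+` because `η`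
stands on the right. -/
theorem wedge_one_right_apply_of_forall {V : Type*} [AddCommGroup V] [Module ℝ V]
    [TopologicalSpace V] {k : ℕ} (a : V [⋀^Fin k]→L[ℝ] ℝ) (η : V [⋀^Fin 1]→L[ℝ] ℝ)
    (f : Fin (k + 1) → V) (hf : ∀ i : Fin k, η (fun _ => f i.castSucc) = 0) :
    wedge a η f = a (fun i => f i.castSucc) * η (fun _ => f (Fin.last k)) := by
  have h0 : finAddFlip (Fin.cast (Nat.add_comm k 1) 0) = (Fin.last k : Fin (k + 1)) := by
    have : Fin.cast (Nat.add_comm k 1) 0 = Fin.castAdd k (0 : Fin 1) := by ext; simp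
    rw [this, finAddFlip_apply_castAdd]; ext; simp
  have h1 : ∀ i : Fin k, finAddFlip (Fin.cast (Nat.add_comm k 1) i.succ) = i.castSucc := by
    intro i
    have : Fin.cast (Nat.add_comm k 1) i.succ = Fin.natAdd 1 i := by ext; simp; omega
    rw [this, finAddFlip_apply_natAdd]; rfl
  rw [wedge_swap_apply, wedge_one_left_apply, Fin.sum_univ_succ, Finset.sum_eq_zero, h0]
  · simp only [Fin.succAbove_zero, h1]
    simp [mul_comm]
  · intro i _
    simp only [h1]
    rw [hf]
    ring

variable {N : Type*} [TopologicalSpace N] [ChartedSpace E6 N] [IsManifold (𝓡 6) (⊤ : ℕ∞) N]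
  {L : Type*} [TopologicalSpace L] [ChartedSpace ℝ L]

/-- The metric at a point as a bilinear map on the model space. -/
def SU3Structure.bilin (s : SU3Structure N) (x : N) : E6 →ₗ[ℝ] E6 →ₗ[ℝ] ℝ :=
  let g : E6 →L[ℝ] E6 →L[ℝ] ℝ := s.g.inner x
  LinearMap.mk₂ ℝ (fun u v => g u v) (by simp) (by simp) (by simp) (by simp)

theorem SU3Structure.exists_frame (s : SU3Structure N) (x : N) (c : ℂ) (hc : Complex.normSq c = 1) :
    ∃ e : Fin 6 → E6, (∀ i j, s.bilin x (e i) (e j) = if i = j then 1 else 0) ∧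
      s.vol x e = 1 ∧ (∀ i j, s.ω x ![e i, e j] = stdOmega i j) ∧
      ∀ i j k, s.Ω x ![e i, e j, e k] = ((reOmega i j k : ℂ) + imOmega i j k * Complex.I) * c := by
  let J : E6 →L[ℝ] E6 := s.J x
  let Ω : E6 [⋀^Fin 3]→L[ℝ] ℂ := s.Ω x
  let vol : E6 [⋀^Fin 6]→L[ℝ] ℝ := s.vol x
  have hsymm : ∀ u v, s.bilin x u v = s.bilin x v u := s.g.symm x
  have hJ : ∀ u, J (J u) = -u := s.J_sq x
  have hJB : ∀ u v, s.bilin x (J u) (J v) = s.bilin x u v := s.J_isometry x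
  obtain ⟨e, he, heΩ, hevol⟩ := exists_su3_frame (s.bilin x) hsymm (s.g.pos x) J.toLinearMap hJ hJB
    (by simp) Ω vol (s.Ω_type x) (s.vol_sq x) (s.Ω_wedge_conj x) c hc
  refine ⟨complexFrame J.toLinearMap e, he.gram hsymm hJB, hevol, fun i j => ?_, fun i j k => ?_⟩
  · exact (s.ω_eq x _ _).trans (he.hermitian hsymm hJ hJB i j)
  · rw [← heΩ]
    exact complexFrame_omega J.toLinearMap Ω (s.Ω_type x) e i j k

variable [IsManifold 𝓘(ℝ, ℝ) (⊤ : ℕ∞) L]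

theorem fromN_eq_zero {F : Type*} [NormedAddCommGroup F] [NormedSpace ℝ F] {k : ℕ}
    (η : DForm (𝓡 6) N F k) (p : N × L) {v : Fin k → E6 × ℝ} {a : Fin k} (ha : (v a).1 = 0) :
    fromN η p v = 0 := by
  let ηx : E6 [⋀^Fin k]→L[ℝ] F := η p.1
  exact (fromN_apply η p v).trans (ηx.map_coord_zero a ha)

theorem fromN_smul_eq {F : Type*} [NormedAddCommGroup F] [NormedSpace ℝ F] {k : ℕ}
    (η : DForm (𝓡 6) N F k) (p : N × L) {v : Fin k → E6 × ℝ} {w : Fin k → E6} {c : ℝ}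
    (hv : ∀ a, (v a).1 = c • w a) : fromN η p v = c ^ k • η p.1 w := by
  let ηx : E6 [⋀^Fin k]→L[ℝ] F := η p.1
  refine (fromN_apply η p v).trans ?_
  have h1 : (fun a => (v a).1) = fun a => c • w a := funext hv
  refine (congrArg ηx h1).trans ((ηx.map_smul_univ (fun _ => c) w).trans ?_)
  rw [Finset.prod_const, Finset.card_univ, Fintype.card_fin]
  rfl

theorem warpedMetric_apply (s : SU3Structure N) (dr : DForm 𝓘(ℝ, ℝ) L ℝ 1) (G h : L → ℝ)
    (p : N × L) (u v : E6 × ℝ) : warpedMetric s dr G h p u v =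
      G p.2 ^ 2 * ((u.2 * lineCoeff dr p.2) * (v.2 * lineCoeff dr p.2)) +
        h p.2 ^ 2 * s.bilin p.1 u.1 v.1 := by
  have h1 : ∀ u : E6 × ℝ, (fromL dr : DForm I7 (N × L) ℝ 1) p (fun _ => u) =
      u.2 * lineCoeff dr p.2 := fun u =>
    (fromL_apply dr p fun _ => u).trans (lineForm_apply dr p.2 fun _ => u.2)
  have h2 : (mfderiv I7 (𝓡 6) Prod.fst p : (E6 × ℝ) →L[ℝ] E6) = ContinuousLinearMap.fst ℝ E6 ℝ :=
    mfderiv_fst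
  have h3 : ∀ u : E6 × ℝ, (mfderiv I7 (𝓡 6) Prod.fst p u : E6) = u.1 := fun u =>
    congrArg (fun T : (E6 × ℝ) →L[ℝ] E6 => T u) h2
  exact congrArg₂ (· + ·) (congrArg (G p.2 ^ 2 * ·) (congrArg₂ (· * ·) (h1 u) (h1 v)))
    (congrArg (h p.2 ^ 2 * ·) (congrArg₂ (fun a b => s.bilin p.1 a b) (h3 u) (h3 v)))

/-- The metric `g₇` at a point as a bilinear map on the model space. -/
def warpedBilin (s : SU3Structure N) (dr : DForm 𝓘(ℝ, ℝ) L ℝ 1) (G h : L → ℝ)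
    (p : N × L) : (E6 × ℝ) →ₗ[ℝ] (E6 × ℝ) →ₗ[ℝ] ℝ :=
  LinearMap.mk₂ ℝ (fun u v => G p.2 ^ 2 * ((u.2 * lineCoeff dr p.2) * (v.2 * lineCoeff dr p.2)) +
    h p.2 ^ 2 * s.bilin p.1 u.1 v.1)
    (fun u u' v => by simp; ring) (fun c u v => by simp; ring) (fun u v v' => by simp; ring)
    (fun c u v => by simp; ring)

theorem warpedMetric_eq_bilin (s : SU3Structure N) (dr : DForm 𝓘(ℝ, ℝ) L ℝ 1) (G h : L → ℝ)
    (p : N × L) (u v : E6 × ℝ) : warpedMetric s dr G h p u v = warpedBilin s dr G h p u v :=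
  warpedMetric_apply s dr G h p u v

theorem warpedMetric_symm (s : SU3Structure N) (dr : DForm 𝓘(ℝ, ℝ) L ℝ 1) (G h : L → ℝ)
    (p : N × L) (u v : TangentSpace I7 p) :
    warpedMetric s dr G h p u v = warpedMetric s dr G h p v u := by
  refine (warpedMetric_apply s dr G h p u v).trans ?_
  refine Eq.trans ?_ (warpedMetric_apply s dr G h p v u).symm
  have : s.bilin p.1 (u : E6 × ℝ).1 (v : E6 × ℝ).1 = s.bilin p.1 (v : E6 × ℝ).1 (u : E6 × ℝ).1 :=
    s.g.symm p.1 _ _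
  rw [this, mul_comm ((u : E6 × ℝ).2 * _)]

theorem warpedVol_apply (s : SU3Structure N) (dr : DForm 𝓘(ℝ, ℝ) L ℝ 1) (G h : L → ℝ)
    (p : N × L) (f : Fin 7 → TangentSpace I7 p)
    (hf : ∀ i : Fin 6, fromL dr p (fun _ => f i.castSucc) = 0) :
    warpedVol s dr G h p f = (G p.2 * h p.2 ^ 6) * (fromN s.vol p (fun i => f i.castSucc) *
      fromL dr p (fun _ => f (Fin.last 6))) := by
  unfold warpedVol
  rw [ContinuousAlternatingMap.smul_apply, smul_eq_mul]
  congr 1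
  exact wedge_one_right_apply_of_forall (fromN s.vol p) (fromL dr p) f hf

/-- The frame `(e₁/h, …, e₆/h, ∂ᵣ/G)` on `N × L`. -/
def warpedFrame (e : Fin 6 → E6) (h c : ℝ) : Fin 7 → E6 × ℝ :=
  Fin.snoc (α := fun _ => E6 × ℝ) (fun i : Fin 6 => (h⁻¹ • e i, (0 : ℝ))) (0, c⁻¹)

theorem warpedFrame_castSucc (e : Fin 6 → E6) (h c : ℝ) (i : Fin 6) :
    warpedFrame e h c i.castSucc = (h⁻¹ • e i, 0) :=
  Fin.snoc_castSucc (α := fun _ => E6 × ℝ) _ _ i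

theorem warpedFrame_last (e : Fin 6 → E6) (h c : ℝ) :
    warpedFrame e h c (Fin.last 6) = (0, c⁻¹) :=
  Fin.snoc_last (α := fun _ => E6 × ℝ) _ _

theorem re_add_mul_I_mul (a b : ℝ) (z : ℂ) :
    (((a : ℂ) + (b : ℂ) * Complex.I) * z).re = a * z.re - b * z.im := by
  simp

theorem im_add_mul_I_mul (a b : ℝ) (z : ℂ) :
    (((a : ℂ) + (b : ℂ) * Complex.I) * z).im = b * z.re + a * z.im := by
  simp [add_comm]

/-- The frame consists of a unitary frame of `N` divided by `h` and the vector dual to `G dr`. It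
absorbs `G`, `h` and `θ` completely, so every later pointwise identity is one about the standard
model `ℂ³ ⊕ ℝ`. -/
theorem exists_isAdaptedBasis (s : SU3Structure N) {dr : DForm 𝓘(ℝ, ℝ) L ℝ 1}
    (hdr0 : ∀ l, dr l ≠ 0) {G h : L → ℝ} (θ : L → ℝ) {p : N × L} (hG : G p.2 ≠ 0)
    (hh : h p.2 ≠ 0) :
    ∃ f : Module.Basis (Fin 7) ℝ (E6 × ℝ), IsAdaptedBasis (V := E6 × ℝ) f
      (warpedMetric s dr G h p) (warpedVol s dr G h p) (G p.2 • fromL dr p)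
      (h p.2 ^ 2 • fromN s.ω p)
      ((h p.2 ^ 3 * Real.cos (θ p.2)) • fromN s.reΩ p -
        (h p.2 ^ 3 * Real.sin (θ p.2)) • fromN s.imΩ p)
      ((h p.2 ^ 3 * Real.sin (θ p.2)) • fromN s.reΩ p +
        (h p.2 ^ 3 * Real.cos (θ p.2)) • fromN s.imΩ p) := by
  set l := p.2 with hl
  have hc : lineCoeff dr l ≠ 0 := lineCoeff_ne_zero (hdr0 l)
  have hcs := Real.cos_sq_add_sin_sq (θ l)
  -- Prescribing the phase `exp(-iθ)` for `Ω` cancels the `exp(iθ)` in `F³ = h³ exp(iθ)`, while the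
  -- scaling by `1/h` cancels `h³`.
  obtain ⟨e, heg, hev, heω, heΩ⟩ := s.exists_frame p.1
    ((Real.cos (θ l) : ℂ) - Real.sin (θ l) * Complex.I) (by
      rw [sub_eq_add_neg, ← neg_mul, ← Complex.ofReal_neg, Complex.normSq_add_mul_I]
      nlinarith)
  set F := warpedFrame e (h l) (G l * lineCoeff dr l) with hF
  have hF1 : ∀ i : Fin 6, F i.castSucc = ((h l)⁻¹ • e i, 0) := warpedFrame_castSucc e _ _
  have hF2 : F (Fin.last 6) = (0, (G l * lineCoeff dr l)⁻¹) := warpedFrame_last e _ _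
  have hF3 : F 6 = (0, (G l * lineCoeff dr l)⁻¹) := hF2
  have hdr : ∀ u : E6 × ℝ, (fromL dr : DForm I7 (N × L) ℝ 1) p (fun _ => u) =
      u.2 * lineCoeff dr l := fun u =>
    (fromL_apply dr p fun _ => u).trans (lineForm_apply dr p.2 fun _ => u.2)
  have hvol : warpedVol s dr G h p F = 1 := by
    have h1 := warpedVol_apply s dr G h p F (fun i => by
      refine (hdr _).trans ?_
      rw [hF1]; simp)
    have h2 : fromN s.vol p (fun i : Fin 6 => F i.castSucc) = ((h l)⁻¹) ^ 6 := by
      refine (fromN_smul_eq s.vol p (w := e) fun i => by rw [hF1]).trans ?_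
      rw [hev]
      simp
    have h3 : fromL dr p (fun _ => F (Fin.last 6)) = (G l)⁻¹ := by
      refine (hdr _).trans ?_
      rw [hF2]
      field_simp
    refine h1.trans ?_
    refine (congrArg₂ (fun a b : ℝ => (G l * h l ^ 6) * (a * b)) h2 h3).trans ?_
    field_simp
  -- A dependent family would have volume `0` instead of `1`.
  have hli : LinearIndependent ℝ F := by
    by_contra hcon
    let vol : (E6 × ℝ) [⋀^Fin 7]→L[ℝ] ℝ := warpedVol s dr G h p
    have := vol.toAlternatingMap.map_linearDependent F hcon
    exact one_ne_zero (α := ℝ) (hvol.symm.trans this)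
  have hb : ∀ i, basisOfLinearIndependentOfCardEqFinrank hli (by simp) i = F i := fun i => by simp
  have hΩ : ∀ i j k : Fin 7, fromN s.Ω p ![F i, F j, F k] =
      ((h l : ℂ)⁻¹) ^ 3 * (((reOmega i j k : ℂ) + imOmega i j k * Complex.I) *
        ((Real.cos (θ l) : ℂ) - Real.sin (θ l) * Complex.I)) := by
    intro i j k
    refine Fin.lastCases ?_ (fun i => ?_) i
    · refine (fromN_eq_zero s.Ω p (a := 0) ?_).trans ?_
      · simp [hF3]
      · simp [reOmega, imOmega]
    refine Fin.lastCases ?_ (fun j => ?_) j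
    · refine (fromN_eq_zero s.Ω p (a := 1) ?_).trans ?_
      · simp [hF3]
      · simp [reOmega, imOmega]
    refine Fin.lastCases ?_ (fun k => ?_) k
    · refine (fromN_eq_zero s.Ω p (a := 2) ?_).trans ?_
      · simp [hF3]
      · simp [reOmega, imOmega]
    refine (fromN_smul_eq s.Ω p (c := (h l)⁻¹) (w := ![e i, e j, e k]) fun a => ?_).trans ?_
    · fin_cases a <;> simp [hF1]
    · refine (congrArg (fun z : ℂ => ((h l)⁻¹) ^ 3 • z) (heΩ i j k)).trans ?_
      simp
  have hω : ∀ i j : Fin 7, fromN s.ω p ![F i, F j] = ((h l)⁻¹) ^ 2 * stdOmega i j := by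
    intro i j
    refine Fin.lastCases ?_ (fun i => ?_) i
    · refine (fromN_eq_zero s.ω p (a := 0) ?_).trans ?_
      · simp [hF3]
      · refine Fin.lastCases ?_ (fun j => ?_) j
        · simp [stdOmega]
        · have : ¬ (3 = (j : ℕ) / 2) := by omega
          simp [stdOmega, this]
    refine Fin.lastCases ?_ (fun j => ?_) j
    · refine (fromN_eq_zero s.ω p (a := 1) ?_).trans ?_
      · simp [hF3]
      · have : ¬ ((i : ℕ) / 2 = 3) := by omega
        simp [stdOmega, this]
    refine (fromN_smul_eq s.ω p (c := (h l)⁻¹) (w := ![e i, e j]) fun a => ?_).trans ?_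
    · fin_cases a <;> simp [hF1]
    · exact congrArg (fun z : ℝ => ((h l)⁻¹) ^ 2 * z) (heω i j)
  have hP : ∀ i j k : Fin 7, (((h l ^ 3 * Real.cos (θ l) : ℝ) : ℂ) +
      ((h l ^ 3 * Real.sin (θ l) : ℝ) : ℂ) * Complex.I) * fromN s.Ω p ![F i, F j, F k] =
        (reOmega i j k : ℂ) + imOmega i j k * Complex.I := by
    intro i j k
    have hhc : (h l : ℂ) ≠ 0 := by exact_mod_cast hh
    have hcs' : (Real.cos (θ l) : ℂ) ^ 2 + (Real.sin (θ l) : ℂ) ^ 2 = 1 := by exact_mod_cast hcs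
    rw [hΩ]
    push_cast at hcs' ⊢
    field_simp
    linear_combination ((reOmega i j k : ℂ) + imOmega i j k * Complex.I) * hcs' -
      ((reOmega i j k : ℂ) + imOmega i j k * Complex.I) * Complex.sin (θ l) ^ 2 * Complex.I_sq
  refine ⟨basisOfLinearIndependentOfCardEqFinrank hli (by simp), ?_, ?_, ?_, ?_, ?_, ?_⟩
  · intro i j
    rw [hb, hb, warpedMetric_apply]
    refine Fin.lastCases ?_ (fun i => ?_) i <;> refine Fin.lastCases ?_ (fun j => ?_) j
    · simp only [hF2, map_zero, if_true]
      rw [← hl]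
      field_simp
      simp
    · rw [if_neg (Fin.castSucc_lt_last j).ne', hF1, hF2]
      simp
    · rw [if_neg (Fin.castSucc_lt_last i).ne, hF1, hF2]
      simp
    · simp only [hF1, map_smul, LinearMap.smul_apply, heg, smul_eq_mul, Fin.castSucc_inj]
      rw [← hl]
      split_ifs <;> field_simp <;> simp
  · rw [← hvol]
    congr 1
    exact funext hb
  · intro i
    rw [hb]
    refine (congrArg (G l * ·) (hdr (F i))).trans ?_
    refine Fin.lastCases ?_ (fun i => ?_) i
    · rw [hF2]; simp [stdDr]; field_simp
    · rw [hF1]; simp [stdDr]; omega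
  · intro i j
    rw [hb, hb]
    refine (congrArg (fun z : ℝ => h l ^ 2 * z) (hω i j)).trans ?_
    field_simp
  · intro i j k
    rw [hb, hb, hb]
    have h1 := congrArg Complex.re (hP i j k)
    rw [re_add_mul_I_mul] at h1
    refine Eq.trans (b := h l ^ 3 * Real.cos (θ l) * (fromN s.Ω p ![F i, F j, F k]).re -
      h l ^ 3 * Real.sin (θ l) * (fromN s.Ω p ![F i, F j, F k]).im) rfl ?_
    simpa using h1
  · intro i j k
    rw [hb, hb, hb]
    have h1 := congrArg Complex.im (hP i j k)
    rw [im_add_mul_I_mul] at h1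
    refine Eq.trans (b := h l ^ 3 * Real.sin (θ l) * (fromN s.Ω p ![F i, F j, F k]).re +
      h l ^ 3 * Real.cos (θ l) * (fromN s.Ω p ![F i, F j, F k]).im) rfl ?_
    simpa using h1

end AdaptedFrame

/-! ### Star and contraction on the span of `w ∧ w` and `η ∧ Q`. -/

section AdaptedCombinations

variable {V : Type*} [AddCommGroup V] [Module ℝ V] [TopologicalSpace V]
  {f : Module.Basis (Fin 7) ℝ V} {g : V → V → ℝ} {vol : V [⋀^Fin 7]→L[ℝ] ℝ}
  {η : V [⋀^Fin 1]→L[ℝ] ℝ} {w : V [⋀^Fin 2]→L[ℝ] ℝ} {P Q : V [⋀^Fin 3]→L[ℝ] ℝ}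

theorem IsAdaptedBasis.hodgeStar_comb [FiniteDimensional ℝ V]
    (hf : IsAdaptedBasis f g vol η w P Q) (h : 4 + 3 = 7)
    (B : V →ₗ[ℝ] V →ₗ[ℝ] ℝ) (hB : ∀ u v, g u v = B u v) (c d : ℝ) :
    hodgeStar h g vol (c • wedge w w + d • oneWedge η Q) = (2 * c) • oneWedge η w - d • P := by
  have h1 := hf.hodgeStar_w_w h B hB
  have h2 := hf.hodgeStar_η_Q h B hB
  rw [hodgeStar_add, hodgeStar_smul, hodgeStar_smul, h1]
  refine (congrArg (fun T : V [⋀^Fin 3]→L[ℝ] ℝ => c • (2 : ℝ) • oneWedge η w + d • T) h2).trans ?_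
  module

theorem IsAdaptedBasis.sum_comb (hf : IsAdaptedBasis f g vol η w P Q) (c d c' d' : ℝ) :
    ∑ m : Fin 4 → Fin 7, (c • wedge w w + d • oneWedge η Q) (fun i => f (m i)) *
      (c' • wedge w w + d' • oneWedge η Q) (fun i => f (m i)) = 288 * (c * c') + 96 * (d * d') := by
  have h1 := hf.sum_w_w_w_w
  have h2 : ∑ m : Fin 4 → Fin 7, oneWedge η Q (fun i => f (m i)) * oneWedge η Q (fun i => f (m i)) =
    96 := hf.sum_η_Q_η_Q
  have h3 : ∑ m : Fin 4 → Fin 7, wedge w w (fun i => f (m i)) * oneWedge η Q (fun i => f (m i)) =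
    0 := hf.sum_w_w_η_Q
  have h4 : ∀ m : Fin 4 → Fin 7, (c • wedge w w + d • oneWedge η Q) (fun i => f (m i)) *
      (c' • wedge w w + d' • oneWedge η Q) (fun i => f (m i)) =
      (c * c') * (wedge w w (fun i => f (m i)) * wedge w w (fun i => f (m i))) +
      (d * d') * (oneWedge η Q (fun i => f (m i)) * oneWedge η Q (fun i => f (m i))) +
      (c * d' + d * c') * (wedge w w (fun i => f (m i)) * oneWedge η Q (fun i => f (m i))) := by
    intro m
    change (c * wedge w w (fun i => f (m i)) + d * oneWedge η Q (fun i => f (m i))) *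
      (c' * wedge w w (fun i => f (m i)) + d' * oneWedge η Q (fun i => f (m i))) = _
    ring
  rw [Finset.sum_congr rfl fun m _ => h4 m, Finset.sum_add_distrib, Finset.sum_add_distrib,
    ← Finset.mul_sum, ← Finset.mul_sum, ← Finset.mul_sum, h1, h2, h3]
  ring

end AdaptedCombinations

/-! ### Hodge star and torsion trace of warped 4-forms. -/

section WarpedStar

theorem wedge_two_smul_smul {V : Type*} [AddCommGroup V] [Module ℝ V] [TopologicalSpace V]
    (c : ℝ) (w : V [⋀^Fin 2]→L[ℝ] ℝ) : wedge (c • w) (c • w) = (c ^ 2) • wedge w w := by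
  ext v
  change wedge (c • w) (c • w) v = c ^ 2 * wedge w w v
  refine (wedge_two_two_apply _ v).trans ?_
  rw [wedge_two_two_apply]
  simp only [ContinuousAlternatingMap.smul_apply, smul_eq_mul]
  ring

variable {N : Type*} [TopologicalSpace N] [ChartedSpace E6 N] [IsManifold (𝓡 6) (⊤ : ℕ∞) N]
  {L : Type*} [TopologicalSpace L] [ChartedSpace ℝ L] [IsManifold 𝓘(ℝ, ℝ) (⊤ : ℕ∞) L]
  {s : SU3Structure N} {dr : DForm 𝓘(ℝ, ℝ) L ℝ 1} {G h θ : L → ℝ} {p : N × L}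

theorem exists_isAdaptedBasis_tangentSpace (s : SU3Structure N) {dr : DForm 𝓘(ℝ, ℝ) L ℝ 1}
    (hdr0 : ∀ l, dr l ≠ 0) {G h : L → ℝ} (θ : L → ℝ) {p : N × L} (hG : G p.2 ≠ 0)
    (hh : h p.2 ≠ 0) :
    ∃ f : Module.Basis (Fin 7) ℝ (TangentSpace I7 p), IsAdaptedBasis f
      (warpedMetric s dr G h p) (warpedVol s dr G h p) (G p.2 • fromL dr p)
      (h p.2 ^ 2 • fromN s.ω p)
      ((h p.2 ^ 3 * Real.cos (θ p.2)) • fromN s.reΩ p -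
        (h p.2 ^ 3 * Real.sin (θ p.2)) • fromN s.imΩ p)
      ((h p.2 ^ 3 * Real.sin (θ p.2)) • fromN s.reΩ p +
        (h p.2 ^ 3 * Real.cos (θ p.2)) • fromN s.imΩ p) :=
  exists_isAdaptedBasis s hdr0 θ hG hh

/-- The hypotheses single out the 4-forms with no `dr ∧ Re (F³ Ω)` component. Both `ψ` and `dφ` (in
the co-closed case) are of this kind. -/
theorem warpedFourForm_eq_comb {u v w : L → ℝ} {c d : ℝ} (hu : u p.2 = c * h p.2 ^ 4)
    (hv : v p.2 = d * (G p.2 * (h p.2 ^ 3 * Real.sin (θ p.2))))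
    (hw : w p.2 = d * (G p.2 * (h p.2 ^ 3 * Real.cos (θ p.2)))) :
    warpedFourForm s dr u v w p =
      c • wedge (h p.2 ^ 2 • fromN s.ω p) (h p.2 ^ 2 • fromN s.ω p) +
      d • oneWedge (G p.2 • fromL dr p) ((h p.2 ^ 3 * Real.sin (θ p.2)) • fromN s.reΩ p +
        (h p.2 ^ 3 * Real.cos (θ p.2)) • fromN s.imΩ p) := by
  have h2 : wedge (fromN s.ω p) (fromN s.ω p) = fromN s.ωSq p :=
    (wedge_compContinuousLinearMap _ _ _).symm
  have h3 : warpedFourForm s dr u v w p = u p.2 • fromN s.ωSq p +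
    v p.2 • oneWedge (fromL dr p) (fromN s.reΩ p) + w p.2 • oneWedge (fromL dr p) (fromN s.imΩ p) :=
    rfl
  rw [h3, wedge_two_smul_smul, h2, oneWedge_smul_left, oneWedge_add_right, oneWedge_smul_right,
    oneWedge_smul_right, hu, hv, hw]
  module

theorem starForm_warpedFourForm (hdr0 : ∀ l, dr l ≠ 0) (hG : G p.2 ≠ 0) (hh : h p.2 ≠ 0)
    {u v w u' v' w' : L → ℝ} {c d : ℝ} (hu : u p.2 = c * h p.2 ^ 4)
    (hv : v p.2 = d * (G p.2 * (h p.2 ^ 3 * Real.sin (θ p.2))))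
    (hw : w p.2 = d * (G p.2 * (h p.2 ^ 3 * Real.cos (θ p.2))))
    (hu' : u' p.2 = -d * (h p.2 ^ 3 * Real.cos (θ p.2)))
    (hv' : v' p.2 = d * (h p.2 ^ 3 * Real.sin (θ p.2)))
    (hw' : w' p.2 = 2 * c * (G p.2 * h p.2 ^ 2)) (h7 : 4 + 3 = 7) :
    starForm h7 (warpedMetric s dr G h) (warpedVol s dr G h) (warpedFourForm s dr u v w) p =
      warpedThreeForm s dr u' v' w' p := by
  obtain ⟨f, hf⟩ := exists_isAdaptedBasis_tangentSpace s hdr0 θ hG hh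
  have h1 := hf.hodgeStar_comb h7 (warpedBilin s dr G h p)
    (warpedMetric_eq_bilin s dr G h p) c d
  have h3 : warpedThreeForm s dr u' v' w' p = u' p.2 • fromN s.reΩ p +
    v' p.2 • fromN s.imΩ p + w' p.2 • oneWedge (fromL dr p) (fromN s.ω p) := rfl
  rw [starForm, warpedFourForm_eq_comb hu hv hw]
  refine h1.trans ?_
  rw [h3, oneWedge_smul_left, oneWedge_smul_right, hu', hv', hw']
  module

/-- `ψ` has the coefficients `1/2` and `-1`, so the trace is `(288 · c/2 - 96 · d) / 96`. -/
theorem warpedTraceTorsion_eq_of_extD (hdr : dr.IsSmooth) (hdr0 : ∀ l, dr l ≠ 0)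
    (hG : G p.2 ≠ 0) (hh : h p.2 ≠ 0)
    (hGd : MDifferentiableAt 𝓘(ℝ, ℝ) 𝓘(ℝ, ℝ) G p.2) (hhd : MDifferentiableAt 𝓘(ℝ, ℝ) 𝓘(ℝ, ℝ) h p.2)
    (hθd : MDifferentiableAt 𝓘(ℝ, ℝ) 𝓘(ℝ, ℝ) θ p.2)
    {u v w : L → ℝ} {c d : ℝ} (hu : u p.2 = c * h p.2 ^ 4)
    (hv : v p.2 = d * (G p.2 * (h p.2 ^ 3 * Real.sin (θ p.2))))
    (hw : w p.2 = d * (G p.2 * (h p.2 ^ 3 * Real.cos (θ p.2))))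
    (hφ : extD (warpedPhi s dr G h θ) p = warpedFourForm s dr u v w p) :
    warpedTraceTorsion s dr G h θ p = 3 / 2 * c - d := by
  obtain ⟨f, hf⟩ := exists_isAdaptedBasis_tangentSpace s hdr0 θ hG hh
  have hd : (warpedPhi s dr G h θ).DiffAt p := by
    rw [warpedPhi_eq]
    have H1 := hGd.hasRDerivAt hdr0
    have H2 := hhd.hasRDerivAt hdr0
    have H3 := hθd.hasRDerivAt hdr0
    exact diffAt_warpedThreeForm hdr ((H2.pow 3).mul H3.cos).mdifferentiableAt
      ((H2.pow 3).mul H3.sin).neg.mdifferentiableAt (H1.mul (H2.pow 2)).mdifferentiableAt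
  have h1 := traceTorsion_eq (warpedMetric_symm s dr G h) (ψ := warpedPsi s dr G h θ) hd
    (warpedBilin s dr G h p) (warpedMetric_eq_bilin s dr G h p) f hf.gram
  have h2 : warpedPsi s dr G h θ p = _ := (congrFun (warpedPsi_eq s dr G h θ) p).trans
    (warpedFourForm_eq_comb (G := G) (h := h) (θ := θ) (c := 1 / 2) (d := -1) (by ring) (by ring)
      (by ring))
  refine h1.trans ?_
  have h3 := hf.sum_comb c d (1 / 2) (-1)
  rw [hφ, h2, warpedFourForm_eq_comb hu hv hw]
  refine (congrArg (fun x : ℝ => 1 / 96 * x) h3).trans ?_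
  ring

end WarpedStar

/-! ### Reading off the coefficients of a warped 4-form. -/

section Evaluation

variable {N : Type*} [TopologicalSpace N] [ChartedSpace E6 N] [IsManifold (𝓡 6) (⊤ : ℕ∞) N]
  {L : Type*} [TopologicalSpace L] [ChartedSpace ℝ L] [IsManifold 𝓘(ℝ, ℝ) (⊤ : ℕ∞) L]

theorem oneWedge_fromL_cons_apply {k : ℕ} (dr : DForm 𝓘(ℝ, ℝ) L ℝ 1) (η : DForm (𝓡 6) N ℝ k)
    (p : N × L) (e : Fin k → E6) :
    oneWedge (fromL dr p) (fromN η p) (Matrix.vecCons ((0 : E6), (1 : ℝ)) fun i => (e i, (0 : ℝ))) =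
      lineCoeff dr p.2 * η p.1 e := by
  refine (oneWedge_apply _ _ _).trans ?_
  have hdr : ∀ u : E6 × ℝ, (fromL dr : DForm I7 (N × L) ℝ 1) p (fun _ => u) =
      u.2 * lineCoeff dr p.2 := fun u =>
    (fromL_apply dr p fun _ => u).trans (lineForm_apply dr p.2 fun _ => u.2)
  rw [Fin.sum_univ_succ, Finset.sum_eq_zero, add_zero]
  · have h1 := hdr (0, 1)
    have h2 : fromN η p (fun j : Fin k => (e j, (0 : ℝ))) = η p.1 e := fromN_apply η p _
    have h3 : (-1 : ℝ) ^ ((0 : Fin (k + 1)) : ℕ) = 1 := by simp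
    refine (congrArg₂ (fun a b : ℝ => (-1 : ℝ) ^ ((0 : Fin (k + 1)) : ℕ) * (a * b)) h1 h2).trans ?_
    rw [h3]
    ring
  · intro i _
    have h1 := hdr (e i, 0)
    refine (congrArg (fun a : ℝ => (-1 : ℝ) ^ (i.succ : ℕ) * (a * _)) h1).trans ?_
    ring

theorem oneWedge_fromL_apply_of_snd {k : ℕ} (dr : DForm 𝓘(ℝ, ℝ) L ℝ 1) (η : DForm (𝓡 6) N ℝ k)
    (p : N × L) (e : Fin (k + 1) → E6) :
    oneWedge (fromL dr p) (fromN η p) (fun i => (e i, (0 : ℝ))) = 0 := by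
  refine (oneWedge_apply _ _ _).trans (Finset.sum_eq_zero fun i _ => ?_)
  have h1 : (fromL dr : DForm I7 (N × L) ℝ 1) p (fun _ => (e i, (0 : ℝ))) =
      (0 : ℝ) * lineCoeff dr p.2 :=
    (fromL_apply dr p fun _ => (e i, (0 : ℝ))).trans (lineForm_apply dr p.2 fun _ => 0)
  refine (congrArg (fun a : ℝ => (-1 : ℝ) ^ (i : ℕ) * (a * _)) h1).trans ?_
  ring

/-- In a unitary frame with `Ω e = 1`, the vectors `x₁, y₁, x₂, y₂` detect `ω²`, the triple `x₁, x₂,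
x₃` detects `Re Ω` alone and `y₁, x₂, x₃` detects `Im Ω` alone. -/
theorem SU3Structure.exists_eval (s : SU3Structure N) (x : N) :
    (∃ e, s.ωSq x e = 2) ∧ (∃ e, s.reΩ x e = 1 ∧ s.imΩ x e = 0) ∧
      ∃ e, s.reΩ x e = 0 ∧ s.imΩ x e = 1 := by
  obtain ⟨e, -, -, heω, heΩ⟩ := s.exists_frame x 1 (by simp)
  have h1 := heΩ 0 2 4
  have h2 := heΩ 1 2 4
  have r1 : reOmega 0 2 4 = 1 := by decide
  have r2 : imOmega 0 2 4 = 0 := by decide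
  have r3 : reOmega 1 2 4 = 0 := by decide
  have r4 : imOmega 1 2 4 = 1 := by decide
  refine ⟨⟨![e 0, e 1, e 2, e 3], ?_⟩, ⟨![e 0, e 2, e 4], ?_, ?_⟩, ⟨![e 1, e 2, e 4], ?_, ?_⟩⟩
  · refine (wedge_two_two_apply (s.ω x) ![e 0, e 1, e 2, e 3]).trans ?_
    have w1 := heω 0 1
    have w2 := heω 2 3
    have w3 := heω 0 2
    have w4 := heω 0 3
    have q1 : stdOmega 0 1 = 1 := by decide
    have q2 : stdOmega 2 3 = 1 := by decide
    have q3 : stdOmega 0 2 = 0 := by decide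
    have q4 : stdOmega 0 3 = 0 := by decide
    refine (show _ = 2 * ((stdOmega 0 1 : ℝ) * stdOmega 2 3 - stdOmega 0 2 * stdOmega 1 3 +
      stdOmega 0 3 * stdOmega 1 2) from ?_).trans (by rw [q1, q2, q3, q4]; norm_num)
    have w5 := heω 1 3
    have w6 := heω 1 2
    exact congrArg (fun z : ℝ => 2 * z) (congrArg₂ (fun a b : ℝ => a + b)
      (congrArg₂ (fun a b : ℝ => a - b) (congrArg₂ (fun a b : ℝ => a * b) w1 w2)
        (congrArg₂ (fun a b : ℝ => a * b) w3 w5)) (congrArg₂ (fun a b : ℝ => a * b) w4 w6))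
  · exact (congrArg Complex.re h1).trans (by simp [r1, r2])
  · exact (congrArg Complex.im h1).trans (by simp [r1, r2])
  · exact (congrArg Complex.re h2).trans (by simp [r3, r4])
  · exact (congrArg Complex.im h2).trans (by simp [r3, r4])

theorem warpedFourForm_apply (s : SU3Structure N) (dr : DForm 𝓘(ℝ, ℝ) L ℝ 1) (u v w : L → ℝ)
    (p : N × L) (z : Fin 4 → TangentSpace I7 p) : warpedFourForm s dr u v w p z =
      u p.2 * fromN s.ωSq p z + v p.2 * oneWedge (fromL dr p) (fromN s.reΩ p) z +
        w p.2 * oneWedge (fromL dr p) (fromN s.imΩ p) z :=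
  rfl

/-- Tangent vectors that read off the three coefficients of a warped 4-form. -/
theorem exists_eval_warpedFourForm (s : SU3Structure N) {dr : DForm 𝓘(ℝ, ℝ) L ℝ 1}
    (hdr0 : ∀ l, dr l ≠ 0) (p : N × L) :
    ∃ c : ℝ, c ≠ 0 ∧ ∃ z₁ z₂ z₃ : Fin 4 → TangentSpace I7 p, ∀ u v w : L → ℝ,
      warpedFourForm s dr u v w p z₁ = u p.2 * 2 ∧ warpedFourForm s dr u v w p z₂ = v p.2 * c ∧
        warpedFourForm s dr u v w p z₃ = w p.2 * c := by
  obtain ⟨⟨e₁, h₁⟩, ⟨e₂, h₂, h₂'⟩, ⟨e₃, h₃, h₃'⟩⟩ := s.exists_eval p.1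
  refine ⟨lineCoeff dr p.2, lineCoeff_ne_zero (hdr0 _), fun i => (e₁ i, (0 : ℝ)),
    Matrix.vecCons ((0 : E6), (1 : ℝ)) fun i => (e₂ i, (0 : ℝ)),
    Matrix.vecCons ((0 : E6), (1 : ℝ)) fun i => (e₃ i, (0 : ℝ)), fun u v w => ⟨?_, ?_, ?_⟩⟩
  · refine (warpedFourForm_apply s dr u v w p _).trans ?_
    have a1 : fromN s.ωSq p (fun i : Fin 4 => (e₁ i, (0 : ℝ))) = 2 := (fromN_apply s.ωSq p _).trans h₁
    have a2 := oneWedge_fromL_apply_of_snd dr s.reΩ p e₁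
    have a3 := oneWedge_fromL_apply_of_snd dr s.imΩ p e₁
    refine (congrArg₂ (fun x y : ℝ => x + y) (congrArg₂ (fun x y : ℝ => u p.2 * x + v p.2 * y) a1 a2)
      (congrArg (fun x : ℝ => w p.2 * x) a3)).trans ?_
    ring
  · refine (warpedFourForm_apply s dr u v w p _).trans ?_
    have a1 : fromN s.ωSq p (Matrix.vecCons ((0 : E6), (1 : ℝ)) fun i => (e₂ i, (0 : ℝ))) = 0 :=
      fromN_eq_zero s.ωSq p (a := 0) rfl
    have a2 := (oneWedge_fromL_cons_apply dr s.reΩ p e₂).trans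
      (congrArg (fun x : ℝ => lineCoeff dr p.2 * x) h₂)
    have a3 := (oneWedge_fromL_cons_apply dr s.imΩ p e₂).trans
      (congrArg (fun x : ℝ => lineCoeff dr p.2 * x) h₂')
    refine (congrArg₂ (fun x y : ℝ => x + y) (congrArg₂ (fun x y : ℝ => u p.2 * x + v p.2 * y) a1 a2)
      (congrArg (fun x : ℝ => w p.2 * x) a3)).trans ?_
    ring
  · refine (warpedFourForm_apply s dr u v w p _).trans ?_
    have a1 : fromN s.ωSq p (Matrix.vecCons ((0 : E6), (1 : ℝ)) fun i => (e₃ i, (0 : ℝ))) = 0 :=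
      fromN_eq_zero s.ωSq p (a := 0) rfl
    have a2 := (oneWedge_fromL_cons_apply dr s.reΩ p e₃).trans
      (congrArg (fun x : ℝ => lineCoeff dr p.2 * x) h₃)
    have a3 := (oneWedge_fromL_cons_apply dr s.imΩ p e₃).trans
      (congrArg (fun x : ℝ => lineCoeff dr p.2 * x) h₃')
    refine (congrArg₂ (fun x y : ℝ => x + y) (congrArg₂ (fun x y : ℝ => u p.2 * x + v p.2 * y) a1 a2)
      (congrArg (fun x : ℝ => w p.2 * x) a3)).trans ?_
    ring

theorem oneWedge_fromL_ωSq_ne_zero (s : SU3Structure N) {dr : DForm 𝓘(ℝ, ℝ) L ℝ 1}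
    (hdr0 : ∀ l, dr l ≠ 0) (p : N × L) : oneWedge (fromL dr p) (fromN s.ωSq p) ≠ 0 := by
  obtain ⟨⟨e, he⟩, -⟩ := s.exists_eval p.1
  intro h0
  have h1 := (oneWedge_fromL_cons_apply dr s.ωSq p e).trans
    (congrArg (fun x : ℝ => lineCoeff dr p.2 * x) he)
  rw [h0] at h1
  exact mul_ne_zero (lineCoeff_ne_zero (hdr0 p.2)) two_ne_zero h1.symm

end Evaluation

/-! ### Consequences of co-closedness: `γ = 0`, `dφ` and the trace of the torsion. -/

section Coclosed

variable {N : Type*} [TopologicalSpace N] [ChartedSpace E6 N] [IsManifold (𝓡 6) (⊤ : ℕ∞) N]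
  {L : Type*} [TopologicalSpace L] [ChartedSpace ℝ L] [IsManifold 𝓘(ℝ, ℝ) (⊤ : ℕ∞) L]

/-- The data of a co-closed warped `G₂`-structure with smooth parameters. -/
structure IsCoclosedWarped (s : SU3Structure N) (lam : ℝ) (dr : DForm 𝓘(ℝ, ℝ) L ℝ 1)
    (G h θ : L → ℝ) : Prop where
  su3 : s.IsCalabiYauOrNearlyKahler lam
  smooth_dr : dr.IsSmooth
  dr_ne : ∀ l, dr l ≠ 0
  smooth_G : ContMDiff 𝓘(ℝ, ℝ) 𝓘(ℝ, ℝ) (⊤ : ℕ∞) G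
  smooth_h : ContMDiff 𝓘(ℝ, ℝ) 𝓘(ℝ, ℝ) (⊤ : ℕ∞) h
  smooth_θ : ContMDiff 𝓘(ℝ, ℝ) 𝓘(ℝ, ℝ) (⊤ : ℕ∞) θ
  G_ne : ∀ l, G l ≠ 0
  h_ne : ∀ l, h l ≠ 0
  coclosed : ∀ p : N × L, extD (warpedPsi s dr G h θ) p = 0

namespace IsCoclosedWarped

variable {s : SU3Structure N} {lam : ℝ} {dr : DForm 𝓘(ℝ, ℝ) L ℝ 1} {G h θ : L → ℝ}

theorem hasRDerivAt_G (H : IsCoclosedWarped s lam dr G h θ) (l : L) :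
    HasRDerivAt dr G (rDeriv dr G l) l :=
  (H.smooth_G.mdifferentiable (by simp) l).hasRDerivAt H.dr_ne

theorem hasRDerivAt_θ (H : IsCoclosedWarped s lam dr G h θ) (l : L) :
    HasRDerivAt dr θ (G l * torsionAlpha dr G θ l) l := by
  have h1 := (H.smooth_θ.mdifferentiable (by simp) l).hasRDerivAt H.dr_ne
  rwa [torsionAlpha, mul_div_cancel₀ _ (H.G_ne l)]

/-- `dψ` equals `2h³ (h' + λ G cos θ) dr ∧ ω²`, and `dr ∧ ω²` vanishes nowhere. A point of `N` is
needed to evaluate it. -/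
theorem rDeriv_h [Nonempty N] (H : IsCoclosedWarped s lam dr G h θ) (l : L) :
    rDeriv dr h l = -(lam * G l * Real.cos (θ l)) := by
  obtain ⟨x⟩ := ‹Nonempty N›
  have hG := H.hasRDerivAt_G
  have hh := fun l => (H.smooth_h.mdifferentiable (by simp) l).hasRDerivAt H.dr_ne
  have hθ := H.hasRDerivAt_θ
  have hu := fun l => ((hh l).pow 4).const_mul (1 / 2)
  have h1 := H.coclosed (x, l)
  have h2 : (fun l => h l ^ 4 / 2) = fun l => 1 / 2 * h l ^ 4 := by funext l; ring
  rw [warpedPsi_eq, extD_warpedFourForm H.su3 H.smooth_dr H.dr_ne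
    (by rw [h2]; exact fun l => (hu l).mdifferentiableAt)
    (fun l => ((hG l).mul (((hh l).pow 3).mul (hθ l).sin)).neg.mdifferentiableAt)
    (fun l => ((hG l).mul (((hh l).pow 3).mul (hθ l).cos)).neg.mdifferentiableAt)] at h1
  have h3 := (smul_eq_zero.1 h1).resolve_right (oneWedge_fromL_ωSq_ne_zero s H.dr_ne (x, l))
  have h4 : rDeriv dr (fun l => h l ^ 4 / 2) l = 1 / 2 * (4 * h l ^ 3 * rDeriv dr h l) := by
    rw [h2, (hu l).rDeriv_eq (H.dr_ne l)]; norm_num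
  simp only [h4] at h3
  have h5 : (2 * h l ^ 3) * (rDeriv dr h l + lam * G l * Real.cos (θ l)) = 0 := by
    linear_combination h3
  have h6 := (mul_eq_zero.1 h5).resolve_left (mul_ne_zero two_ne_zero (pow_ne_zero 3 (H.h_ne l)))
  linear_combination h6

theorem torsionGamma_eq_zero [Nonempty N] (H : IsCoclosedWarped s lam dr G h θ) (l : L) :
    torsionGamma lam dr G h θ l = 0 := by
  have := H.h_ne l
  rw [torsionGamma, H.rDeriv_h]
  field_simp
  ring

theorem hasRDerivAt_h [Nonempty N] (H : IsCoclosedWarped s lam dr G h θ) (l : L) :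
    HasRDerivAt dr h (-(lam * G l * Real.cos (θ l))) l := by
  rw [← H.rDeriv_h]
  exact (H.smooth_h.mdifferentiable (by simp) l).hasRDerivAt H.dr_ne

theorem hasRDerivAt_alpha (H : IsCoclosedWarped s lam dr G h θ) (l : L) :
    HasRDerivAt dr (torsionAlpha dr G θ) (rDeriv dr (torsionAlpha dr G θ) l) l := by
  have h1 := ((contMDiff_rDeriv H.smooth_dr H.dr_ne H.smooth_θ).mdifferentiable (by simp) l).hasRDerivAt
    H.dr_ne
  have h2 := h1.mul ((H.hasRDerivAt_G l).inv (H.G_ne l))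
  exact h2.mdifferentiableAt.hasRDerivAt H.dr_ne

/-- Substituting `h' = -λ G cos θ` makes both terms of the product rule multiples of `λ h⁻¹ cos θ ·
G`. The factor `α + β` is the denominator in the evolution of `β`. -/
theorem hasRDerivAt_beta [Nonempty N] (H : IsCoclosedWarped s lam dr G h θ) (l : L) :
    HasRDerivAt dr (torsionBeta lam h θ) (lam * (h l)⁻¹ * Real.cos (θ l) * G l *
      (torsionAlpha dr G θ l + torsionBeta lam h θ l)) l := by
  have h1 := (((H.hasRDerivAt_h l).inv (H.h_ne l)).const_mul lam).mul (H.hasRDerivAt_θ l).sin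
  have := H.h_ne l
  have h2 : lam * (h l)⁻¹ * Real.cos (θ l) * G l *
      (torsionAlpha dr G θ l + torsionBeta lam h θ l) =
      lam * (-(h l ^ 2)⁻¹ * -(lam * G l * Real.cos (θ l))) * Real.sin (θ l) +
        lam * (h l)⁻¹ * (Real.cos (θ l) * (G l * torsionAlpha dr G θ l)) := by
    rw [torsionBeta]
    field_simp
    ring
  rw [h2]
  exact h1

theorem mul_torsionBeta (H : IsCoclosedWarped s lam dr G h θ) (l : L) :
    torsionBeta lam h θ l * h l = lam * Real.sin (θ l) := by
  have := H.h_ne l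
  rw [torsionBeta]
  field_simp

theorem hasRDerivAt_re [Nonempty N] (H : IsCoclosedWarped s lam dr G h θ) (l : L) :
    HasRDerivAt dr (fun l => h l ^ 3 * Real.cos (θ l))
      (3 * h l ^ 2 * (-(lam * G l * Real.cos (θ l))) * Real.cos (θ l) -
        h l ^ 3 * Real.sin (θ l) * (G l * torsionAlpha dr G θ l)) l := by
  convert ((H.hasRDerivAt_h l).pow 3).mul (H.hasRDerivAt_θ l).cos using 1
  norm_num
  ring

theorem hasRDerivAt_im [Nonempty N] (H : IsCoclosedWarped s lam dr G h θ) (l : L) :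
    HasRDerivAt dr (fun l => h l ^ 3 * Real.sin (θ l))
      (3 * h l ^ 2 * (-(lam * G l * Real.cos (θ l))) * Real.sin (θ l) +
        h l ^ 3 * Real.cos (θ l) * (G l * torsionAlpha dr G θ l)) l := by
  convert ((H.hasRDerivAt_h l).pow 3).mul (H.hasRDerivAt_θ l).sin using 1
  norm_num
  ring

/-- With `h'` eliminated, `dφ = -2β w ∧ w + (3β - α) η ∧ Q`. The `dr ∧ Re (F³ Ω)` component cancels,
so `dφ` has the shape on which the star is known. -/
theorem extD_warpedPhi [Nonempty N] (H : IsCoclosedWarped s lam dr G h θ) :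
    extD (warpedPhi s dr G h θ) = warpedFourForm s dr
      (fun l => -2 * torsionBeta lam h θ l * h l ^ 4)
      (fun l => (-torsionAlpha dr G θ l + 3 * torsionBeta lam h θ l) *
        (G l * (h l ^ 3 * Real.sin (θ l))))
      (fun l => (-torsionAlpha dr G θ l + 3 * torsionBeta lam h θ l) *
        (G l * (h l ^ 3 * Real.cos (θ l)))) := by
  have hre := H.hasRDerivAt_re
  have him := fun l => (H.hasRDerivAt_im l).neg
  have hw := fun l => (H.hasRDerivAt_G l).mul ((H.hasRDerivAt_h l).pow 2)
  rw [warpedPhi_eq, extD_warpedThreeForm H.su3 H.smooth_dr H.dr_ne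
    (fun l => (hre l).mdifferentiableAt) (fun l => (him l).mdifferentiableAt)
    (fun l => (hw l).mdifferentiableAt)]
  congr 1
  · funext l
    linear_combination (2 * h l ^ 3) * H.mul_torsionBeta l
  · funext l
    rw [(hre l).rDeriv_eq (H.dr_ne l)]
    linear_combination (-3 * G l * h l ^ 2 * Real.sin (θ l)) * H.mul_torsionBeta l -
      (3 * lam * G l * h l ^ 2) * Real.sin_sq_add_cos_sq (θ l)
  · funext l
    rw [(him l).rDeriv_eq (H.dr_ne l)]
    linear_combination (-3 * G l * h l ^ 2 * Real.cos (θ l)) * H.mul_torsionBeta l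

theorem traceTorsion_eq [Nonempty N] (H : IsCoclosedWarped s lam dr G h θ) (p : N × L) :
    warpedTraceTorsion s dr G h θ p =
      torsionAlpha dr G θ p.2 - 6 * torsionBeta lam h θ p.2 := by
  rw [warpedTraceTorsion_eq_of_extD H.smooth_dr H.dr_ne (H.G_ne _) (H.h_ne _)
    (H.hasRDerivAt_G _).mdifferentiableAt (H.smooth_h.mdifferentiable (by simp) _)
    (H.hasRDerivAt_θ _).mdifferentiableAt rfl rfl rfl (congrFun H.extD_warpedPhi p)]
  ring

end IsCoclosedWarped

end Coclosed

/-! ### The right-hand side of the modified coflow in closed form. -/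

section CoflowRHS

variable {N : Type*} [TopologicalSpace N] [ChartedSpace E6 N] [IsManifold (𝓡 6) (⊤ : ℕ∞) N]
  {L : Type*} [TopologicalSpace L] [ChartedSpace ℝ L] [IsManifold 𝓘(ℝ, ℝ) (⊤ : ℕ∞) L]

theorem extD_zero {E : Type*} [NormedAddCommGroup E] [NormedSpace ℝ E]
    {H : Type*} [TopologicalSpace H] {I : ModelWithCorners ℝ E H} [I.Boundaryless]
    {M : Type*} [TopologicalSpace M] [ChartedSpace H M] [IsManifold I 1 M]
    {F : Type*} [NormedAddCommGroup F] [NormedSpace ℝ F] {k : ℕ} :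
    extD (0 : DForm I M F k) = 0 := by
  funext x
  refine ContinuousAlternatingMap.ext fun (v : Fin (k + 1) → E) => ?_
  refine (extD_apply _ x v).trans ?_
  have h1 : (0 : DForm I M F k).inChart x = fun _ => 0 := by
    funext y
    ext w
    rfl
  rw [h1, extDeriv, fderiv_fun_const, ContinuousAlternatingMap.alternatizeUncurryFin_apply]
  exact Finset.sum_eq_zero fun i _ => smul_zero _

theorem codiff_zero {E : Type*} [NormedAddCommGroup E] [NormedSpace ℝ E] [FiniteDimensional ℝ E]
    {H : Type*} [TopologicalSpace H] {I : ModelWithCorners ℝ E H} [I.Boundaryless]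
    {M : Type*} [TopologicalSpace M] [ChartedSpace H M] [IsManifold I 1 M]
    {k l n : ℕ} (h : k + 1 + l = n) (g : BilinField I M) (vol : DForm I M ℝ n) :
    codiff h g vol 0 = 0 := by
  have h1 : ∀ {k l n : ℕ} (h : k + l = n) (vol : DForm I M ℝ n), starForm h g vol 0 = 0 :=
    fun h vol => funext fun x => hodgeStar_zero h (g x) (vol x)
  rw [codiff, h1, extD_zero, h1, smul_zero]

theorem codiff_of_even {E : Type*} [NormedAddCommGroup E] [NormedSpace ℝ E] [FiniteDimensional ℝ E]
    {H : Type*} [TopologicalSpace H] {I : ModelWithCorners ℝ E H}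
    {M : Type*} [TopologicalSpace M] [ChartedSpace H M]
    {k l n : ℕ} (h : k + 1 + l = n) (h' : l + 1 + k = n) (he : Even (n * (k + 2) + 1))
    (g : BilinField I M) (vol : DForm I M ℝ n) (β : DForm I M ℝ (k + 1)) :
    codiff h g vol β = starForm h' g vol (extD (starForm h g vol β)) := by
  rw [codiff, he.neg_one_pow, one_smul]

namespace IsCoclosedWarped

variable {s : SU3Structure N} {lam : ℝ} {dr : DForm 𝓘(ℝ, ℝ) L ℝ 1} {G h θ : L → ℝ}

theorem starForm_warpedPsi (H : IsCoclosedWarped s lam dr G h θ) (h7 : 4 + 3 = 7) :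
    starForm h7 (warpedMetric s dr G h) (warpedVol s dr G h) (warpedPsi s dr G h θ) =
      warpedPhi s dr G h θ := by
  funext p
  rw [warpedPsi_eq, warpedPhi_eq]
  exact starForm_warpedFourForm (θ := θ) (c := 1 / 2) (d := -1) H.dr_ne (H.G_ne _) (H.h_ne _)
    (by ring) (by ring) (by ring) (by ring) (by ring) (by ring) h7

theorem starForm_extD_warpedPhi [Nonempty N] (H : IsCoclosedWarped s lam dr G h θ)
    (h7 : 4 + 3 = 7) :
    starForm h7 (warpedMetric s dr G h) (warpedVol s dr G h) (extD (warpedPhi s dr G h θ)) =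
      warpedThreeForm s dr
        (fun l => (torsionAlpha dr G θ l - 3 * torsionBeta lam h θ l) *
          (h l ^ 3 * Real.cos (θ l)))
        (fun l => (torsionAlpha dr G θ l - 3 * torsionBeta lam h θ l) *
          -(h l ^ 3 * Real.sin (θ l)))
        (fun l => -4 * torsionBeta lam h θ l * (G l * h l ^ 2)) := by
  funext p
  rw [H.extD_warpedPhi]
  exact starForm_warpedFourForm (θ := θ) H.dr_ne (H.G_ne _) (H.h_ne _) rfl rfl rfl
    (by ring) (by ring) (by ring) h7

/-- Since `dψ = 0` only `d d*` contributes, and `⋆ψ = φ` turns it into `d ⋆ dφ`. -/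
theorem hodgeLaplacian_warpedPsi [Nonempty N] (H : IsCoclosedWarped s lam dr G h θ) :
    hodgeLaplacian (k := 3) (l := 2) (n := 7) rfl (warpedMetric s dr G h) (warpedVol s dr G h)
        (warpedPsi s dr G h θ) =
      extD (warpedThreeForm s dr
        (fun l => (torsionAlpha dr G θ l - 3 * torsionBeta lam h θ l) *
          (h l ^ 3 * Real.cos (θ l)))
        (fun l => (torsionAlpha dr G θ l - 3 * torsionBeta lam h θ l) *
          -(h l ^ 3 * Real.sin (θ l)))
        (fun l => -4 * torsionBeta lam h θ l * (G l * h l ^ 2))) := by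
  have h0 : extD (warpedPsi s dr G h θ) = 0 := funext H.coclosed
  have h1 : starForm (k := 4) (l := 3) (n := 7) rfl (warpedMetric s dr G h)
      (warpedVol s dr G h) (warpedPsi s dr G h θ) = warpedPhi s dr G h θ :=
    H.starForm_warpedPsi rfl
  rw [hodgeLaplacian, h0, codiff_zero, add_zero]
  -- The sign exponent of `d*` on 4-forms in dimension 7 is `7 · 5 + 1 = 36`.
  refine congrArg extD ((codiff_of_even (k := 3) (l := 3) (n := 7) rfl rfl (by decide) _ _ _).trans ?_)
  refine (congrArg (fun η => starForm (k := 4) (l := 3) (n := 7) rfl (warpedMetric s dr G h)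
    (warpedVol s dr G h) (extD η)) h1).trans ?_
  exact H.starForm_extD_warpedPhi rfl

end IsCoclosedWarped

theorem warpedFourForm_add_smul (s : SU3Structure N) (dr : DForm 𝓘(ℝ, ℝ) L ℝ 1)
    (u v w u' v' w' : L → ℝ) (k : ℝ) :
    warpedFourForm s dr u v w + k • warpedFourForm s dr u' v' w' =
      warpedFourForm s dr (fun l => u l + k * u' l) (fun l => v l + k * v' l)
        (fun l => w l + k * w' l) := by
  funext p
  refine ContinuousAlternatingMap.ext fun z => ?_
  refine (show _ = warpedFourForm s dr u v w p z + k * warpedFourForm s dr u' v' w' p z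
    from rfl).trans ?_
  simp only [warpedFourForm_apply]
  ring

theorem smul_warpedThreeForm (s : SU3Structure N) (dr : DForm 𝓘(ℝ, ℝ) L ℝ 1)
    (a u v w : L → ℝ) :
    (fun p : N × L => a p.2 • warpedThreeForm s dr u v w p) =
      warpedThreeForm s dr (fun l => a l * u l) (fun l => a l * v l) (fun l => a l * w l) := by
  funext p
  refine ContinuousAlternatingMap.ext fun z => ?_
  have h3 : ∀ u v w : L → ℝ, warpedThreeForm s dr u v w p z = u p.2 * fromN s.reΩ p z +
      v p.2 * fromN s.imΩ p z + w p.2 * oneWedge (fromL dr p) (fromN s.ω p) z := fun u v w => rfl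
  refine (show _ = a p.2 * warpedThreeForm s dr u v w p z from rfl).trans ?_
  rw [h3, h3]
  ring

theorem modifiedCoflowRHS_eq_of_eq {s : SU3Structure N} {dr : DForm 𝓘(ℝ, ℝ) L ℝ 1}
    {k C : ℝ} {G h θ : L → ℝ} {A B : DForm I7 (N × L) ℝ 4}
    (hA : hodgeLaplacian (k := 3) (l := 2) (n := 7) rfl (warpedMetric s dr G h)
      (warpedVol s dr G h) (warpedPsi s dr G h θ) = A)
    (hB : extD (fun p => (C - warpedTraceTorsion s dr G h θ p) • warpedPhi s dr G h θ p) = B) :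
    modifiedCoflowRHS s dr k C G h θ = A + k • B :=
  congrArg₂ (fun a b : DForm I7 (N × L) ℝ 4 => a + k • b) hA hB

/-- The coefficient `m = α - 3β + k (C - Tr T)` in the modified coflow. -/
def coflowFactor (k C α β : ℝ) : ℝ := α - 3 * β + k * (C - (α - 6 * β))

namespace IsCoclosedWarped

variable {s : SU3Structure N} {lam : ℝ} {dr : DForm 𝓘(ℝ, ℝ) L ℝ 1} {G h θ : L → ℝ}

theorem hasRDerivAt_trace [Nonempty N] (H : IsCoclosedWarped s lam dr G h θ) (l : L) :
    HasRDerivAt dr (fun x => torsionAlpha dr G θ x - 6 * torsionBeta lam h θ x)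
      (rDeriv dr (fun x => torsionAlpha dr G θ x - 6 * torsionBeta lam h θ x) l) l :=
  ((H.hasRDerivAt_alpha l).sub ((H.hasRDerivAt_beta l).const_mul 6)).mdifferentiableAt.hasRDerivAt
    H.dr_ne

/-- The right-hand side is `d (m P + (m - α - β) η ∧ w)` with `m = coflowFactor`, as `-4β + k (C -
Tr T) = m - α - β`. Writing `α' = (Tr T)' + 6β'` gives `m' = (1 - k) (Tr T)' + 3β'`, where `β'` is
explicit. -/
theorem modifiedCoflowRHS_eq [Nonempty N] (H : IsCoclosedWarped s lam dr G h θ) (k C : ℝ) :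
    modifiedCoflowRHS s dr k C G h θ =
      warpedFourForm s dr
        (fun l => -(2 * lam * coflowFactor k C (torsionAlpha dr G θ l) (torsionBeta lam h θ l) *
          (h l ^ 3 * Real.sin (θ l))))
        (fun l => ((1 - k) *
            rDeriv dr (fun x => torsionAlpha dr G θ x - 6 * torsionBeta lam h θ x) l +
              3 * (lam * (h l)⁻¹ * Real.cos (θ l) * G l *
                (torsionAlpha dr G θ l + torsionBeta lam h θ l))) * (h l ^ 3 * Real.cos (θ l)) +
          coflowFactor k C (torsionAlpha dr G θ l) (torsionBeta lam h θ l) *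
            (3 * h l ^ 2 * (-(lam * G l * Real.cos (θ l))) * Real.cos (θ l) -
              h l ^ 3 * Real.sin (θ l) * (G l * torsionAlpha dr G θ l)) +
          3 * lam * (G l * h l ^ 2) *
            (coflowFactor k C (torsionAlpha dr G θ l) (torsionBeta lam h θ l) -
              torsionAlpha dr G θ l - torsionBeta lam h θ l))
        (fun l => -(((1 - k) *
            rDeriv dr (fun x => torsionAlpha dr G θ x - 6 * torsionBeta lam h θ x) l +
              3 * (lam * (h l)⁻¹ * Real.cos (θ l) * G l *
                (torsionAlpha dr G θ l + torsionBeta lam h θ l))) * (h l ^ 3 * Real.sin (θ l)) +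
          coflowFactor k C (torsionAlpha dr G θ l) (torsionBeta lam h θ l) *
            (3 * h l ^ 2 * (-(lam * G l * Real.cos (θ l))) * Real.sin (θ l) +
              h l ^ 3 * Real.cos (θ l) * (G l * torsionAlpha dr G θ l)))) := by
  have hτ := H.hasRDerivAt_trace
  have hb := H.hasRDerivAt_beta
  have hre := H.hasRDerivAt_re
  have him := fun l => (H.hasRDerivAt_im l).neg
  have hw := fun l => (H.hasRDerivAt_G l).mul ((H.hasRDerivAt_h l).pow 2)
  have hm1 := fun l => (H.hasRDerivAt_alpha l).sub ((H.hasRDerivAt_beta l).const_mul 3)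
  have hm2 := fun l => (HasRDerivAt.const (dr := dr) (l := l) C).sub (hτ l)
  have hφ : (fun p : N × L => (C - warpedTraceTorsion s dr G h θ p) • warpedPhi s dr G h θ p) =
      warpedThreeForm s dr
        (fun l => (C - (torsionAlpha dr G θ l - 6 * torsionBeta lam h θ l)) * (h l ^ 3 * Real.cos (θ l)))
        (fun l => (C - (torsionAlpha dr G θ l - 6 * torsionBeta lam h θ l)) * -(h l ^ 3 * Real.sin (θ l)))
        (fun l => (C - (torsionAlpha dr G θ l - 6 * torsionBeta lam h θ l)) * (G l * h l ^ 2)) := by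
    rw [← smul_warpedThreeForm, ← warpedPhi_eq]
    funext p
    rw [H.traceTorsion_eq]
  have hα' : ∀ l, rDeriv dr (torsionAlpha dr G θ) l =
      rDeriv dr (fun x => torsionAlpha dr G θ x - 6 * torsionBeta lam h θ x) l +
      6 * (lam * (h l)⁻¹ * Real.cos (θ l) * G l *
        (torsionAlpha dr G θ l + torsionBeta lam h θ l)) := fun l => by
    have := ((H.hasRDerivAt_alpha l).sub ((hb l).const_mul 6)).rDeriv_eq (H.dr_ne l)
    linear_combination -this
  have hA := H.hodgeLaplacian_warpedPsi.trans
    (extD_warpedThreeForm H.su3 H.smooth_dr H.dr_ne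
      (fun l => ((hm1 l).mul (hre l)).mdifferentiableAt)
      (fun l => ((hm1 l).mul (him l)).mdifferentiableAt)
      (fun l => (((hb l).const_mul (-4)).mul (hw l)).mdifferentiableAt))
  have hB := (congrArg extD hφ).trans (extD_warpedThreeForm H.su3 H.smooth_dr H.dr_ne
      (fun l => ((hm2 l).mul (hre l)).mdifferentiableAt)
      (fun l => ((hm2 l).mul (him l)).mdifferentiableAt)
      (fun l => ((hm2 l).mul (hw l)).mdifferentiableAt))
  refine (modifiedCoflowRHS_eq_of_eq hA hB).trans ((warpedFourForm_add_smul ..).trans ?_)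
  congr 1
  · funext l
    rw [coflowFactor]
    ring
  · funext l
    rw [((hm1 l).mul (hre l)).rDeriv_eq (H.dr_ne l), ((hm2 l).mul (hre l)).rDeriv_eq (H.dr_ne l),
      hα', coflowFactor]
    ring
  · funext l
    rw [((hm1 l).mul (him l)).rDeriv_eq (H.dr_ne l), ((hm2 l).mul (him l)).rDeriv_eq (H.dr_ne l),
      hα', coflowFactor]
    ring

end IsCoclosedWarped

end CoflowRHS

/-! ### Equivalence of the coflow with the system for `G`, `θ` and `h`. -/

section FlowEquivalence

variable {N : Type*} [TopologicalSpace N] [ChartedSpace E6 N] [IsManifold (𝓡 6) (⊤ : ℕ∞) N]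
  {L : Type*} [TopologicalSpace L] [ChartedSpace ℝ L] [IsManifold 𝓘(ℝ, ℝ) (⊤ : ℕ∞) L]

/-- The three basic 4-forms are independent of time, so only coefficients are differentiated.
Tangent vectors isolating each coefficient and uniqueness of derivatives within `S` give the forward
direction. -/
theorem hasDerivWithinAt_warpedFourForm_iff (s : SU3Structure N) {dr : DForm 𝓘(ℝ, ℝ) L ℝ 1}
    (hdr0 : ∀ l, dr l ≠ 0) {S : Set ℝ} {t : ℝ} (hS : UniqueDiffWithinAt ℝ S t)
    {u v w : ℝ → L → ℝ} {u' v' w' : L → ℝ} {p : N × L} {a b c : ℝ}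
    (hu : HasDerivWithinAt (fun τ => u τ p.2) a S t)
    (hv : HasDerivWithinAt (fun τ => v τ p.2) b S t)
    (hw : HasDerivWithinAt (fun τ => w τ p.2) c S t) :
    (∀ z : Fin 4 → TangentSpace I7 p,
      HasDerivWithinAt (fun τ => warpedFourForm s dr (u τ) (v τ) (w τ) p z)
        (warpedFourForm s dr u' v' w' p z) S t) ↔ a = u' p.2 ∧ b = v' p.2 ∧ c = w' p.2 := by
  constructor
  · intro H
    obtain ⟨e, he, z₁, z₂, z₃, hz⟩ := exists_eval_warpedFourForm s hdr0 p
    have h1 := H z₁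
    have h2 := H z₂
    have h3 := H z₃
    simp only [(hz _ _ _).1] at h1
    simp only [(hz _ _ _).2.1] at h2
    simp only [(hz _ _ _).2.2] at h3
    exact ⟨mul_right_cancel₀ two_ne_zero (hS.eq_deriv _ (hu.mul_const 2) h1),
      mul_right_cancel₀ he (hS.eq_deriv _ (hv.mul_const e) h2),
      mul_right_cancel₀ he (hS.eq_deriv _ (hw.mul_const e) h3)⟩
  · rintro ⟨rfl, rfl, rfl⟩ z
    simp only [warpedFourForm_apply]
    exact ((hu.mul_const _).add (hv.mul_const _)).add (hw.mul_const _)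

/-- The coefficients of the coflow, rewritten as equations for `G`, `θ` and `h`. -/
theorem coflow_coefficients_iff {lam G h s c α β m δ G' h' θ' : ℝ} (hG : G ≠ 0) (hh : h ≠ 0)
    (hsc : s ^ 2 + c ^ 2 = 1) (hβ : β * h = lam * s) :
    (2 * h ^ 3 * h' = -(2 * lam * m * (h ^ 3 * s)) ∧
      -(G' * (h ^ 3 * s) + G * (3 * h ^ 2 * h' * s + h ^ 3 * (c * θ'))) =
        (-δ + 3 * (lam * h⁻¹ * c * G * (α + β))) * (h ^ 3 * c) +
          m * (3 * h ^ 2 * (-(lam * G * c)) * c - h ^ 3 * s * (G * α)) +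
          3 * lam * (G * h ^ 2) * (m - α - β) ∧
      -(G' * (h ^ 3 * c) + G * (3 * h ^ 2 * h' * c + h ^ 3 * (-s * θ'))) =
        -((-δ + 3 * (lam * h⁻¹ * c * G * (α + β))) * (h ^ 3 * s) +
          m * (3 * h ^ 2 * (-(lam * G * c)) * s + h ^ 3 * c * (G * α)))) ↔
    G' / G = m * α + 3 * α * β + 3 * β ^ 2 ∧ θ' = G⁻¹ * δ ∧ h' / h = -(m * β) := by
  have hi : lam * h⁻¹ * h ^ 3 = lam * h ^ 2 := by field_simp
  have h3 := pow_ne_zero 3 hh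
  rw [div_eq_iff hG, div_eq_iff hh]
  have hθ : θ' = G⁻¹ * δ ↔ G * θ' = δ := by
    rw [eq_inv_mul_iff_mul_eq₀ hG]
  rw [hθ]
  constructor
  · rintro ⟨e1, e2, e3⟩
    -- The `ω²` coefficient determines `h'` alone, through `λ sin θ = β h`.
    have a1 : h' = -(m * β) * h := by
      refine mul_left_cancel₀ (mul_ne_zero two_ne_zero h3) ?_
      linear_combination e1 + 2 * m * h ^ 3 * hβ
    subst a1
    refine ⟨mul_left_cancel₀ h3 ?_, mul_left_cancel₀ h3 ?_, rfl⟩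
    -- Rotation by `θ`: this combination eliminates `θ'` and isolates `G'`, using `s² + c² = 1`.
    · linear_combination -s * e2 - c * e3 +
        (-h ^ 3 * G' + 3 * G * h ^ 3 * m * β + m * h ^ 3 * G * α) * hsc +
        3 * G * h ^ 2 * (m - α - β) * hβ
    -- The orthogonal combination eliminates `G'` and `h'` and isolates `θ'`; `hi` clears the `h⁻¹`
    -- that comes from `β'`.
    · linear_combination -c * e2 + s * e3 +
        (-h ^ 3 * G * θ' + δ * h ^ 3 + 3 * lam * G * h ^ 2 * c * (m - α - β)) * hsc -
        3 * c * G * (α + β) * (s ^ 2 + c ^ 2) * hi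
  · rintro ⟨rfl, rfl, rfl⟩
    refine ⟨?_, ?_, ?_⟩
    · linear_combination -2 * m * h ^ 3 * hβ
    · linear_combination -3 * c ^ 2 * G * (α + β) * hi +
        3 * lam * G * h ^ 2 * (m - α - β) * hsc + 3 * G * h ^ 2 * s * (m - α - β) * hβ
    · linear_combination 3 * c * s * G * (α + β) * hi + 3 * G * h ^ 2 * c * (m - α - β) * hβ

/-- The modified coflow at one time and over one point of the line factor, in terms of `G`, `θ`
and `h`. -/
theorem hasDerivWithinAt_warpedPsi_iff [Nonempty N] {s : SU3Structure N} {lam : ℝ}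
    {dr : DForm 𝓘(ℝ, ℝ) L ℝ 1} {G h θ : ℝ → L → ℝ} {S : Set ℝ} {t : ℝ}
    (H : IsCoclosedWarped s lam dr (G t) (h t) (θ t)) (hS : UniqueDiffWithinAt ℝ S t)
    (k C : ℝ) (p : N × L) {G' h' θ' : ℝ}
    (hG : HasDerivWithinAt (fun τ => G τ p.2) G' S t)
    (hh : HasDerivWithinAt (fun τ => h τ p.2) h' S t)
    (hθ : HasDerivWithinAt (fun τ => θ τ p.2) θ' S t) :
    (∀ z : Fin 4 → TangentSpace I7 p,
      HasDerivWithinAt (fun τ => warpedPsi s dr (G τ) (h τ) (θ τ) p z)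
        (modifiedCoflowRHS s dr k C (G t) (h t) (θ t) p z) S t) ↔
      G' / G t p.2 = (1 - k) * torsionAlpha dr (G t) (θ t) p.2 ^ 2 +
          3 * torsionBeta lam (h t) (θ t) p.2 ^ 2 +
          6 * k * torsionAlpha dr (G t) (θ t) p.2 * torsionBeta lam (h t) (θ t) p.2 +
          k * C * torsionAlpha dr (G t) (θ t) p.2 ∧
        θ' = (k - 1) * (G t p.2)⁻¹ * rDeriv dr
          (fun x => torsionAlpha dr (G t) (θ t) x - 6 * torsionBeta lam (h t) (θ t) x) p.2 ∧
        h' / h t p.2 = 3 * (1 - 2 * k) * torsionBeta lam (h t) (θ t) p.2 ^ 2 +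
          (k - 1) * torsionAlpha dr (G t) (θ t) p.2 * torsionBeta lam (h t) (θ t) p.2 -
          k * C * torsionBeta lam (h t) (θ t) p.2 := by
  have d1 : HasDerivWithinAt (fun τ => h τ p.2 ^ 4 / 2) (2 * h t p.2 ^ 3 * h') S t := by
    refine ((hh.pow 4).div_const 2).congr_deriv ?_
    norm_num
    ring
  have d3 : HasDerivWithinAt (fun τ => h τ p.2 ^ 3) (3 * h t p.2 ^ 2 * h') S t :=
    (hh.pow 3).congr_deriv (by norm_num)
  have d2 : HasDerivWithinAt (fun τ => -(G τ p.2 * (h τ p.2 ^ 3 * Real.sin (θ τ p.2))))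
      (-(G' * (h t p.2 ^ 3 * Real.sin (θ t p.2)) + G t p.2 *
        (3 * h t p.2 ^ 2 * h' * Real.sin (θ t p.2) +
          h t p.2 ^ 3 * (Real.cos (θ t p.2) * θ')))) S t :=
    (hG.mul (d3.mul hθ.sin)).neg
  have d4 : HasDerivWithinAt (fun τ => -(G τ p.2 * (h τ p.2 ^ 3 * Real.cos (θ τ p.2))))
      (-(G' * (h t p.2 ^ 3 * Real.cos (θ t p.2)) + G t p.2 *
        (3 * h t p.2 ^ 2 * h' * Real.cos (θ t p.2) +
          h t p.2 ^ 3 * (-Real.sin (θ t p.2) * θ')))) S t :=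
    (hG.mul (d3.mul hθ.cos)).neg
  simp only [warpedPsi_eq, H.modifiedCoflowRHS_eq]
  rw [hasDerivWithinAt_warpedFourForm_iff s H.dr_ne hS d1 d2 d4]
  refine Iff.trans (Iff.trans ?_ (coflow_coefficients_iff (G' := G') (h' := h') (θ' := θ')
    (α := torsionAlpha dr (G t) (θ t) p.2)
    (m := coflowFactor k C (torsionAlpha dr (G t) (θ t) p.2) (torsionBeta lam (h t) (θ t) p.2))
    (δ := (k - 1) * rDeriv dr
      (fun x => torsionAlpha dr (G t) (θ t) x - 6 * torsionBeta lam (h t) (θ t) x) p.2)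
    (H.G_ne p.2) (H.h_ne p.2) (Real.sin_sq_add_cos_sq (θ t p.2)) (H.mul_torsionBeta p.2))) ?_
  · refine and_congr Iff.rfl (and_congr (Eq.congr rfl ?_) (Eq.congr rfl ?_)) <;> ring
  · refine and_congr (Eq.congr rfl ?_) (and_congr (Eq.congr rfl ?_) (Eq.congr rfl ?_))
    · rw [coflowFactor]
      ring
    · ring
    · rw [coflowFactor]
      ring

end FlowEquivalence

/-! ### Evolution of `α` and `β` along the flow. -/

section TorsionEvolution

variable {N : Type*} [TopologicalSpace N] [ChartedSpace E6 N] [IsManifold (𝓡 6) (⊤ : ℕ∞) N]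
  {L : Type*} [TopologicalSpace L] [ChartedSpace ℝ L] [IsManifold 𝓘(ℝ, ℝ) (⊤ : ℕ∞) L]

namespace IsCoclosedWarped

variable {s : SU3Structure N} {lam : ℝ} {dr : DForm 𝓘(ℝ, ℝ) L ℝ 1} {G h θ : L → ℝ}

theorem smooth_alpha (H : IsCoclosedWarped s lam dr G h θ) :
    ContMDiff 𝓘(ℝ, ℝ) 𝓘(ℝ, ℝ) (⊤ : ℕ∞) (torsionAlpha dr G θ) :=
  (contMDiff_rDeriv H.smooth_dr H.dr_ne H.smooth_θ).div₀ H.smooth_G H.G_ne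

theorem smooth_beta (H : IsCoclosedWarped s lam dr G h θ) :
    ContMDiff 𝓘(ℝ, ℝ) 𝓘(ℝ, ℝ) (⊤ : ℕ∞) (torsionBeta lam h θ) :=
  (contMDiff_const.mul (H.smooth_h.inv₀ H.h_ne)).mul
    (Real.contDiff_sin.contMDiff.comp H.smooth_θ)

theorem smooth_trace (H : IsCoclosedWarped s lam dr G h θ) :
    ContMDiff 𝓘(ℝ, ℝ) 𝓘(ℝ, ℝ) (⊤ : ℕ∞)
      (fun x => torsionAlpha dr G θ x - 6 * torsionBeta lam h θ x) :=
  H.smooth_alpha.sub (contMDiff_const.mul H.smooth_beta)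

theorem hasRDerivAt_θ_velocity (H : IsCoclosedWarped s lam dr G h θ) (k : ℝ) (l : L) :
    HasRDerivAt dr (fun l => (k - 1) * (G l)⁻¹ *
        rDeriv dr (fun x => torsionAlpha dr G θ x - 6 * torsionBeta lam h θ x) l)
      ((k - 1) * (-(G l ^ 2)⁻¹ * rDeriv dr G l) *
          rDeriv dr (fun x => torsionAlpha dr G θ x - 6 * torsionBeta lam h θ x) l +
        (k - 1) * (G l)⁻¹ *
          rDeriv dr (rDeriv dr fun x => torsionAlpha dr G θ x - 6 * torsionBeta lam h θ x) l) l :=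
  (((H.hasRDerivAt_G l).inv (H.G_ne l)).const_mul (k - 1)).mul
    (((contMDiff_rDeriv H.smooth_dr H.dr_ne H.smooth_trace).mdifferentiable
      (by simp) l).hasRDerivAt H.dr_ne)

end IsCoclosedWarped

variable {s : SU3Structure N} {lam : ℝ} {dr : DForm 𝓘(ℝ, ℝ) L ℝ 1} {G h θ : ℝ → L → ℝ}
  {S : Set ℝ} {t : ℝ} {k C : ℝ}

/-- From `α = θ' / G` the quotient rule gives `(∂θ/∂t)' / G - α (∂G/∂t) / G`. The first term yields
the second-order part and the second the polynomial in `α` and `β`. -/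
theorem EvolutionEquations.hasDerivWithinAt_torsionAlpha
    (E : EvolutionEquations lam dr k C S G h θ)
    (hS : S.OrdConnected) (hS' : S.Nontrivial) (ht : t ∈ S)
    (hG : ContMDiffOn (𝓘(ℝ, ℝ).prod 𝓘(ℝ, ℝ)) 𝓘(ℝ, ℝ) (⊤ : ℕ∞)
      (fun q : ℝ × L => G q.1 q.2) (S ×ˢ Set.univ))
    (hθ : ContMDiffOn (𝓘(ℝ, ℝ).prod 𝓘(ℝ, ℝ)) 𝓘(ℝ, ℝ) (⊤ : ℕ∞)
      (fun q : ℝ × L => θ q.1 q.2) (S ×ˢ Set.univ))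
    (H : IsCoclosedWarped s lam dr (G t) (h t) (θ t)) (l : L) :
    let α := torsionAlpha dr (G t) (θ t)
    let β := torsionBeta lam (h t) (θ t)
    let τ := fun x => α x - 6 * β x
    HasDerivWithinAt (fun u => torsionAlpha dr (G u) (θ u) l)
      ((k - 1) * (G t l ^ 2)⁻¹ *
          (-(rDeriv dr (G t) l / G t l) * rDeriv dr τ l + rDeriv dr (rDeriv dr τ) l) +
        (k - 1) * α l ^ 3 - 6 * k * β l * α l ^ 2 - 3 * β l ^ 2 * α l - k * C * α l ^ 2) S t := by
  intro α β τ
  have hv := H.hasRDerivAt_θ_velocity k l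
  have h1 := hasDerivWithinAt_rDeriv hS hS' dr hθ ht (fun l => (E t ht l).2.1)
    hv.mdifferentiableAt
  rw [hv.rDeriv_eq (H.dr_ne l)] at h1
  have h2 := hasDerivWithinAt_time hG ht l
  have hG0 := H.G_ne l
  have hGt := (div_eq_iff hG0).1 (E t ht l).1
  refine (h1.div h2 hG0).congr_deriv ?_
  rw [hGt, ← mul_div_cancel_left₀ (rDeriv dr (θ t) l) hG0, mul_div_assoc]
  rw [show rDeriv dr (θ t) l / G t l = α l from rfl]
  field_simp
  ring

/-- The chain rule produces `λ h⁻¹ cos θ · ∂θ/∂t`, and `λ h⁻¹ cos θ` equals `β' / (G (α + β))` where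
`α + β ≠ 0`. The remaining term is `-β` times the logarithmic derivative of `h`. -/
theorem EvolutionEquations.hasDerivWithinAt_torsionBeta [Nonempty N]
    (E : EvolutionEquations lam dr k C S G h θ) (ht : t ∈ S)
    (hh : ContMDiffOn (𝓘(ℝ, ℝ).prod 𝓘(ℝ, ℝ)) 𝓘(ℝ, ℝ) (⊤ : ℕ∞)
      (fun q : ℝ × L => h q.1 q.2) (S ×ˢ Set.univ))
    (hθ : ContMDiffOn (𝓘(ℝ, ℝ).prod 𝓘(ℝ, ℝ)) 𝓘(ℝ, ℝ) (⊤ : ℕ∞)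
      (fun q : ℝ × L => θ q.1 q.2) (S ×ˢ Set.univ))
    (H : IsCoclosedWarped s lam dr (G t) (h t) (θ t)) (l : L) :
    let α := torsionAlpha dr (G t) (θ t)
    let β := torsionBeta lam (h t) (θ t)
    let τ := fun x => α x - 6 * β x
    α l + β l ≠ 0 →
      HasDerivWithinAt (fun u => torsionBeta lam (h u) (θ u) l)
        ((k - 1) * (G t l ^ 2)⁻¹ * rDeriv dr τ l * (rDeriv dr β l / (α l + β l)) +
          (1 - k) * β l ^ 2 * α l + 3 * (2 * k - 1) * β l ^ 3 + k * C * β l ^ 2) S t := by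
  intro α β τ hαβ
  have h1 := hasDerivWithinAt_time hh ht l
  have h2 := hasDerivWithinAt_time hθ ht l
  have hG0 := H.G_ne l
  have hh0 := H.h_ne l
  have hht := (div_eq_iff hh0).1 (E t ht l).2.2
  refine (((h1.fun_inv hh0).const_mul lam).mul h2.sin).congr_deriv ?_
  rw [hht, (E t ht l).2.1, (H.hasRDerivAt_beta l).rDeriv_eq (H.dr_ne l)]
  have hβ : lam * Real.sin (θ t l) = β l * h t l := (H.mul_torsionBeta l).symm
  change _ = (k - 1) * (G t l ^ 2)⁻¹ * rDeriv dr τ l *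
    (lam * (h t l)⁻¹ * Real.cos (θ t l) * G t l * (α l + β l) / (α l + β l)) + _ + _ + _
  rw [mul_div_cancel_right₀ _ hαβ]
  change lam * (-((3 * (1 - 2 * k) * β l ^ 2 + (k - 1) * α l * β l - k * C * β l) * h t l) /
    h t l ^ 2) * Real.sin (θ t l) + lam * (h t l)⁻¹ * (Real.cos (θ t l) *
      ((k - 1) * (G t l)⁻¹ * rDeriv dr τ l)) = _
  field_simp
  linear_combination (-(3 * (1 - 2 * k) * β l ^ 2 + (k - 1) * α l * β l - k * C * β l) * G t l) * hβ

end TorsionEvolution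

end

theorem mainTheorem4
    {N : Type*} [TopologicalSpace N] [ChartedSpace E6 N] [IsManifold (𝓡 6) (⊤ : ℕ∞) N]
    [Nonempty N]
    {L : Type*} [TopologicalSpace L] [ChartedSpace ℝ L] [IsManifold 𝓘(ℝ, ℝ) (⊤ : ℕ∞) L]
    (s : SU3Structure N) (lam : ℝ) (hs : s.IsCalabiYauOrNearlyKahler lam)
    (dr : DForm 𝓘(ℝ, ℝ) L ℝ 1) (hdr : dr.IsSmooth) (hdr0 : ∀ l, dr l ≠ 0)
    (k C : ℝ)
    (S : Set ℝ) (hS : S.OrdConnected) (hS' : S.Nontrivial)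
    (G h θ : ℝ → L → ℝ)
    (hG : ContMDiffOn (𝓘(ℝ, ℝ).prod 𝓘(ℝ, ℝ)) 𝓘(ℝ, ℝ) (⊤ : ℕ∞)
      (fun q : ℝ × L => G q.1 q.2) (S ×ˢ Set.univ))
    (hh : ContMDiffOn (𝓘(ℝ, ℝ).prod 𝓘(ℝ, ℝ)) 𝓘(ℝ, ℝ) (⊤ : ℕ∞)
      (fun q : ℝ × L => h q.1 q.2) (S ×ˢ Set.univ))
    (hθ : ContMDiffOn (𝓘(ℝ, ℝ).prod 𝓘(ℝ, ℝ)) 𝓘(ℝ, ℝ) (⊤ : ℕ∞)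
      (fun q : ℝ × L => θ q.1 q.2) (S ×ˢ Set.univ))
    (hGpos : ∀ t ∈ S, ∀ l, 0 < G t l) (hhne : ∀ t ∈ S, ∀ l, h t l ≠ 0)
    (hcoclosed : ∀ t ∈ S, ∀ p : N × L, extD (warpedPsi s dr (G t) (h t) (θ t)) p = 0) :
    (∀ t ∈ S, ∀ p : N × L, warpedTraceTorsion s dr (G t) (h t) (θ t) p =
      torsionAlpha dr (G t) (θ t) p.2 - 6 * torsionBeta lam (h t) (θ t) p.2) ∧
    (∀ t ∈ S, ∀ l, torsionGamma lam dr (G t) (h t) (θ t) l = 0) ∧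
    (IsModifiedCoflow s dr k C S G h θ ↔ EvolutionEquations lam dr k C S G h θ) ∧
    (IsModifiedCoflow s dr k C S G h θ → ∀ t ∈ S, ∀ l : L,
      let α := torsionAlpha dr (G t) (θ t)
      let β := torsionBeta lam (h t) (θ t)
      let τ := fun x => α x - 6 * β x
      HasDerivWithinAt (fun u => torsionAlpha dr (G u) (θ u) l)
        ((k - 1) * (G t l ^ 2)⁻¹ *
            (-(rDeriv dr (G t) l / G t l) * rDeriv dr τ l + rDeriv dr (rDeriv dr τ) l) +
          (k - 1) * α l ^ 3 - 6 * k * β l * α l ^ 2 - 3 * β l ^ 2 * α l - k * C * α l ^ 2) S t ∧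
      (α l + β l ≠ 0 →
        HasDerivWithinAt (fun u => torsionBeta lam (h u) (θ u) l)
          ((k - 1) * (G t l ^ 2)⁻¹ * rDeriv dr τ l * (rDeriv dr β l / (α l + β l)) +
            (1 - k) * β l ^ 2 * α l + 3 * (2 * k - 1) * β l ^ 3 + k * C * β l ^ 2) S t)) := by
  have H : ∀ t ∈ S, IsCoclosedWarped s lam dr (G t) (h t) (θ t) := fun t ht =>
    { su3 := hs
      smooth_dr := hdr
      dr_ne := hdr0
      smooth_G := contMDiff_slice hG ht
      smooth_h := contMDiff_slice hh ht
      smooth_θ := contMDiff_slice hθ ht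
      G_ne := fun l => (hGpos t ht l).ne'
      h_ne := hhne t ht
      coclosed := hcoclosed t ht }
  have hiff : ∀ t (ht : t ∈ S) (p : N × L), _ := fun t ht p =>
    hasDerivWithinAt_warpedPsi_iff (H t ht) (uniqueDiffOn_of_ordConnected hS hS' t ht) k C p
      (hasDerivWithinAt_time hG ht p.2) (hasDerivWithinAt_time hh ht p.2)
      (hasDerivWithinAt_time hθ ht p.2)
  -- The equations live on `L`, so testing the flow over a single point of `N` is enough to recover
  -- them.
  have hflow : IsModifiedCoflow s dr k C S G h θ ↔ EvolutionEquations lam dr k C S G h θ :=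
    ⟨fun F t ht l => (hiff t ht (Classical.arbitrary N, l)).1 (F t ht _),
      fun E t ht p => (hiff t ht p).2 (E t ht p.2)⟩
  exact ⟨fun t ht p => (H t ht).traceTorsion_eq p, fun t ht l => (H t ht).torsionGamma_eq_zero l,
    hflow, fun F t ht l =>
      ⟨(hflow.1 F).hasDerivWithinAt_torsionAlpha hS hS' ht hG hθ (H t ht) l,
        (hflow.1 F).hasDerivWithinAt_torsionBeta ht hh hθ (H t ht) l⟩⟩
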